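/- Let $k,\omega,f,\gamma\in\mathbb R$ with $\omega^2=k^2+1$, let $S=S(x_2,t_2)$ be a smooth real function on $\mathbb R^2$, and consider $$\mathcal P_\varepsilon[U]=\partial_t^2U-\partial_x^2U+\Bigl(1+\varepsilon f\cos\frac{S(\varepsilon^2x,\varepsilon^2t)}{\varepsilon^2}\Bigr)U+\gamma U^3=0,\qquad \varepsilon>0,\quad x_j=\varepsilon^jx,\ t_j=\varepsilon^jt .$$ Put $\chi_{j,m}=j(kx_2+\omega t_2)+mS$, $L[\chi]=(\partial_{t_2}\chi)^2-(\partial_{x_2}\chi)^2-1$, $l=L[\chi_{1,1}]$, $\zeta=\omega x_1+kt_1$, $\Omega_1=\{(\pm1,0)\}$ and, for $n\ge2$, $\Omega_n=\Omega_{n-1}\cup\{(j,m\pm1):(j,m)\in\Omega_{n-1}\}\cup\{p_1+p_2+p_3:\ p_q\in\Omega_{l_q},\ l_q\ge1,\ l_1+l_2+l_3=n\}$. Let $N\ge1$, let $M_N=\bigcup_{q\le\max(N,2)}\Omega_q\setminus\{(\pm1,0)\}$, and let $D$ be an open set of points $(x_2,t_2)$ on which $l<0$, all derivatives of $S$ of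 order $\ge1$ are bounded, and $L[\chi_p]\ne0$ for all $p\in M_N$. Let $\rho=\min(1,\min_{p\in M_N}|L[\chi_p]|)$. Consider $$U=\sum_{n=1}^N\varepsilon^nU_n,\qquad U_n=\sum_{p\in\Omega_n}u_{n,p}(x_1,t_1,x_2,t_2)\,e^{i\chi_p/\varepsilon^2},\qquad u_{n,-p}=\overline{u_{n,p}},$$ with $u_{n,p}$ smooth on $\mathbb R^2\times D$ (and $u_{n,p}=0$ if $n\le0$ or $p\notin\Omega_n$). Write $p=(j,m)$, and let $$\begin{aligned}F_{n,p}={}&2i(\partial_{t_2}\chi_p\,\partial_{t_1}-\partial_{x_2}\chi_p\,\partial_{x_1})u_{n-1,p}+(\partial_{t_1}^2-\partial_{x_1}^2)u_{n-2,p}+2i(\partial_{t_2}\chi_p\,\partial_{t_2}-\partial_{x_2}\chi_p\,\partial_{x_2})u_{n-2,p}\\&+i(\partial_{t_2}^2\chi_p-\partial_{x_2}^2\chi_p)u_{n-2,p}+2(\partial_{t_1}\partial_{t_2}-\partial_{x_1}\partial_{x_2})u_{n-3,p}+(\partial_{t_2}^2-\partial_{x_2}^2)u_{n-4,p}\\&+\tfrac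 f2(u_{n-1,(j,m-1)}+u_{n-1,(j,m+1)})+\gamma\!\!\sum_{q_1+q_2+q_3=n,\ p_1+p_2+p_3=p}\!\!u_{q_1,p_1}u_{q_2,p_2}u_{q_3,p_3},\end{aligned}$$ so that the coefficient of $\varepsilon^ne^{i\chi_p/\varepsilon^2}$ in $\mathcal P_\varepsilon[U]$ is $-L[\chi_p]u_{n,p}+F_{n,p}$ for $n\le N$. Consider the equations (i) (algebraic equations, $n\le N$, $p\in\Omega_n\setminus\{(\pm1,0)\}$) $\ u_{n,p}=F_{n,p}/L[\chi_p]$; (ii) $u_{n,(1,0)}$ depends on $(x_1,t_1)$ only through $\zeta$; (iii) (NLS-type equation, $n=1$) $a=u_{1,(1,0)}$ satisfies, with $g=\frac1{L[\chi_{1,-1}]}+\frac1{L[\chi_{1,1}]}$, $$2i(\omega\partial_{t_2}-k\partial_{x_2})a-\partial_\zeta^2a+3\gamma|a|^2a+\tfrac{f^2}4g\,a=0;$$ (iv) (linearized equations, $n\ge2$) $a=u_{n,(1,0)}$ satisfies $$2i(\omega\partial_{t_2}-k\partial_{x_2})a-\partial_\zeta^2a+3\gamma\bigl(2|u_{1,(1,0)}|^2a+u_{1,(1,0)}^2\bar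 a\bigr)+\tfrac{f^2}4g\,a+R_n=0,$$ where $R_n$ is obtained by setting $u_{n,(\pm1,0)}=0$ in $\tfrac f2\bigl(\tfrac{F_{n+1,(1,1)}}{L[\chi_{1,1}]}+\tfrac{F_{n+1,(1,-1)}}{L[\chi_{1,-1}]}\bigr)+\gamma\sum u_{q_1,p_1}u_{q_2,p_2}u_{q_3,p_3}+2(\partial_{t_1}\partial_{t_2}-\partial_{x_1}\partial_{x_2})u_{n-1,(1,0)}+(\partial_{t_2}^2-\partial_{x_2}^2)u_{n-2,(1,0)}$, the sum being over $q_1+q_2+q_3=n+2$, $p_1+p_2+p_3=(1,0)$. Then: 1. For any smooth $a_1,\dots,a_N$ on $\mathbb R^2\times D$ there is exactly one such expansion with $u_{n,(1,0)}=a_n$ $(1\le n\le N)$ that satisfies (i). 2. Suppose that each $u_{n,(1,0)}$, $n\le N$, is bounded in $(x_1,t_1)$ for each $(x_2,t_2)\in D$. Then the coefficients of $\varepsilon^ne^{i\chi_p/\varepsilon^2}$ in the equation vanish for all $n\le N$ and all $p\in\mathbb Z^2$ if and only if (i) holds for $n\le N$, (ii) for $n\le N-1$, and (iii), (iv) for $n\le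 N-2$. 3. (Validity for $\varepsilon^{-1}|L[\chi_p]|\gg1$.) Say that $v$ has singularities of order at most $r$ if each derivative $\partial^\alpha v$ is $O(\rho^{-r-s})$ uniformly on $\mathbb R^2\times D$, where $s$ is the number of derivatives in $x_2,t_2$ in $\partial^\alpha$. Let (i)-(iv) hold for all $n\le N$, and let $u_{n,(1,0)}$ have singularities of order at most $n-1$ for all $n\le N$. Then so do all $u_{n,p}$, $U$ is real, and there is a constant $C$ such that, whenever $(\varepsilon^2x,\varepsilon^2t)\in D$ and $\varepsilon\le\rho=\rho(\varepsilon^2x,\varepsilon^2t)$, $$|\varepsilon^nU_n|\le C\varepsilon\Bigl(\frac\varepsilon\rho\Bigr)^{n-1}\ (1\le n\le N),\qquad |\mathcal P_\varepsilon[U]|\le C\varepsilon^2\Bigl(\frac\varepsilon\rho\Bigr)^{N-1};$$ in particular $\mathcal P_\varepsilon[U]=O(\varepsilon^{N+1})$ at a fixed distance from the resonant curves $L[\chi_p]=0$. 4. The bounds on $u_{n,(1,0)}$ supposed in 3 hold for localized wave packets if the group lines are transversal to the resonant curves. That is, let (i)-(iv) hold for all $n\le N$, let $D_0\subseteq D$,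 and suppose: (a) there are $T$ and $c>0$ such that for each $z\in D$ there is $s_0$ with $|s_0|\le T$, $z+s_0(-k/\omega,1)\in D_0$, and, for all $s$ between $0$ and $s_0$, $z+s(-k/\omega,1)\in D$ and $\rho(z+s(-k/\omega,1))\ge c(\rho(z)+|s|)$; (b) each $u_{n,(1,0)}$ and all its derivatives decay faster than any power of $\zeta$, uniformly for $(x_2,t_2)$ in compact subsets of $D$; (c) on $D_0$, $(1+|\zeta|)^d\,\partial^\alpha u_{n,(1,0)}=O(\rho^{-(n-1)-s})$ for all $d$, $\alpha$ ($s$ as in 3). Then $u_{n,(1,0)}$ has singularities of order at most $n-1$ on $D$ for all $n\le N$. -/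

import Mathlib

open scoped ContDiff BigOperators

noncomputable section

namespace WKB

/-- Constants and phase function of the driven equation
`U_tt - U_xx + (1 + ε f cos (S (ε² x, ε² t) / ε²)) U + γ U³ = 0`,
with the wave number `k` and the frequency `ω` (the field `om`) of the carrier wave.
The two arguments of `S` are the slow variables `(x₂, t₂)`. -/
structure Driver where
  k : ℝ
  om : ℝ
  f : ℝ
  γ : ℝ
  S : ℝ × ℝ → ℝ

/-- A mode `(j, m)`. -/
abbrev Mode := ℤ × ℤ

/-- A function of `(x₁, t₁, x₂, t₂)`; the coordinates are numbered `0, 1, 2, 3`. -/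
abbrev Amp := (Fin 4 → ℝ) → ℂ

/-- A family of amplitudes `u n (j, m)`. -/
abbrev Family := ℕ → Mode → Amp

/-! ### Modes, phases, resonances -/

/-- The sets `Ω_n`. There is no mode of order zero, so the triples below effectively
run over positive `l₁, l₂, l₃`. -/
def Omega : ℕ → Finset Mode
  | 0 => ∅
  | 1 => {(1, 0), (-1, 0)}
  | n + 2 =>
      Omega (n + 1)
        ∪ (Omega (n + 1)).image (fun p => (p.1, p.2 + 1))
        ∪ (Omega (n + 1)).image (fun p => (p.1, p.2 - 1))
        ∪ ((Finset.univ : Finset (Fin (n + 2) × Fin (n + 2) × Fin (n + 2))).filter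
            (fun l => l.1.val + l.2.1.val + l.2.2.val = n + 2)).biUnion
            (fun l => (Omega l.1.val ×ˢ Omega l.2.1.val ×ˢ Omega l.2.2.val).image
              (fun q => q.1 + q.2.1 + q.2.2))
  termination_by n => n
  decreasing_by
    all_goals first
      | exact Nat.lt_succ_self _
      | exact l.1.isLt
      | exact l.2.1.isLt
      | exact l.2.2.isLt

/-- The partial derivative in `x₂` of a function of `(x₂, t₂)`. -/
def dx (χ : ℝ × ℝ → ℝ) (z : ℝ × ℝ) : ℝ := fderiv ℝ χ z (1, 0)

/-- The partial derivative in `t₂` of a function of `(x₂, t₂)`. -/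
def dt (χ : ℝ × ℝ → ℝ) (z : ℝ × ℝ) : ℝ := fderiv ℝ χ z (0, 1)

/-- `L[χ] = (∂_{t₂} χ)² - (∂_{x₂} χ)² - 1`. -/
def eikonal (χ : ℝ × ℝ → ℝ) (z : ℝ × ℝ) : ℝ := dt χ z ^ 2 - dx χ z ^ 2 - 1

/-- `χ_{j,m} = j (k x₂ + ω t₂) + m S`. -/
def phase (P : Driver) (p : Mode) (z : ℝ × ℝ) : ℝ :=
  (p.1 : ℝ) * (P.k * z.1 + P.om * z.2) + (p.2 : ℝ) * P.S z

/-- `l = L[ω t₂ + k x₂ + S]`. -/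
def ell (P : Driver) (z : ℝ × ℝ) : ℝ :=
  eikonal (fun w => P.om * w.2 + P.k * w.1 + P.S w) z

/-- `g = 1 / L[ω t₂ + k x₂ - S] + 1 / L[ω t₂ + k x₂ + S]`. -/
def gFun (P : Driver) (z : ℝ × ℝ) : ℝ :=
  1 / eikonal (fun w => P.om * w.2 + P.k * w.1 - P.S w) z
    + 1 / eikonal (fun w => P.om * w.2 + P.k * w.1 + P.S w) z

/-- The modes of the first `N` orders (of the first two orders, if `N = 1`: the functions
`L[χ_{1,±1}]` occur already in the equation of the leading amplitude), without the two
carrier modes `(±1, 0)`, for which `L` vanishes identically. -/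
def drivenModes (N : ℕ) : Finset Mode :=
  ((Finset.Icc 1 (max N 2)).biUnion Omega).filter (fun p => p ≠ (1, 0) ∧ p ≠ (-1, 0))

/-- `ρ = min (1, min |L[χ_{j,m}]|)`, the minimum over the modes in `drivenModes N`. -/
def resDist (P : Driver) (N : ℕ) (z : ℝ × ℝ) : ℝ :=
  (drivenModes N).fold min 1 (fun p => |eikonal (phase P p) z|)

/-! ### Amplitudes -/

/-- The slow coordinates `(x₂, t₂)` of a point. -/
def slow (y : Fin 4 → ℝ) : ℝ × ℝ := (y 2, y 3)

/-- `ζ = ω x₁ + k t₁`. -/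
def zeta (P : Driver) (y : Fin 4 → ℝ) : ℝ := P.om * y 0 + P.k * y 1

/-- The set of all `(x₁, t₁, x₂, t₂)` with `(x₂, t₂) ∈ D`. -/
def dom (D : Set (ℝ × ℝ)) : Set (Fin 4 → ℝ) := {y | slow y ∈ D}

/-- The partial derivative in the `i`-th coordinate. -/
def pd (i : Fin 4) (v : Amp) : Amp := fun y => fderiv ℝ v y (Pi.single i 1)

/-- Iterated partial derivatives. -/
def pds (l : List (Fin 4)) (v : Amp) : Amp := l.foldr pd v

/-- How many of the derivatives in the list are in a slow variable `x₂`, `t₂`. -/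
def slowCount (l : List (Fin 4)) : ℕ := l.countP (fun i => decide (2 ≤ i))

/-- `∂_ζ` of a function that depends on `(x₁, t₁)` through `ζ = ω x₁ + k t₁` only. -/
def dzeta (P : Driver) (v : Amp) : Amp := fun y => (P.om : ℂ)⁻¹ * pd 0 v y

/-- `v` depends on `(x₁, t₁)` through `ζ` only. -/
def DependsOnZeta (P : Driver) (D : Set (ℝ × ℝ)) (v : Amp) : Prop :=
  ∀ y ∈ dom D, ∀ y' ∈ dom D, slow y = slow y' → zeta P y = zeta P y' → v y = v y'

/-- The ansatz of order `N`: smooth amplitudes of order `n` for the modes in `Ω_n` only,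
which add up to real functions. -/
structure IsAnsatz (D : Set (ℝ × ℝ)) (N : ℕ) (u : Family) : Prop where
  smooth : ∀ n ≤ N, ∀ p, ContDiffOn ℝ ∞ (u n p) (dom D)
  support : ∀ n ≤ N, ∀ p, p ∉ Omega n → ∀ y ∈ dom D, u n p y = 0
  real : ∀ n ≤ N, ∀ p, ∀ y ∈ dom D, u n (-p) y = (starRingEnd ℂ) (u n p y)

/-- The functions `U_n = ∑ u_{n,(j,m)} exp (i χ_{j,m} / ε²)`. -/
def wkbTerm (P : Driver) (u : Family) (n : ℕ) (ε x t : ℝ) : ℂ :=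
  ∑ p ∈ Omega n, u n p ![ε * x, ε * t, ε ^ 2 * x, ε ^ 2 * t]
    * Complex.exp (Complex.I * ((phase P p (ε ^ 2 * x, ε ^ 2 * t) / ε ^ 2 : ℝ) : ℂ))

/-- `U = ∑_{n=1}^N εⁿ U_n`. -/
def wkb (P : Driver) (u : Family) (N : ℕ) (ε x t : ℝ) : ℂ :=
  ∑ n ∈ Finset.Icc 1 N, (ε : ℂ) ^ n * wkbTerm P u n ε x t

/-- The left-hand side of the driven nonlinear Klein-Gordon equation. -/
def kleinGordon (P : Driver) (ε : ℝ) (U : ℝ → ℝ → ℂ) (x t : ℝ) : ℂ :=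
  iteratedDeriv 2 (fun s => U x s) t - iteratedDeriv 2 (fun s => U s t) x
    + ((1 + ε * P.f * Real.cos (P.S (ε ^ 2 * x, ε ^ 2 * t) / ε ^ 2) : ℝ) : ℂ) * U x t
    + (P.γ : ℂ) * U x t ^ 3

/-! ### The recurrent system -/

/-- The coefficient of `εⁿ exp (i χ_p / ε²)` in `U³`. -/
def cubic (u : Family) (n : ℕ) (p : Mode) : Amp := fun y =>
  ∑ q ∈ (Finset.range (n + 1) ×ˢ Finset.range (n + 1) ×ˢ Finset.range (n + 1)).filter
      (fun q => q.1 + q.2.1 + q.2.2 = n),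
    ∑ r ∈ (Omega q.1 ×ˢ Omega q.2.1 ×ˢ Omega q.2.2).filter
        (fun r => r.1 + r.2.1 + r.2.2 = p),
      u q.1 r.1 y * u q.2.1 r.2.1 y * u q.2.2 r.2.2 y

/-- All contributions of the orders below `n` to the coefficient of `εⁿ exp (i χ_p / ε²)` that
results from the substitution of `∑ εⁿ U_n` in the equation. (Amplitudes of order zero vanish,
so that truncated subtraction does no harm.) -/
def lower (P : Driver) (u : Family) (n : ℕ) (p : Mode) : Amp := fun y =>
  2 * Complex.I * ((dt (phase P p) (slow y) : ℂ) * pd 1 (u (n - 1) p) y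
      - (dx (phase P p) (slow y) : ℂ) * pd 0 (u (n - 1) p) y)
    + (pd 1 (pd 1 (u (n - 2) p)) y - pd 0 (pd 0 (u (n - 2) p)) y)
    + 2 * Complex.I * ((dt (phase P p) (slow y) : ℂ) * pd 3 (u (n - 2) p) y
      - (dx (phase P p) (slow y) : ℂ) * pd 2 (u (n - 2) p) y)
    + Complex.I * ((dt (dt (phase P p)) (slow y) - dx (dx (phase P p)) (slow y) : ℝ) : ℂ)
      * u (n - 2) p y
    + 2 * (pd 1 (pd 3 (u (n - 3) p)) y - pd 0 (pd 2 (u (n - 3) p)) y)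
    + (pd 3 (pd 3 (u (n - 4) p)) y - pd 2 (pd 2 (u (n - 4) p)) y)
    + (P.f : ℂ) / 2 * (u (n - 1) (p.1, p.2 - 1) y + u (n - 1) (p.1, p.2 + 1) y)
    + (P.γ : ℂ) * cubic u n p y

/-- The coefficients of `εⁿ exp (i χ_p / ε²)` in the equation vanish for all `n ≤ N` and all
modes `p`. -/
def IsFormalSolution (P : Driver) (D : Set (ℝ × ℝ)) (N : ℕ) (u : Family) : Prop :=
  ∀ n ≤ N, ∀ p : Mode, ∀ y ∈ dom D,
    -(eikonal (phase P p) (slow y) : ℂ) * u n p y + lower P u n p y = 0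

/-- The amplitude of order `n` of the mode `p` as the algebraic equation gives it. -/
def algAmp (P : Driver) (u : Family) (n : ℕ) (p : Mode) : Amp := fun y =>
  1 / (eikonal (phase P p) (slow y) : ℂ) * lower P u n p y

/-- The algebraic equations for `(j, m) ≠ (±1, 0)` up to the order `N`. -/
def AlgebraicEqs (P : Driver) (D : Set (ℝ × ℝ)) (N : ℕ) (u : Family) : Prop :=
  ∀ n, 1 ≤ n → n ≤ N → ∀ p ∈ Omega n, p ≠ (1, 0) → p ≠ (-1, 0) →
    ∀ y ∈ dom D, u n p y = algAmp P u n p y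

/-- The NLS-type equation
`2i (ω ∂_{t₂} - k ∂_{x₂}) a - ∂_ζ² a + 3 γ |a|² a + (f²/4) g a = 0`. -/
def LeadingEq (P : Driver) (D : Set (ℝ × ℝ)) (a : Amp) : Prop :=
  ∀ y ∈ dom D,
    2 * Complex.I * ((P.om : ℂ) * pd 3 a y - (P.k : ℂ) * pd 2 a y)
      - dzeta P (dzeta P a) y
      + 3 * (P.γ : ℂ) * (‖a y‖ ^ 2 : ℝ) * a y
      + (P.f : ℂ) ^ 2 / 4 * (gFun P (slow y) : ℂ) * a y = 0

/-- The family with the amplitudes of the modes `(±1, 0)` of order `n` removed. -/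
def dropCarrier (n : ℕ) (u : Family) : Family := fun q p =>
  if q = n ∧ (p = (1, 0) ∨ p = (-1, 0)) then 0 else u q p

/-- The terms of the resonant mode `(1, 0)` at order `n + 2`, except for the derivatives of
the amplitudes of orders `n` and `n + 1` of this mode. -/
def carrierTerms (P : Driver) (u : Family) (n : ℕ) : Amp := fun y =>
  (P.f : ℂ) / 2 * (algAmp P u (n + 1) (1, 1) y + algAmp P u (n + 1) (1, -1) y)
    + (P.γ : ℂ) * cubic u (n + 2) (1, 0) y
    + 2 * (pd 1 (pd 3 (u (n - 1) (1, 0))) y - pd 0 (pd 2 (u (n - 1) (1, 0))) y)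
    + (pd 3 (pd 3 (u (n - 2) (1, 0))) y - pd 2 (pd 2 (u (n - 2) (1, 0))) y)

/-- The equation for `a = u_{n,(1,0)}`, `n ≥ 2`: the linearization of the leading equation at
`u_{1,(1,0)}`, with a source that consists of amplitudes which do not depend on `a`. -/
def LinearizedEq (P : Driver) (D : Set (ℝ × ℝ)) (u : Family) (n : ℕ) : Prop :=
  ∀ y ∈ dom D,
    2 * Complex.I * ((P.om : ℂ) * pd 3 (u n (1, 0)) y - (P.k : ℂ) * pd 2 (u n (1, 0)) y)
      - dzeta P (dzeta P (u n (1, 0))) y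
      + 3 * (P.γ : ℂ) * (2 * (‖u 1 (1, 0) y‖ ^ 2 : ℝ) * u n (1, 0) y
          + u 1 (1, 0) y ^ 2 * (starRingEnd ℂ) (u n (1, 0) y))
      + (P.f : ℂ) ^ 2 / 4 * (gFun P (slow y) : ℂ) * u n (1, 0) y
      + carrierTerms P (dropCarrier n u) n y = 0

/-- The amplitudes `u_{n,(1,0)}`, `1 ≤ n ≤ N`, depend on `(x₁, t₁)` through `ζ` only. -/
def CarrierZeta (P : Driver) (D : Set (ℝ × ℝ)) (N : ℕ) (u : Family) : Prop :=
  ∀ n, 1 ≤ n → n ≤ N → DependsOnZeta P D (u n (1, 0))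

/-- The differential equations for `u_{n,(1,0)}`, `1 ≤ n ≤ N`. -/
def CarrierEqs (P : Driver) (D : Set (ℝ × ℝ)) (N : ℕ) (u : Family) : Prop :=
  (1 ≤ N → LeadingEq P D (u 1 (1, 0))) ∧
    ∀ n, 2 ≤ n → n ≤ N → LinearizedEq P D u n

/-! ### Size of the amplitudes near the resonant curves -/

/-- `v` has singularities of order at most `r` on the resonant curves: uniformly in `(x₁, t₁)`,
`v` and its derivatives in `x₁, t₁` are `O (ρ ^ (-r))`, and each derivative in `x₂` or
`t₂` costs one more power of `ρ`. -/
def SingularOrder (P : Driver) (N : ℕ) (D : Set (ℝ × ℝ)) (r : ℕ) (v : Amp) : Prop :=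
  ∀ l : List (Fin 4), ∃ C : ℝ, ∀ y ∈ dom D,
    ‖pds l v y‖ ≤ C / resDist P N (slow y) ^ (r + slowCount l)

/-- The same on a subset `D₀` (where data are given), with rapid decay in `ζ`. -/
def DecayingData (P : Driver) (N : ℕ) (D₀ : Set (ℝ × ℝ)) (r : ℕ) (v : Amp) : Prop :=
  ∀ (d : ℕ) (l : List (Fin 4)), ∃ C : ℝ, ∀ y ∈ dom D₀,
    (1 + |zeta P y|) ^ d * ‖pds l v y‖ ≤ C / resDist P N (slow y) ^ (r + slowCount l)

/-- `v` and its derivatives decay rapidly in `ζ`, locally uniformly in `(x₂, t₂) ∈ D`. -/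
def LocallyDecaying (P : Driver) (D : Set (ℝ × ℝ)) (v : Amp) : Prop :=
  ∀ K ⊆ D, IsCompact K → ∀ (d : ℕ) (l : List (Fin 4)), ∃ C : ℝ, ∀ y ∈ dom K,
    (1 + |zeta P y|) ^ d * ‖pds l v y‖ ≤ C

/-- Each point of `D` is joined with a point of `D₀` by a segment in `D` of bounded length of
a group line `x₂ + (k/ω) t₂ = const`, along which the distance to the resonances grows at least
linearly: the group lines meet the resonant curves transversally. -/
def TransversalFrom (P : Driver) (N : ℕ) (D D₀ : Set (ℝ × ℝ)) : Prop :=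
  ∃ T c : ℝ, 0 < c ∧ ∀ z ∈ D, ∃ s₀ : ℝ, |s₀| ≤ T ∧
    z + s₀ • ((-P.k / P.om, 1) : ℝ × ℝ) ∈ D₀ ∧
    ∀ s ∈ Set.uIcc 0 s₀, z + s • ((-P.k / P.om, 1) : ℝ × ℝ) ∈ D ∧
      c * (resDist P N z + |s|) ≤ resDist P N (z + s • ((-P.k / P.om, 1) : ℝ × ℝ))

end WKB

end

open WKB

open WKB

namespace WKB

/-! ### Calculus of amplitudes on `dom D` -/

/-! The coefficient of order `n` and mode `p` is `-L[χ_p] u_{n,p} + F_{n,p}`, and `F_{n,p}` contains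
only lower orders. Off the carrier modes `(±1, 0)` the factor `L[χ_p]` has no zero on `D`, so the
equation is solved by division. On the carrier modes `L` vanishes identically, by the dispersion
relation, and the equation turns into a solvability condition. The carrier amplitudes are therefore
free data of the algebraic recursion (`existsUnique_algebraic`), and `F_{n,-p}` being conjugate to
`F_{n,p}` keeps the expansion real (`lower_neg`).

Solvability. `F_{n+2,(1,0)}` is `2i (ω ∂_{t₁} - k ∂_{x₁}) u_{n+1,(1,0)}` plus terms that, by
induction, depend on the fast variables through `ζ` only. Those terms are constant on the
characteristics of the transport operator, so they would make `u_{n+1,(1,0)}` grow linearly;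
boundedness forces both parts to vanish separately (`transport_of_bounded`). The first part says
that `u_{n+1,(1,0)}` is a function of `ζ`. The second is the equation of `u_{n,(1,0)}`: on functions
of `ζ` the wave operator is `-∂_ζ²`, the feedback of the sidebands `(1, ±1)` gives `f² g / 4`, and
the cubic term gives the nonlinearity or its linearization (`carrierTerms_one`,
`carrierTerms_drop`).

Singularities. Powers of `1/ρ` are counted. Division by `L` costs one power, a slow derivative costs
one more (`BddCoef.isCoef_inv`), and every term of `F_m` has order at most `m - 2`
(`AmpClass.lower`); hence `u_m` has order `m - 1`. The same induction serves smoothness, dependence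
on `ζ`, size and square integrability, so it is carried out once, for an abstract `AmpClass`. The
residual is an exact finite sum (`kleinGordon_eq_sum`): its orders up to `N` cancel, and an order `n
> N` contributes `ε^n ρ^{-(n-2)} = ε² (ε/ρ)^{n-2}`.

Localized packets. The equations of the carrier amplitudes are Schrödinger equations along the group
lines, with the real potential `f² g / 4` of size `1/ρ`. Being real, it does not affect the `L²`
norm over `x₁`; being constant in `x₁`, it does not spoil the conservation of energy. It is felt
only when slow derivatives fall on it, and the commutator is then one power of `1/ρ` too large.
Transversality regains this power, since `∫ (ρ + |s|)^{-e-1} ds` is `O(ρ^{-e})` for `e ≥ 1`; the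
quantitative form is `le_of_singular_growth`. The leading amplitude is bounded by conservation of
mass and energy and then differentiated (`SolvesNLS.localized`); the corrections solve linear
equations whose source has one order more than the solution, which is again admissible
(`Transported.localized_linear`). Sobolev's inequality in `x₁` costs no power of `ρ` and turns the
`L²` bounds into pointwise ones. -/

/-- Smooth amplitudes on `dom D`. -/
abbrev SmoothAmp (D : Set (ℝ × ℝ)) (v : Amp) : Prop := ContDiffOn ℝ ∞ v (dom D)

theorem contDiff_slow : ContDiff ℝ ∞ slow :=
  (contDiff_apply ℝ ℝ (2 : Fin 4)).prodMk (contDiff_apply ℝ ℝ (3 : Fin 4))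

theorem isOpen_dom {D : Set (ℝ × ℝ)} (hD : IsOpen D) : IsOpen (dom D) :=
  hD.preimage contDiff_slow.continuous

theorem dom_mem_nhds {D : Set (ℝ × ℝ)} (hD : IsOpen D) {y : Fin 4 → ℝ} (hy : y ∈ dom D) :
    dom D ∈ nhds y := (isOpen_dom hD).mem_nhds hy

theorem SmoothAmp.differentiableAt {D : Set (ℝ × ℝ)} (hD : IsOpen D) {v : Amp}
    (hv : SmoothAmp D v) {y : Fin 4 → ℝ} (hy : y ∈ dom D) : DifferentiableAt ℝ v y :=
  (hv.contDiffAt (dom_mem_nhds hD hy)).differentiableAt (by simp)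

theorem SmoothAmp.pd {D : Set (ℝ × ℝ)} (hD : IsOpen D) {v : Amp} (hv : SmoothAmp D v)
    (i : Fin 4) : SmoothAmp D (pd i v) :=
  (hv.fderiv_of_isOpen (isOpen_dom hD) (by simp)).clm_apply contDiffOn_const

theorem SmoothAmp.pds {D : Set (ℝ × ℝ)} (hD : IsOpen D) {v : Amp} (hv : SmoothAmp D v)
    (l : List (Fin 4)) : SmoothAmp D (pds l v) := by
  induction l with
  | nil => exact hv
  | cons i l ih => exact SmoothAmp.pd hD ih i

@[simp] theorem pds_nil (v : Amp) : pds [] v = v := rfl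

@[simp] theorem pds_cons (i : Fin 4) (l : List (Fin 4)) (v : Amp) :
    pds (i :: l) v = pd i (pds l v) := rfl

theorem pds_append (l l' : List (Fin 4)) (v : Amp) : pds (l ++ l') v = pds l (pds l' v) := by
  simp [pds, List.foldr_append]

theorem SmoothAmp.congr_amp {D : Set (ℝ × ℝ)} {v w : Amp} (hv : SmoothAmp D v)
    (h : Set.EqOn v w (dom D)) : SmoothAmp D w := hv.congr h.symm

theorem pd_congr {D : Set (ℝ × ℝ)} (hD : IsOpen D) {v w : Amp} (h : Set.EqOn v w (dom D))
    (i : Fin 4) : Set.EqOn (pd i v) (pd i w) (dom D) := fun y hy => by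
  simp only [pd]
  rw [Filter.EventuallyEq.fderiv_eq (h.eventuallyEq_of_mem (dom_mem_nhds hD hy))]

theorem pds_congr {D : Set (ℝ × ℝ)} (hD : IsOpen D) {v w : Amp} (h : Set.EqOn v w (dom D))
    (l : List (Fin 4)) : Set.EqOn (pds l v) (pds l w) (dom D) := by
  induction l with
  | nil => exact h
  | cons i l ih => exact pd_congr hD ih i

@[simp] theorem pd_zero (i : Fin 4) : pd i (0 : Amp) = 0 := by
  funext y; simp [pd, show (0 : Amp) = fun _ => 0 from rfl]

@[simp] theorem pds_zero (l : List (Fin 4)) : pds l (0 : Amp) = 0 := by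
  induction l with
  | nil => rfl
  | cons i l ih => rw [pds_cons, ih, pd_zero]

theorem pds_eqOn_zero {D : Set (ℝ × ℝ)} (hD : IsOpen D) {v : Amp}
    (h : Set.EqOn v 0 (dom D)) (l : List (Fin 4)) : Set.EqOn (pds l v) 0 (dom D) := by
  have := pds_congr hD h l
  rwa [pds_zero] at this

theorem pd_add {D : Set (ℝ × ℝ)} (hD : IsOpen D) {v w : Amp} (hv : SmoothAmp D v)
    (hw : SmoothAmp D w) (i : Fin 4) : Set.EqOn (pd i (v + w)) (pd i v + pd i w) (dom D) :=
  fun y hy => by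
    simp only [pd, Pi.add_apply]
    rw [fderiv_add (hv.differentiableAt hD hy) (hw.differentiableAt hD hy)]
    rfl

theorem pds_add {D : Set (ℝ × ℝ)} (hD : IsOpen D) {v w : Amp} (hv : SmoothAmp D v)
    (hw : SmoothAmp D w) (l : List (Fin 4)) :
    Set.EqOn (pds l (v + w)) (pds l v + pds l w) (dom D) := by
  induction l with
  | nil => exact fun _ _ => rfl
  | cons i l ih => exact (pd_congr hD ih i).trans (pd_add hD (hv.pds hD l) (hw.pds hD l) i)

theorem pd_mul {D : Set (ℝ × ℝ)} (hD : IsOpen D) {v w : Amp} (hv : SmoothAmp D v)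
    (hw : SmoothAmp D w) (i : Fin 4) :
    Set.EqOn (pd i (v * w)) (pd i v * w + v * pd i w) (dom D) := fun y hy => by
  simp only [pd, Pi.add_apply, Pi.mul_apply]
  rw [fderiv_mul (hv.differentiableAt hD hy) (hw.differentiableAt hD hy)]
  simp only [add_apply, smul_apply, smul_eq_mul]
  ring

theorem SmoothAmp.add {D : Set (ℝ × ℝ)} {v w : Amp} (hv : SmoothAmp D v)
    (hw : SmoothAmp D w) : SmoothAmp D (v + w) := ContDiffOn.add hv hw

theorem SmoothAmp.mul {D : Set (ℝ × ℝ)} {v w : Amp} (hv : SmoothAmp D v)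
    (hw : SmoothAmp D w) : SmoothAmp D (v * w) := ContDiffOn.mul hv hw

theorem smoothAmp_const {D : Set (ℝ × ℝ)} (c : ℂ) : SmoothAmp D (fun _ => c) :=
  contDiffOn_const

theorem pd_const (i : Fin 4) (c : ℂ) : pd i (fun _ => c) = 0 := by
  funext y; simp [pd]

theorem pd_const_mul {D : Set (ℝ × ℝ)} (hD : IsOpen D) {v : Amp} (hv : SmoothAmp D v) (c : ℂ)
    (i : Fin 4) : Set.EqOn (pd i (fun y => c * v y)) (fun y => c * pd i v y) (dom D) :=
  fun y hy => by
    simp only [pd]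
    rw [fderiv_const_mul (hv.differentiableAt hD hy)]
    rfl

theorem pds_const_mul {D : Set (ℝ × ℝ)} (hD : IsOpen D) {v : Amp} (hv : SmoothAmp D v) (c : ℂ)
    (l : List (Fin 4)) : Set.EqOn (pds l (fun y => c * v y)) (fun y => c * pds l v y) (dom D) := by
  induction l with
  | nil => exact fun _ _ => rfl
  | cons i l ih => exact (pd_congr hD ih i).trans (pd_const_mul hD (hv.pds hD l) c i)

/-- Complex conjugation of amplitudes. -/
def cconj (v : Amp) : Amp := fun y => (starRingEnd ℂ) (v y)

theorem SmoothAmp.cconj {D : Set (ℝ × ℝ)} {v : Amp} (hv : SmoothAmp D v) :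
    SmoothAmp D (cconj v) :=
  Complex.conjCLE.contDiff.comp_contDiffOn hv

theorem pd_cconj {D : Set (ℝ × ℝ)} (hD : IsOpen D) {v : Amp} (hv : SmoothAmp D v)
    (i : Fin 4) : Set.EqOn (pd i (cconj v)) (cconj (pd i v)) (dom D) := fun y hy => by
  have h := (Complex.conjCLE.toContinuousLinearMap.hasFDerivAt (x := v y)).comp y
    (hv.differentiableAt hD hy).hasFDerivAt
  have h' : fderiv ℝ (cconj v) y
      = Complex.conjCLE.toContinuousLinearMap.comp (fderiv ℝ v y) := h.fderiv
  simp only [pd, h']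
  simp [WKB.cconj, pd]

theorem pds_cconj {D : Set (ℝ × ℝ)} (hD : IsOpen D) {v : Amp} (hv : SmoothAmp D v)
    (l : List (Fin 4)) : Set.EqOn (pds l (cconj v)) (cconj (pds l v)) (dom D) := by
  induction l with
  | nil => exact fun _ _ => rfl
  | cons i l ih => exact (pd_congr hD ih i).trans (pd_cconj hD (hv.pds hD l) i)

theorem pd_comm {D : Set (ℝ × ℝ)} (hD : IsOpen D) {v : Amp} (hv : SmoothAmp D v)
    (i j : Fin 4) : Set.EqOn (pd i (pd j v)) (pd j (pd i v)) (dom D) := fun y hy => by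
  have h1 : ContDiffAt ℝ ∞ v y := hv.contDiffAt (dom_mem_nhds hD hy)
  have hs : IsSymmSndFDerivAt ℝ v y := h1.isSymmSndFDerivAt (by
    simpa using (WithTop.coe_le_coe.2 (le_top : (2 : ℕ∞) ≤ ⊤)))
  have hd : DifferentiableAt ℝ (fderiv ℝ v) y :=
    (h1.fderiv_right (m := ∞) (by simp)).differentiableAt (by simp)
  have key : ∀ a b : Fin 4, pd a (pd b v) y
      = fderiv ℝ (fderiv ℝ v) y (Pi.single a 1) (Pi.single b 1) := by
    intro a b
    have := (hd.hasFDerivAt.clm_apply (hasFDerivAt_const (Pi.single b (1 : ℝ)) y)).fderiv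
    change fderiv ℝ (fun y => fderiv ℝ v y (Pi.single b 1)) y (Pi.single a 1) = _
    rw [this]
    simp
  rw [key, key]
  exact hs _ _

theorem pd_pds_comm {D : Set (ℝ × ℝ)} (hD : IsOpen D) {v : Amp} (hv : SmoothAmp D v)
    (i : Fin 4) (l : List (Fin 4)) :
    Set.EqOn (pds l (pd i v)) (pd i (pds l v)) (dom D) := by
  induction l with
  | nil => exact fun _ _ => rfl
  | cons j l ih => exact (pd_congr hD ih j).trans (pd_comm hD (hv.pds hD l) j i)

/-! ### The Leibniz rule -/

/-- `l` is an interleaving of `a` and `b`. -/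
inductive Split : List (Fin 4) → List (Fin 4) → List (Fin 4) → Prop
  | nil : Split [] [] []
  | left (i : Fin 4) {l a b : List (Fin 4)} : Split l a b → Split (i :: l) (i :: a) b
  | right (i : Fin 4) {l a b : List (Fin 4)} : Split l a b → Split (i :: l) a (i :: b)

theorem Split.length {l a b : List (Fin 4)} (h : Split l a b) :
    a.length + b.length = l.length := by
  induction h with
  | nil => rfl
  | left i _ ih => simp only [List.length_cons]; omega
  | right i _ ih => simp only [List.length_cons]; omega

@[simp] theorem slowCount_nil : slowCount [] = 0 := rfl

theorem slowCount_cons (i : Fin 4) (l : List (Fin 4)) :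
    slowCount (i :: l) = slowCount l + slowCount [i] := by
  simp [slowCount, List.countP_cons]

theorem slowCount_append (l l' : List (Fin 4)) :
    slowCount (l ++ l') = slowCount l + slowCount l' := by
  simp [slowCount, List.countP_append]

theorem Split.slowCount {l a b : List (Fin 4)} (h : Split l a b) :
    slowCount a + slowCount b = slowCount l := by
  induction h with
  | nil => rfl
  | @left i l a b _ ih => rw [slowCount_cons i a, slowCount_cons i l]; omega
  | @right i l a b _ ih => rw [slowCount_cons i b, slowCount_cons i l]; omega

theorem Split.symm {l a b : List (Fin 4)} (h : Split l a b) : Split l b a := by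
  induction h with
  | nil => exact .nil
  | left i _ ih => exact .right i ih
  | right i _ ih => exact .left i ih

theorem Split.eq_of_left_nil {l b : List (Fin 4)} (h : Split l [] b) : b = l := by
  induction l generalizing b with
  | nil => cases h; rfl
  | cons i l ih => cases h with | right _ h => rw [ih h]

/-- Leibniz' rule: a property of sums holds for `pds l (v * w)` if it holds for the products
`pds a v * pds b w` of the expansion. -/
theorem leibniz_induction {D : Set (ℝ × ℝ)} (hD : IsOpen D) {v w : Amp} (hv : SmoothAmp D v)
    (hw : SmoothAmp D w) (l : List (Fin 4)) (Q : Amp → Prop)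
    (hadd : ∀ f g : Amp, SmoothAmp D f → SmoothAmp D g → Q f → Q g → Q (f + g))
    (hcongr : ∀ f g : Amp, SmoothAmp D f → Set.EqOn f g (dom D) → Q f → Q g)
    (h : ∀ a b, Split l a b → Q (pds a v * pds b w)) : Q (pds l (v * w)) := by
  induction l generalizing Q with
  | nil => exact h [] [] .nil
  | cons i l ih =>
    rw [pds_cons]
    -- The outer derivative is moved into the predicate, which is why `Q` is generalized in the
    -- induction.
    refine ih (fun f => Q (pd i f)) ?_ ?_ ?_
    · intro f g hf hg h1 h2
      exact hcongr _ _ ((hf.pd hD i).add (hg.pd hD i)) (pd_add hD hf hg i).symm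
        (hadd _ _ (hf.pd hD i) (hg.pd hD i) h1 h2)
    · intro f g hf hfg h1
      exact hcongr _ _ (hf.pd hD i) (pd_congr hD hfg i) h1
    · intro a b hab
      have e := pd_mul hD (hv.pds hD a) (hw.pds hD b) i
      have s1 := ((hv.pds hD a).pd hD i).mul (hw.pds hD b)
      have s2 := (hv.pds hD a).mul ((hw.pds hD b).pd hD i)
      exact hcongr _ _ (s1.add s2) e.symm
        (hadd _ _ s1 s2 (h _ _ (.left i hab)) (h _ _ (.right i hab)))

/-- Leibniz' rule without the term in which all derivatives fall on the second factor. -/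
theorem leibniz_commutator_induction {D : Set (ℝ × ℝ)} (hD : IsOpen D) {v w : Amp}
    (hv : SmoothAmp D v) (hw : SmoothAmp D w) (l : List (Fin 4)) (Q : Amp → Prop)
    (hzero : Q 0)
    (hadd : ∀ f g : Amp, SmoothAmp D f → SmoothAmp D g → Q f → Q g → Q (f + g))
    (hcongr : ∀ f g : Amp, SmoothAmp D f → Set.EqOn f g (dom D) → Q f → Q g)
    (h : ∀ a b, Split l a b → a ≠ [] → Q (pds a v * pds b w)) :
    Q (pds l (v * w) - v * pds l w) := by
  induction l generalizing Q with
  | nil =>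
    have : pds [] (v * w) - v * pds [] w = 0 := by simp
    rw [this]; exact hzero
  | cons i l ih =>
    have sl := (hv.mul hw).pds hD l
    have sr := hv.mul (hw.pds hD l)
    have sd : SmoothAmp D (pds l (v * w) - v * pds l w) := ContDiffOn.sub sl sr
    have s2 := (hv.pd hD i).mul (hw.pds hD l)
    -- With `l` extended by `i`, the commutator is the derivative of the previous commutator plus
    -- the single new term `(∂_i v) ∂^l w`, in which `v` is differentiated.
    refine hcongr (pd i (pds l (v * w) - v * pds l w) + pd i v * pds l w) _
      ((sd.pd hD i).add s2) ?_ (hadd _ _ (sd.pd hD i) s2 ?_ ?_)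
    · intro y hy
      have e1 : pd i (pds l (v * w) - v * pds l w) y
          = pd i (pds l (v * w)) y - pd i (v * pds l w) y := by
        simp only [pd]
        rw [fderiv_sub (sl.differentiableAt hD hy) (sr.differentiableAt hD hy)]
        rfl
      have e2 := pd_mul hD hv (hw.pds hD l) i hy
      simp only [Pi.add_apply, Pi.mul_apply, Pi.sub_apply, pds_cons] at e1 e2 ⊢
      rw [e1, e2]; ring
    · refine ih (fun f => Q (pd i f)) (by simpa using hzero) ?_ ?_ ?_
      · intro f g hf hg h1 h2
        exact hcongr _ _ ((hf.pd hD i).add (hg.pd hD i)) (pd_add hD hf hg i).symm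
          (hadd _ _ (hf.pd hD i) (hg.pd hD i) h1 h2)
      · intro f g hf hfg h1
        exact hcongr _ _ (hf.pd hD i) (pd_congr hD hfg i) h1
      · intro a b hab ha
        have e := pd_mul hD (hv.pds hD a) (hw.pds hD b) i
        have s1 := ((hv.pds hD a).pd hD i).mul (hw.pds hD b)
        have s2 := (hv.pds hD a).mul ((hw.pds hD b).pd hD i)
        exact hcongr _ _ (s1.add s2) e.symm (hadd _ _ s1 s2
          (h _ _ (.left i hab) (by simp)) (h _ _ (.right i hab) ha))
    · have hs : Split l [] l := by
        clear * -
        induction l with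
        | nil => exact .nil
        | cons i l ih => exact .right i ih
      exact h [i] l (.left i hs) (by simp)

/-! ### Functions of the slow variables -/

/-- A real function of `(x₂, t₂)` as an amplitude. -/
def liftSlow (φ : ℝ × ℝ → ℝ) : Amp := fun y => (φ (slow y) : ℂ)

/-- Iterated directional derivatives of a function of `(x₂, t₂)`. -/
noncomputable def dirs (l : List (ℝ × ℝ)) (φ : ℝ × ℝ → ℝ) : ℝ × ℝ → ℝ :=
  l.foldr (fun e ψ z => fderiv ℝ ψ z e) φ

theorem dirs_cons (e : ℝ × ℝ) (l : List (ℝ × ℝ)) (φ : ℝ × ℝ → ℝ) :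
    dirs (e :: l) φ = fun z => fderiv ℝ (dirs l φ) z e := rfl

theorem dirs_append (l l' : List (ℝ × ℝ)) (φ : ℝ × ℝ → ℝ) :
    dirs (l ++ l') φ = dirs l (dirs l' φ) := by
  simp [dirs, List.foldr_append]

theorem contDiff_dirs {φ : ℝ × ℝ → ℝ} (hφ : ContDiff ℝ ∞ φ) (l : List (ℝ × ℝ)) :
    ContDiff ℝ ∞ (dirs l φ) := by
  induction l with
  | nil => exact hφ
  | cons e l ih =>
    rw [dirs_cons]
    exact (ih.fderiv_right (m := ∞) (by simp)).clm_apply contDiff_const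

/-- The link between the hypothesis on `S`, which bounds `iteratedFDeriv`, and the partial
derivatives of amplitudes, which are iterated directional derivatives. -/
theorem dirs_eq_iteratedFDeriv {φ : ℝ × ℝ → ℝ} (hφ : ContDiff ℝ ∞ φ) (l : List (ℝ × ℝ))
    (z : ℝ × ℝ) : dirs l φ z = iteratedFDeriv ℝ l.length φ z l.get := by
  induction l generalizing z with
  | nil => simp [dirs]
  | cons e l ih =>
    rw [dirs_cons]
    have h1 : dirs l φ = fun z => iteratedFDeriv ℝ l.length φ z l.get := funext ih
    have hd : DifferentiableAt ℝ (iteratedFDeriv ℝ l.length φ) z :=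
      (hφ.differentiable_iteratedFDeriv (m := l.length)
        (by exact_mod_cast WithTop.coe_lt_coe.2 (ENat.natCast_lt_top _))) z
    have h2 : fderiv ℝ (fun z => iteratedFDeriv ℝ l.length φ z l.get) z e
        = fderiv ℝ (iteratedFDeriv ℝ l.length φ) z e l.get := by
      have := (ContinuousMultilinearMap.apply ℝ (fun _ : Fin l.length => ℝ × ℝ) ℝ
        l.get).hasFDerivAt.comp z hd.hasFDerivAt
      have e := this.fderiv
      change fderiv ℝ (fun z => iteratedFDeriv ℝ l.length φ z l.get) z = _ at e
      rw [e]; rfl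
    simp only [h1, h2]
    exact (iteratedFDeriv_succ_apply_left (𝕜 := ℝ) (f := φ) (x := z) (e :: l).get).symm

theorem abs_dirs_le {φ : ℝ × ℝ → ℝ} (hφ : ContDiff ℝ ∞ φ) (l : List (ℝ × ℝ))
    (hl : ∀ e ∈ l, ‖e‖ ≤ 1) (z : ℝ × ℝ) :
    |dirs l φ z| ≤ ‖iteratedFDeriv ℝ l.length φ z‖ := by
  rw [dirs_eq_iteratedFDeriv hφ, ← Real.norm_eq_abs]
  refine (ContinuousMultilinearMap.le_opNorm _ _).trans ?_
  refine mul_le_of_le_one_right (norm_nonneg _) (Finset.prod_le_one (fun _ _ => norm_nonneg _) ?_)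
  exact fun i _ => hl _ (List.get_mem _ _)

/-- The slow part of the `i`-th coordinate direction. -/
def slowDir (i : Fin 4) : ℝ × ℝ := slow (Pi.single i 1)

theorem norm_slowDir_le (i : Fin 4) : ‖slowDir i‖ ≤ 1 := by
  fin_cases i <;> simp [slowDir, slow, Prod.norm_def]

theorem smoothAmp_liftSlow {D : Set (ℝ × ℝ)} {φ : ℝ × ℝ → ℝ} (hφ : ContDiff ℝ ∞ φ) :
    SmoothAmp D (liftSlow φ) :=
  (Complex.ofRealCLM.contDiff.comp (hφ.comp contDiff_slow)).contDiffOn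

theorem pd_liftSlow {φ : ℝ × ℝ → ℝ} (hφ : ContDiff ℝ ∞ φ) (i : Fin 4) :
    pd i (liftSlow φ) = liftSlow (dirs [slowDir i] φ) := by
  funext y
  let sl : (Fin 4 → ℝ) →L[ℝ] ℝ × ℝ :=
    (ContinuousLinearMap.proj (R := ℝ) (φ := fun _ : Fin 4 => ℝ) 2).prod
      (ContinuousLinearMap.proj (R := ℝ) (φ := fun _ : Fin 4 => ℝ) 3)
  have h1 : HasFDerivAt slow sl y := sl.hasFDerivAt
  have h2 := (hφ.differentiable (by simp) (slow y)).hasFDerivAt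
  have h3 := (Complex.ofRealCLM.hasFDerivAt (x := φ (slow y))).comp y (h2.comp y h1)
  have h4 : fderiv ℝ (liftSlow φ) y = _ := h3.fderiv
  simp only [pd]
  rw [h4]
  rfl

theorem pds_liftSlow {φ : ℝ × ℝ → ℝ} (hφ : ContDiff ℝ ∞ φ) (l : List (Fin 4)) :
    pds l (liftSlow φ) = liftSlow (dirs (l.map slowDir) φ) := by
  induction l with
  | nil => rfl
  | cons i l ih => rw [pds_cons, ih, pd_liftSlow (contDiff_dirs hφ _)]; rfl

end WKB

namespace WKB

/-! ### The sets of modes -/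

theorem Omega_zero : Omega 0 = ∅ := by rw [Omega]

theorem Omega_one : Omega 1 = {(1, 0), (-1, 0)} := by rw [Omega]

theorem Omega_subset_succ (n : ℕ) : Omega n ⊆ Omega (n + 1) := by
  cases n with
  | zero => simp [Omega_zero]
  | succ n =>
    rw [Omega.eq_3 n]
    intro p hp
    simp only [Finset.mem_union]
    exact Or.inl (Or.inl (Or.inl hp))

theorem Omega_mono : Monotone Omega := monotone_nat_of_le_succ Omega_subset_succ

theorem Omega_up {n : ℕ} {p : Mode} (hp : p ∈ Omega n) : (p.1, p.2 + 1) ∈ Omega (n + 1) := by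
  cases n with
  | zero => simp [Omega_zero] at hp
  | succ n =>
    rw [Omega.eq_3 n]
    simp only [Finset.mem_union]
    exact Or.inl (Or.inl (Or.inr (Finset.mem_image_of_mem _ hp)))

theorem Omega_down {n : ℕ} {p : Mode} (hp : p ∈ Omega n) : (p.1, p.2 - 1) ∈ Omega (n + 1) := by
  cases n with
  | zero => simp [Omega_zero] at hp
  | succ n =>
    rw [Omega.eq_3 n]
    simp only [Finset.mem_union]
    exact Or.inl (Or.inr (Finset.mem_image_of_mem _ hp))

theorem pos_of_mem_Omega {n : ℕ} {p : Mode} (hp : p ∈ Omega n) : 1 ≤ n := by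
  rcases Nat.eq_zero_or_pos n with rfl | h
  · simp [Omega_zero] at hp
  · exact h

theorem Omega_add {a b c : ℕ} {p q r : Mode} (hp : p ∈ Omega a) (hq : q ∈ Omega b)
    (hr : r ∈ Omega c) : p + q + r ∈ Omega (a + b + c) := by
  -- Since all three orders are positive, each of them is smaller than their sum, as the range of
  -- the triples in `Omega` demands.
  have ha := pos_of_mem_Omega hp
  have hb := pos_of_mem_Omega hq
  have hc := pos_of_mem_Omega hr
  obtain ⟨n, hn⟩ : ∃ n, a + b + c = n + 2 := ⟨a + b + c - 2, by omega⟩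
  rw [hn, Omega.eq_3 n]
  simp only [Finset.mem_union]
  refine Or.inr ?_
  simp only [Finset.mem_biUnion, Finset.mem_filter, Finset.mem_univ, true_and]
  refine ⟨(⟨a, by omega⟩, ⟨b, by omega⟩, ⟨c, by omega⟩), by simpa using hn, ?_⟩
  exact Finset.mem_image.2 ⟨(p, q, r), by simp [Finset.mem_product, hp, hq, hr], rfl⟩

/-- Negation exchanges the steps `m + 1` and `m - 1` and respects sums of triples. The symmetry is
needed for the reality of the expansion. -/
theorem Omega_neg {n : ℕ} {p : Mode} (hp : p ∈ Omega n) : -p ∈ Omega n := by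
  induction n using Nat.strong_induction_on generalizing p with
  | _ n ih =>
    match n, ih, hp with
    | 0, _, hp => simp [Omega_zero] at hp
    | 1, _, hp =>
      rw [Omega_one] at hp ⊢
      simp only [Finset.mem_insert, Finset.mem_singleton] at hp ⊢
      rcases hp with rfl | rfl <;> simp
    | n + 2, ih, hp =>
      have hlt : n + 1 < n + 2 := by omega
      rw [Omega.eq_3 n] at hp
      simp only [Finset.mem_union, Finset.mem_image, Finset.mem_biUnion, Finset.mem_filter,
        Finset.mem_univ, true_and, Finset.mem_product] at hp
      rcases hp with ((hp | ⟨q, hq, rfl⟩) | ⟨q, hq, rfl⟩) | ⟨l, hl, q, ⟨h1, h2, h3⟩, rfl⟩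
      · exact Omega_subset_succ _ (ih _ hlt hp)
      · have := Omega_down (ih _ hlt hq)
        rwa [show ((-q).1, (-q).2 - 1) = -((q.1, q.2 + 1) : Mode) by ext <;> simp; ring] at this
      · have := Omega_up (ih _ hlt hq)
        rwa [show ((-q).1, (-q).2 + 1) = -((q.1, q.2 - 1) : Mode) by ext <;> simp; ring] at this
      · have := Omega_add (ih _ l.1.isLt h1) (ih _ l.2.1.isLt h2) (ih _ l.2.2.isLt h3)
        rw [hl] at this
        rwa [show -(q.1 + q.2.1 + q.2.2) = -q.1 + -q.2.1 + -q.2.2 by abel]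

theorem carrier_mem_Omega {n : ℕ} (hn : 1 ≤ n) : ((1, 0) : Mode) ∈ Omega n :=
  Omega_mono hn (by rw [Omega_one]; simp)

theorem mem_drivenModes {N n : ℕ} (hn : n ≤ max N 2) {p : Mode} (hp : p ∈ Omega n)
    (h1 : p ≠ (1, 0)) (h2 : p ≠ (-1, 0)) : p ∈ drivenModes N := by
  simp only [drivenModes, Finset.mem_filter, Finset.mem_biUnion, Finset.mem_Icc]
  exact ⟨⟨n, ⟨pos_of_mem_Omega hp, hn⟩, hp⟩, h1, h2⟩

/-- The modes `(1, ±1)` appear in `Ω_2` and not in `Ω_1`. Because of the `max N 2` in `drivenModes`,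
`ρ` controls the coefficient `g` also for `N = 1`. -/
theorem sideband_mem_drivenModes (N : ℕ) {m : ℤ} (hm : m = 1 ∨ m = -1) :
    ((1, m) : Mode) ∈ drivenModes N := by
  have h := carrier_mem_Omega le_rfl
  refine mem_drivenModes (n := 2) (le_max_right _ _) ?_ ?_ ?_
  · rcases hm with rfl | rfl
    · simpa using Omega_up h
    · simpa using Omega_down h
  · rcases hm with rfl | rfl <;> simp
  · rcases hm with rfl | rfl <;> simp

/-! ### The distance to the resonances -/

theorem resDist_le_one (P : Driver) (N : ℕ) (z : ℝ × ℝ) : resDist P N z ≤ 1 :=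
  ((Finset.le_fold_min (b := (1 : ℝ)) _).1 le_rfl).1

theorem resDist_le_abs (P : Driver) (N : ℕ) {p : Mode} (hp : p ∈ drivenModes N) (z : ℝ × ℝ) :
    resDist P N z ≤ |eikonal (phase P p) z| :=
  ((Finset.le_fold_min (b := (1 : ℝ)) _).1 le_rfl).2 p hp

theorem resDist_pos (P : Driver) (N : ℕ) {z : ℝ × ℝ}
    (h : ∀ p ∈ drivenModes N, eikonal (phase P p) z ≠ 0) : 0 < resDist P N z :=
  (Finset.lt_fold_min (b := (1 : ℝ)) _).2 ⟨one_pos, fun p hp => abs_pos.2 (h p hp)⟩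

/-! ### Phases -/

section Phase

variable {P : Driver}

theorem fderiv_phase (hS : ContDiff ℝ ∞ P.S) (p : Mode) (z e : ℝ × ℝ) :
    fderiv ℝ (phase P p) z e
      = (p.1 : ℝ) * (P.k * e.1 + P.om * e.2) + (p.2 : ℝ) * fderiv ℝ P.S z e := by
  have h1 : HasFDerivAt (fun z : ℝ × ℝ => z.1) (ContinuousLinearMap.fst ℝ ℝ ℝ) z := hasFDerivAt_fst
  have h2 : HasFDerivAt (fun z : ℝ × ℝ => z.2) (ContinuousLinearMap.snd ℝ ℝ ℝ) z := hasFDerivAt_snd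
  have h3 := (hS.differentiable (by simp) z).hasFDerivAt
  have h := (((h1.const_mul P.k).add (h2.const_mul P.om)).const_mul (p.1 : ℝ)).add
    (h3.const_mul (p.2 : ℝ))
  have h' : fderiv ℝ (phase P p) z = _ := h.fderiv
  rw [h']
  simp [mul_add]

theorem dt_phase (hS : ContDiff ℝ ∞ P.S) (p : Mode) :
    dt (phase P p) = fun z => (p.1 : ℝ) * P.om + (p.2 : ℝ) * dt P.S z := by
  funext z; simp only [dt]; rw [fderiv_phase hS]; simp

theorem dx_phase (hS : ContDiff ℝ ∞ P.S) (p : Mode) :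
    dx (phase P p) = fun z => (p.1 : ℝ) * P.k + (p.2 : ℝ) * dx P.S z := by
  funext z; simp only [dx]; rw [fderiv_phase hS]; simp

theorem contDiff_dt {φ : ℝ × ℝ → ℝ} (h : ContDiff ℝ ∞ φ) : ContDiff ℝ ∞ (dt φ) :=
  contDiff_dirs h [(0, 1)]

theorem contDiff_dx {φ : ℝ × ℝ → ℝ} (h : ContDiff ℝ ∞ φ) : ContDiff ℝ ∞ (dx φ) :=
  contDiff_dirs h [(1, 0)]

theorem contDiff_phase (hS : ContDiff ℝ ∞ P.S) (p : Mode) : ContDiff ℝ ∞ (phase P p) := by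
  unfold phase
  fun_prop

theorem dt_dt_phase (hS : ContDiff ℝ ∞ P.S) (p : Mode) :
    dt (dt (phase P p)) = fun z => (p.2 : ℝ) * dt (dt P.S) z := by
  rw [dt_phase hS]
  funext z
  have h := ((((contDiff_dt hS).differentiable (by simp) z).hasFDerivAt.const_mul
    (p.2 : ℝ)).const_add ((p.1 : ℝ) * P.om)).fderiv
  simp only [dt] at h ⊢
  rw [h]; simp

theorem dx_dx_phase (hS : ContDiff ℝ ∞ P.S) (p : Mode) :
    dx (dx (phase P p)) = fun z => (p.2 : ℝ) * dx (dx P.S) z := by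
  rw [dx_phase hS]
  funext z
  have h := ((((contDiff_dx hS).differentiable (by simp) z).hasFDerivAt.const_mul
    (p.2 : ℝ)).const_add ((p.1 : ℝ) * P.k)).fderiv
  simp only [dx] at h ⊢
  rw [h]; simp

theorem eikonal_phase (hS : ContDiff ℝ ∞ P.S) (p : Mode) (z : ℝ × ℝ) :
    eikonal (phase P p) z = ((p.1 : ℝ) * P.om + (p.2 : ℝ) * dt P.S z) ^ 2
      - ((p.1 : ℝ) * P.k + (p.2 : ℝ) * dx P.S z) ^ 2 - 1 := by
  simp only [eikonal, dt_phase hS, dx_phase hS]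

theorem eikonal_phase_carrier (hS : ContDiff ℝ ∞ P.S) (hom : P.om ^ 2 = P.k ^ 2 + 1)
    {j : ℤ} (hj : j = 1 ∨ j = -1) (z : ℝ × ℝ) : eikonal (phase P (j, 0)) z = 0 := by
  rw [eikonal_phase hS]
  rcases hj with rfl | rfl <;> · simp; linarith

theorem eikonal_phase_neg (hS : ContDiff ℝ ∞ P.S) (p : Mode) (z : ℝ × ℝ) :
    eikonal (phase P (-p)) z = eikonal (phase P p) z := by
  rw [eikonal_phase hS, eikonal_phase hS]
  simp only [Prod.fst_neg, Prod.snd_neg, Int.cast_neg]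
  ring

theorem gFun_eq (z : ℝ × ℝ) :
    gFun P z = 1 / eikonal (phase P (1, -1)) z + 1 / eikonal (phase P (1, 1)) z := by
  have e1 : phase P (1, -1) = fun w => P.om * w.2 + P.k * w.1 - P.S w := by
    funext w; simp [phase]; ring
  have e2 : phase P (1, 1) = fun w => P.om * w.2 + P.k * w.1 + P.S w := by
    funext w; simp [phase]; ring
  rw [gFun, e1, e2]

end Phase

/-! ### Singular functions -/

section Singular

variable {P : Driver} {N : ℕ} {D : Set (ℝ × ℝ)}

/-- A bound for the products in Leibniz' rule is a bound for the derivative of the product. -/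
theorem exists_bound_pds_mul (hD : IsOpen D) {v w : Amp} (hv : SmoothAmp D v)
    (hw : SmoothAmp D w) (l : List (Fin 4)) (W : (Fin 4 → ℝ) → ℝ)
    (h : ∀ a b, Split l a b → ∃ C : ℝ, ∀ y ∈ dom D, ‖pds a v y * pds b w y‖ ≤ C * W y) :
    ∃ C : ℝ, ∀ y ∈ dom D, ‖pds l (v * w) y‖ ≤ C * W y := by
  refine leibniz_induction hD hv hw l
    (fun f => ∃ C : ℝ, ∀ y ∈ dom D, ‖f y‖ ≤ C * W y) ?_ ?_ h
  · rintro f g - - ⟨C, hC⟩ ⟨C', hC'⟩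
    refine ⟨C + C', fun y hy => (norm_add_le _ _).trans ?_⟩
    rw [add_mul]
    exact add_le_add (hC y hy) (hC' y hy)
  · rintro f g - hfg ⟨C, hC⟩
    exact ⟨C, fun y hy => by rw [← hfg hy]; exact hC y hy⟩

theorem SingularOrder.congr (hD : IsOpen D) {r : ℕ} {v w : Amp} (h : SingularOrder P N D r v)
    (hvw : Set.EqOn v w (dom D)) : SingularOrder P N D r w := fun l => by
  obtain ⟨C, hC⟩ := h l
  exact ⟨C, fun y hy => by rw [← pds_congr hD hvw l hy]; exact hC y hy⟩

theorem div_pow_mono {C ρ : ℝ} (hρ : 0 < ρ) (h1 : ρ ≤ 1) (hC : 0 ≤ C) {a b : ℕ} (hab : a ≤ b) :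
    C / ρ ^ a ≤ C / ρ ^ b :=
  div_le_div_of_nonneg_left hC (pow_pos hρ _) (pow_le_pow_of_le_one hρ.le h1 hab)

variable (hρ : ∀ z ∈ D, 0 < resDist P N z)
include hρ

omit hρ in
theorem singularOrder_of_bound {r : ℕ} {v : Amp}
    (h : ∀ l : List (Fin 4), ∃ C : ℝ, ∀ y ∈ dom D,
      ‖pds l v y‖ ≤ C * (1 / resDist P N (slow y) ^ (r + slowCount l))) :
    SingularOrder P N D r v := fun l => by
  obtain ⟨C, hC⟩ := h l
  exact ⟨C, fun y hy => by simpa [div_eq_mul_inv] using hC y hy⟩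

theorem SingularOrder.nonneg_bound {r : ℕ} {v : Amp} (h : SingularOrder P N D r v)
    (l : List (Fin 4)) : ∃ C : ℝ, 0 ≤ C ∧ ∀ y ∈ dom D,
      ‖pds l v y‖ ≤ C * (1 / resDist P N (slow y) ^ (r + slowCount l)) := by
  obtain ⟨C, hC⟩ := h l
  refine ⟨|C|, abs_nonneg C, fun y hy => (hC y hy).trans ?_⟩
  rw [div_eq_mul_one_div]
  have := hρ _ hy
  exact mul_le_mul_of_nonneg_right (le_abs_self C) (by positivity)

theorem SingularOrder.mono {r r' : ℕ} {v : Amp} (h : SingularOrder P N D r v) (hr : r ≤ r') :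
    SingularOrder P N D r' v := fun l => by
  obtain ⟨C, hC, h⟩ := h.nonneg_bound hρ l
  refine ⟨C, fun y hy => (h y hy).trans ?_⟩
  rw [← div_eq_mul_one_div]
  exact div_pow_mono (hρ _ hy) (resDist_le_one _ _ _) hC (by omega)

omit hρ in
theorem SingularOrder.add (hD : IsOpen D) {r : ℕ} {v w : Amp} (sv : SmoothAmp D v)
    (sw : SmoothAmp D w) (hv : SingularOrder P N D r v) (hw : SingularOrder P N D r w) :
    SingularOrder P N D r (v + w) := fun l => by
  obtain ⟨C, hC⟩ := hv l
  obtain ⟨C', hC'⟩ := hw l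
  refine ⟨C + C', fun y hy => ?_⟩
  rw [pds_add hD sv sw l hy, add_div]
  exact (norm_add_le _ _).trans (add_le_add (hC y hy) (hC' y hy))

theorem SingularOrder.mul (hD : IsOpen D) {r r' : ℕ} {v w : Amp} (sv : SmoothAmp D v)
    (sw : SmoothAmp D w) (hv : SingularOrder P N D r v) (hw : SingularOrder P N D r' w) :
    SingularOrder P N D (r + r') (v * w) := by
  refine singularOrder_of_bound fun l => exists_bound_pds_mul hD sv sw l _ fun a b hab => ?_
  obtain ⟨C, hC0, hC⟩ := hv.nonneg_bound hρ a
  obtain ⟨C', hC0', hC'⟩ := hw.nonneg_bound hρ b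
  refine ⟨C * C', fun y hy => ?_⟩
  have := hρ _ hy
  rw [norm_mul, ← hab.slowCount, show r + r' + (slowCount a + slowCount b)
    = (r + slowCount a) + (r' + slowCount b) by omega, pow_add, one_div, mul_inv, ← one_div,
    ← one_div, mul_mul_mul_comm]
  exact mul_le_mul (hC y hy) (hC' y hy) (norm_nonneg _) (by positivity)

omit hρ in
theorem SingularOrder.pd (hD : IsOpen D) {r : ℕ} {v : Amp} (hv : SmoothAmp D v)
    (h : SingularOrder P N D r v) (i : Fin 4) :
    SingularOrder P N D (r + slowCount [i]) (pd i v) := fun l => by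
  obtain ⟨C, hC⟩ := h (i :: l)
  refine ⟨C, fun y hy => ?_⟩
  rw [pd_pds_comm hD hv i l hy]
  have := hC y hy
  rwa [pds_cons, slowCount_cons, ← add_assoc, add_right_comm] at this

theorem singularOrder_of_bounded {v : Amp}
    (h : ∀ l : List (Fin 4), ∃ C : ℝ, ∀ y ∈ dom D, ‖pds l v y‖ ≤ C) (r : ℕ) :
    SingularOrder P N D r v := fun l => by
  obtain ⟨C, hC⟩ := h l
  refine ⟨|C|, fun y hy => ((hC y hy).trans (le_abs_self C)).trans ?_⟩
  have := div_pow_mono (hρ _ hy) (resDist_le_one P N (slow y)) (abs_nonneg C)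
    (Nat.zero_le (r + slowCount l))
  simpa using this

omit hρ in
theorem singularOrder_zero (r : ℕ) : SingularOrder P N D r 0 := fun l =>
  ⟨0, fun y _ => by simp⟩

omit hρ in
theorem SingularOrder.cconj (hD : IsOpen D) {r : ℕ} {v : Amp} (hv : SmoothAmp D v)
    (h : SingularOrder P N D r v) : SingularOrder P N D r (cconj v) := fun l => by
  obtain ⟨C, hC⟩ := h l
  refine ⟨C, fun y hy => ?_⟩
  rw [pds_cconj hD hv l hy]
  simpa [WKB.cconj] using hC y hy

end Singular

/-! ### Coefficients -/

/-- A smooth function of `(x₂, t₂)` with all derivatives bounded. -/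
structure BddCoef (D : Set (ℝ × ℝ)) (c : Amp) : Prop where
  smooth : SmoothAmp D c
  bound : ∀ l : List (Fin 4), ∃ C : ℝ, ∀ y ∈ dom D, ‖pds l c y‖ ≤ C
  slow : ∀ y ∈ dom D, ∀ y' ∈ dom D, slow y = slow y' → c y = c y'

/-- A smooth function of `(x₂, t₂)` with singularities of order at most `r`. -/
structure IsCoef (P : Driver) (N : ℕ) (D : Set (ℝ × ℝ)) (r : ℕ) (c : Amp) : Prop where
  smooth : SmoothAmp D c
  sing : SingularOrder P N D r c
  slow : ∀ y ∈ dom D, ∀ y' ∈ dom D, slow y = slow y' → c y = c y'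

section Coef

variable {P : Driver} {N : ℕ} {D : Set (ℝ × ℝ)}

theorem pds_const_cons (i : Fin 4) (l : List (Fin 4)) (c : ℂ) :
    pds (i :: l) (fun _ => c) = 0 := by
  induction l generalizing i with
  | nil => exact pd_const i c
  | cons j l ih => rw [pds_cons, ih, pd_zero]

theorem bddCoef_const (c : ℂ) : BddCoef D (fun _ => c) where
  smooth := smoothAmp_const c
  bound l := by
    cases l with
    | nil => exact ⟨‖c‖, fun _ _ => le_rfl⟩
    | cons i l => exact ⟨0, fun _ _ => by rw [pds_const_cons]; simp⟩
  slow _ _ _ _ _ := rfl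

theorem BddCoef.add (hD : IsOpen D) {c c' : Amp} (h : BddCoef D c) (h' : BddCoef D c') :
    BddCoef D (c + c') where
  smooth := h.smooth.add h'.smooth
  bound l := by
    obtain ⟨C, hC⟩ := h.bound l
    obtain ⟨C', hC'⟩ := h'.bound l
    refine ⟨C + C', fun y hy => ?_⟩
    rw [pds_add hD h.smooth h'.smooth l hy]
    exact (norm_add_le _ _).trans (add_le_add (hC y hy) (hC' y hy))
  slow y hy y' hy' e := by
    simp only [Pi.add_apply, h.slow y hy y' hy' e, h'.slow y hy y' hy' e]

theorem BddCoef.mul (hD : IsOpen D) {c c' : Amp} (h : BddCoef D c) (h' : BddCoef D c') :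
    BddCoef D (c * c') where
  smooth := h.smooth.mul h'.smooth
  bound l := by
    have := exists_bound_pds_mul hD h.smooth h'.smooth l (fun _ => 1) fun a b _ => by
      obtain ⟨C, hC⟩ := h.bound a
      obtain ⟨C', hC'⟩ := h'.bound b
      refine ⟨C * C', fun y hy => ?_⟩
      rw [norm_mul, mul_one]
      exact mul_le_mul (hC y hy) (hC' y hy) (norm_nonneg _) ((norm_nonneg _).trans (hC y hy))
    simpa using this
  slow y hy y' hy' e := by
    simp only [Pi.mul_apply, h.slow y hy y' hy' e, h'.slow y hy y' hy' e]

/-- The list must be nonempty because only the derivatives of `S` are bounded. `S` itself may grow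
on `D`, but it enters the coefficients of the system through its derivatives alone. -/
theorem bddCoef_dirs {φ : ℝ × ℝ → ℝ} (hφ : ContDiff ℝ ∞ φ)
    (hb : ∀ i : ℕ, 1 ≤ i → ∃ C : ℝ, ∀ z ∈ D, ‖iteratedFDeriv ℝ i φ z‖ ≤ C)
    {l : List (ℝ × ℝ)} (hl : l ≠ []) (hl1 : ∀ e ∈ l, ‖e‖ ≤ 1) :
    BddCoef D (liftSlow (dirs l φ)) where
  smooth := smoothAmp_liftSlow (contDiff_dirs hφ l)
  bound l' := by
    obtain ⟨C, hC⟩ := hb (l'.map slowDir ++ l).length (by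
      have := List.length_pos_of_ne_nil hl
      simp only [List.length_append]; omega)
    refine ⟨C, fun y hy => ?_⟩
    rw [pds_liftSlow (contDiff_dirs hφ l), ← dirs_append]
    simp only [liftSlow, Complex.norm_real, Real.norm_eq_abs]
    refine (abs_dirs_le hφ _ ?_ _).trans (hC _ hy)
    intro e he
    rcases List.mem_append.1 he with he | he
    · obtain ⟨i, -, rfl⟩ := List.mem_map.1 he
      exact norm_slowDir_le i
    · exact hl1 e he
  slow y _ y' _ e := by simp only [liftSlow, e]

theorem pd_eq_zero_of_slow (hD : IsOpen D) {c : Amp}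
    (h : ∀ y ∈ dom D, ∀ y' ∈ dom D, slow y = slow y' → c y = c y') (hc : SmoothAmp D c)
    {i : Fin 4} (hi : i = 0 ∨ i = 1) :
    Set.EqOn (pd i c) 0 (dom D) := fun y hy => by
  have h1 := (hc.differentiableAt hD hy).hasFDerivAt
  have hsl : ∀ t : ℝ, slow (y + t • Pi.single i 1) = slow y := by
    intro t
    rcases hi with rfl | rfl <;> simp [slow]
  have h2 : HasDerivAt (fun t : ℝ => c (y + t • Pi.single i 1)) (fderiv ℝ c y (Pi.single i 1)) 0 := by
    have h3 : HasDerivAt (fun t : ℝ => y + t • (Pi.single i 1 : Fin 4 → ℝ)) (Pi.single i 1) 0 := by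
      simpa using ((hasDerivAt_id (0 : ℝ)).smul_const (Pi.single i 1 : Fin 4 → ℝ)).const_add y
    have h1' : HasFDerivAt c (fderiv ℝ c y) (y + (0 : ℝ) • (Pi.single i 1 : Fin 4 → ℝ)) := by
      simpa using h1
    exact h1'.comp_hasDerivAt 0 h3
  have h4 : (fun t : ℝ => c (y + t • Pi.single i 1)) = fun _ => c y := by
    funext t
    refine h _ ?_ _ hy (hsl t)
    change slow _ ∈ D
    rw [hsl t]; exact hy
  rw [h4] at h2
  exact h2.unique (hasDerivAt_const _ _)

variable (hρ : ∀ z ∈ D, 0 < resDist P N z)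
include hρ

theorem BddCoef.isCoef {c : Amp} (h : BddCoef D c) (r : ℕ) : IsCoef P N D r c :=
  ⟨h.smooth, singularOrder_of_bounded hρ h.bound r, h.slow⟩

theorem IsCoef.mul (hD : IsOpen D) {r r' : ℕ} {c c' : Amp} (h : IsCoef P N D r c)
    (h' : IsCoef P N D r' c') : IsCoef P N D (r + r') (c * c') where
  smooth := h.smooth.mul h'.smooth
  sing := h.sing.mul hρ hD h.smooth h'.smooth h'.sing
  slow y hy y' hy' e := by
    simp only [Pi.mul_apply, h.slow y hy y' hy' e, h'.slow y hy y' hy' e]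

omit hρ in
theorem IsCoef.add (hD : IsOpen D) {r : ℕ} {c c' : Amp} (h : IsCoef P N D r c)
    (h' : IsCoef P N D r c') : IsCoef P N D r (c + c') where
  smooth := h.smooth.add h'.smooth
  sing := h.sing.add hD h.smooth h'.smooth h'.sing
  slow y hy y' hy' e := by
    simp only [Pi.add_apply, h.slow y hy y' hy' e, h'.slow y hy y' hy' e]

/-- From `c · (1/c) = 1` one gets `∂_i (1/c) = -(∂_i c) (1/c)²`. Each slow derivative thus brings
one more factor `1/c`, that is one more power of `1/ρ`; fast derivatives vanish because `c` depends
on the slow variables only. -/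
theorem BddCoef.isCoef_inv (hD : IsOpen D) {c : Amp} (h : BddCoef D c)
    (hc : ∀ y ∈ dom D, resDist P N (WKB.slow y) ≤ ‖c y‖) :
    IsCoef P N D 1 (fun y => 1 / c y) := by
  have hne : ∀ y ∈ dom D, c y ≠ 0 := fun y hy =>
    norm_pos_iff.1 ((hρ _ hy).trans_le (hc y hy))
  set w : Amp := fun y => 1 / c y with hw
  have sw : SmoothAmp D w := by
    have : SmoothAmp D (fun y => (c y)⁻¹) := h.smooth.inv hne
    simpa [hw] using this
  have slw : ∀ y ∈ dom D, ∀ y' ∈ dom D, WKB.slow y = WKB.slow y' → w y = w y' :=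
    fun y hy y' hy' e => by simp only [hw, h.slow y hy y' hy' e]
  refine ⟨sw, ?_, slw⟩
  have hpd : ∀ i, Set.EqOn (WKB.pd i w) ((fun y => -1 * WKB.pd i c y) * (w * w)) (dom D) := by
    intro i y hy
    have h1 : Set.EqOn (c * w) (fun _ => 1) (dom D) := fun y hy => by
      simp only [Pi.mul_apply, hw]
      field_simp [hne y hy]
    have h2 := pd_congr hD h1 i hy
    rw [pd_mul hD h.smooth sw i hy, pd_const] at h2
    simp only [Pi.add_apply, Pi.mul_apply, Pi.zero_apply] at h2 ⊢
    have h3 : WKB.pd i w y = -(WKB.pd i c y * w y) / c y := by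
      rw [eq_div_iff (hne y hy)]; linear_combination h2
    rw [h3]; simp only [hw]; ring
  -- The claim covers all lists up to a length, since Leibniz' rule for `w * w` produces arbitrary
  -- shorter lists.
  have main : ∀ m : ℕ, ∀ l : List (Fin 4), l.length ≤ m → ∃ C : ℝ, 0 ≤ C ∧ ∀ y ∈ dom D,
      ‖WKB.pds l w y‖ ≤ C * (1 / resDist P N (WKB.slow y) ^ (1 + slowCount l)) := by
    intro m
    induction m with
    | zero =>
      intro l hl
      obtain rfl : l = [] := List.length_eq_zero_iff.1 (by omega)
      refine ⟨1, zero_le_one, fun y hy => ?_⟩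
      have := hρ _ hy
      simp only [pds_nil, hw, norm_div, norm_one, slowCount_nil, add_zero, pow_one, one_mul]
      exact one_div_le_one_div_of_le this (hc y hy)
    | succ m ih =>
      intro l hl
      cases l with
      | nil => exact ih [] (by simp)
      | cons i l =>
        have hl' : l.length ≤ m := by simpa using hl
        suffices hs : ∃ C : ℝ, ∀ y ∈ dom D, ‖WKB.pds l ((fun y => -1 * WKB.pd i c y) * (w * w)) y‖
            ≤ C * (1 / resDist P N (WKB.slow y) ^ (1 + slowCount (i :: l))) by
          obtain ⟨C, hC⟩ := hs
          refine ⟨|C|, abs_nonneg C, fun y hy => ?_⟩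
          rw [pds_cons, ← pd_pds_comm hD sw i l hy, pds_congr hD (hpd i) l hy]
          have := hρ _ hy
          exact (hC y hy).trans (mul_le_mul_of_nonneg_right (le_abs_self C) (by positivity))
        have spd : SmoothAmp D (fun y => -1 * WKB.pd i c y) :=
          contDiffOn_const.mul (h.smooth.pd hD i)
        refine exists_bound_pds_mul hD spd (sw.mul sw) l _ fun a b hab => ?_
        obtain ⟨C1, hC1⟩ := h.bound (i :: a)
        have e1 : ∀ y ∈ dom D, ‖WKB.pds a (fun y => -1 * WKB.pd i c y) y‖
            = ‖WKB.pds (i :: a) c y‖ := fun y hy => by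
          rw [pds_const_mul hD (h.smooth.pd hD i) (-1) a hy]
          simp only [pd_pds_comm hD h.smooth i a hy]
          simp
        have hbl : b.length ≤ m := by have := hab.length; omega
        have hww : ∃ C : ℝ, ∀ y ∈ dom D, ‖WKB.pds b (w * w) y‖
            ≤ C * (1 / resDist P N (WKB.slow y) ^ (2 + slowCount b)) := by
          refine exists_bound_pds_mul hD sw sw b _ fun a' b' hab' => ?_
          have := hab'.length
          obtain ⟨C, hC0, hC⟩ := ih a' (by omega)
          obtain ⟨C', hC0', hC'⟩ := ih b' (by omega)
          refine ⟨C * C', fun y hy => ?_⟩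
          have := hρ _ hy
          rw [norm_mul, ← hab'.slowCount, show 2 + (slowCount a' + slowCount b')
            = (1 + slowCount a') + (1 + slowCount b') by omega, pow_add, one_div, mul_inv,
            ← one_div, ← one_div, mul_mul_mul_comm]
          exact mul_le_mul (hC y hy) (hC' y hy) (norm_nonneg _) (by positivity)
        obtain ⟨C2, hC2⟩ := hww
        -- A fast derivative does not raise `slowCount`, so the extra factor `1/c` could not be paid
        -- for; but then the factor `∂_i c` is zero.
        by_cases hi : i = 0 ∨ i = 1
        · refine ⟨0, fun y hy => ?_⟩
          have hz := pds_eqOn_zero hD (pd_eq_zero_of_slow hD h.slow h.smooth hi) a hy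
          rw [norm_mul, e1 y hy, pds_cons, ← pd_pds_comm hD h.smooth i a hy, hz]
          simp
        · have hsi : slowCount [i] = 1 := by
            fin_cases i <;> simp_all [slowCount]
          refine ⟨|C1| * |C2|, fun y hy => ?_⟩
          have hp := hρ _ hy
          rw [norm_mul, e1 y hy, mul_assoc]
          refine mul_le_mul ((hC1 y hy).trans (le_abs_self _)) ?_ (norm_nonneg _) (abs_nonneg _)
          refine (hC2 y hy).trans (mul_le_mul (le_abs_self _) ?_ (by positivity) (abs_nonneg _))
          refine div_pow_mono hp (resDist_le_one _ _ _) zero_le_one ?_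
          rw [slowCount_cons i l, hsi, ← hab.slowCount]; omega
  intro l
  obtain ⟨C, -, hC⟩ := main _ l le_rfl
  exact ⟨C, fun y hy => by rw [div_eq_mul_one_div]; exact hC y hy⟩

end Coef

/-! ### The coefficients of the recurrent system -/

section PhaseCoef

variable {P : Driver} {N : ℕ} {D : Set (ℝ × ℝ)}

theorem BddCoef.congr_amp (hD : IsOpen D) {c c' : Amp} (h : BddCoef D c)
    (e : Set.EqOn c c' (dom D)) : BddCoef D c' where
  smooth := h.smooth.congr_amp e
  bound l := by
    obtain ⟨C, hC⟩ := h.bound l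
    exact ⟨C, fun y hy => by rw [← pds_congr hD e l hy]; exact hC y hy⟩
  slow y hy y' hy' hs := by rw [← e hy, ← e hy', h.slow y hy y' hy' hs]

variable (hS : ContDiff ℝ ∞ P.S) (hD : IsOpen D)
  (hSb : ∀ i : ℕ, 1 ≤ i → ∃ C : ℝ, ∀ z ∈ D, ‖iteratedFDeriv ℝ i P.S z‖ ≤ C)
include hS hD hSb

theorem bddCoef_dt_phase (p : Mode) : BddCoef D (fun y => (dt (phase P p) (slow y) : ℂ)) := by
  have h : BddCoef D (liftSlow (dt P.S)) :=
    bddCoef_dirs hS hSb (l := [(0, 1)]) (by simp) (by simp [Prod.norm_def])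
  refine BddCoef.congr_amp hD ((bddCoef_const ((p.1 : ℂ) * P.om)).add hD
    ((bddCoef_const (p.2 : ℂ)).mul hD h)) fun y _ => ?_
  simp [dt_phase hS, liftSlow]

theorem bddCoef_dx_phase (p : Mode) : BddCoef D (fun y => (dx (phase P p) (slow y) : ℂ)) := by
  have h : BddCoef D (liftSlow (dx P.S)) :=
    bddCoef_dirs hS hSb (l := [(1, 0)]) (by simp) (by simp [Prod.norm_def])
  refine BddCoef.congr_amp hD ((bddCoef_const ((p.1 : ℂ) * P.k)).add hD
    ((bddCoef_const (p.2 : ℂ)).mul hD h)) fun y _ => ?_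
  simp [dx_phase hS, liftSlow]

theorem bddCoef_wave_phase (p : Mode) : BddCoef D (fun y =>
    ((dt (dt (phase P p)) (slow y) - dx (dx (phase P p)) (slow y) : ℝ) : ℂ)) := by
  have h1 : BddCoef D (liftSlow (dt (dt P.S))) :=
    bddCoef_dirs hS hSb (l := [(0, 1), (0, 1)]) (by simp) (by simp [Prod.norm_def])
  have h2 : BddCoef D (liftSlow (dx (dx P.S))) :=
    bddCoef_dirs hS hSb (l := [(1, 0), (1, 0)]) (by simp) (by simp [Prod.norm_def])
  refine BddCoef.congr_amp hD (((bddCoef_const (p.2 : ℂ)).mul hD h1).add hD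
    ((bddCoef_const (-p.2 : ℂ)).mul hD h2)) fun y _ => ?_
  simp [dx_dx_phase hS, dt_dt_phase hS, liftSlow]
  ring

theorem bddCoef_eikonal (p : Mode) : BddCoef D (fun y => (eikonal (phase P p) (slow y) : ℂ)) := by
  have h1 := bddCoef_dt_phase hS hD hSb p
  have h2 := bddCoef_dx_phase hS hD hSb p
  refine BddCoef.congr_amp hD ((h1.mul hD h1).add hD
    (((bddCoef_const (-1)).mul hD (h2.mul hD h2)).add hD (bddCoef_const (-1)))) fun y _ => ?_
  simp [eikonal]
  ring

theorem isCoef_inv_eikonal (hρ : ∀ z ∈ D, 0 < resDist P N z) {p : Mode}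
    (hp : p ∈ drivenModes N) :
    IsCoef P N D 1 (fun y => 1 / (eikonal (phase P p) (slow y) : ℂ)) := by
  refine (bddCoef_eikonal hS hD hSb p).isCoef_inv hρ hD fun y _ => ?_
  simpa using resDist_le_abs P N hp (slow y)

theorem isCoef_gFun (hρ : ∀ z ∈ D, 0 < resDist P N z) :
    IsCoef P N D 1 (fun y => (gFun P (slow y) : ℂ)) := by
  have h1 := isCoef_inv_eikonal hS hD hSb hρ (sideband_mem_drivenModes N (Or.inr rfl))
  have h2 := isCoef_inv_eikonal hS hD hSb hρ (sideband_mem_drivenModes N (Or.inl rfl))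
  have := h1.add hD h2
  convert this using 1
  funext y
  simp [gFun_eq]

end PhaseCoef

end WKB

namespace WKB

/-! ### Classes of amplitudes -/

/-- A scale of classes of amplitudes that is closed under the operations by which the
recurrent system determines the amplitudes; a derivative in a slow variable costs one order. -/
structure AmpClass (P : Driver) (N : ℕ) (D : Set (ℝ × ℝ)) (𝓒 : ℕ → Amp → Prop) : Prop where
  smooth : ∀ {r v}, 𝓒 r v → SmoothAmp D v
  congr : ∀ {r v w}, 𝓒 r v → Set.EqOn v w (dom D) → 𝓒 r w
  zero : ∀ r, 𝓒 r 0
  add : ∀ {r v w}, 𝓒 r v → 𝓒 r w → 𝓒 r (v + w)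
  mono : ∀ {r r' v}, 𝓒 r v → r ≤ r' → 𝓒 r' v
  pd : ∀ {r v}, 𝓒 r v → ∀ i, 𝓒 (r + slowCount [i]) (pd i v)
  coef : ∀ {s r c v}, IsCoef P N D s c → 𝓒 r v → 𝓒 (s + r) (c * v)
  mul : ∀ {r s v w}, 𝓒 r v → 𝓒 s w → 𝓒 (r + s) (v * w)
  conj : ∀ {r v}, 𝓒 r v → 𝓒 r (cconj v)

namespace AmpClass

variable {P : Driver} {N : ℕ} {D : Set (ℝ × ℝ)} {𝓒 : ℕ → Amp → Prop}

theorem sum (h : AmpClass P N D 𝓒) {ι : Type*} (s : Finset ι) {r : ℕ} {f : ι → Amp}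
    (hf : ∀ i ∈ s, 𝓒 r (f i)) : 𝓒 r (fun y => ∑ i ∈ s, f i y) := by
  classical
  induction s using Finset.induction_on with
  | empty => exact h.congr (h.zero r) fun y _ => by simp
  | insert i s hi ih =>
    refine h.congr (h.add (hf i (by simp)) (ih fun j hj => hf j (by simp [hj]))) fun y _ => ?_
    rw [Finset.sum_insert hi]; rfl

theorem pds (h : AmpClass P N D 𝓒) {r : ℕ} {v : Amp} (hv : 𝓒 r v) (l : List (Fin 4)) :
    𝓒 (r + slowCount l) (pds l v) := by
  induction l with
  | nil => exact hv
  | cons i l ih =>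
    rw [slowCount_cons, ← add_assoc]
    exact h.pd ih i

theorem bdd (h : AmpClass P N D 𝓒) (hρ : ∀ z ∈ D, 0 < resDist P N z) {r : ℕ} {c v : Amp}
    (hc : BddCoef D c) (hv : 𝓒 r v) : 𝓒 r (c * v) := by
  simpa using h.coef (hc.isCoef hρ 0) hv

/-- The exponents `q_i - 1` of three factors with `q₁ + q₂ + q₃ = n` add up to `n - 3`. Positivity
of the orders confines each of them to `n - 2`. -/
theorem cubic (h : AmpClass P N D 𝓒) {u : Family} {n : ℕ} (p : Mode)
    (hu : ∀ q, 1 ≤ q → q + 2 ≤ n → ∀ p, 𝓒 (q - 1) (u q p)) : 𝓒 (n - 3) (cubic u n p) := by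
  refine h.sum _ fun q hq => h.sum _ fun r hr => ?_
  simp only [Finset.mem_filter, Finset.mem_product] at hq hr
  obtain ⟨-, hq⟩ := hq
  obtain ⟨⟨h1, h2, h3⟩, -⟩ := hr
  have h1 := pos_of_mem_Omega h1
  have h2 := pos_of_mem_Omega h2
  have h3 := pos_of_mem_Omega h3
  have := h.mul (h.mul (hu q.1 h1 (by omega) r.1) (hu q.2.1 h2 (by omega) r.2.1))
    (hu q.2.2 h3 (by omega) r.2.2)
  rwa [show q.1 - 1 + (q.2.1 - 1) + (q.2.2 - 1) = n - 3 by omega] at this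

/-- In `lower`, an amplitude of order `m - k` carries fewer than `k` slow derivatives, so its
exponent is at most `(m - k - 1) + (k - 1) = m - 2`. If the subtraction `m - k` is truncated, the
amplitude is zero. -/
theorem pds_lower_order (h : AmpClass P N D 𝓒) (hD : IsOpen D) {u : Family}
    {m : ℕ} (h0 : ∀ p, Set.EqOn (u 0 p) 0 (dom D))
    (hu : ∀ q, 1 ≤ q → q < m → ∀ p, 𝓒 (q - 1) (u q p)) (p : Mode) (k : ℕ) (l : List (Fin 4))
    (hk : slowCount l + 1 ≤ k) : 𝓒 (m - 2) (WKB.pds l (u (m - k) p)) := by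
  rcases Nat.eq_zero_or_pos (m - k) with hm | hm
  · rw [hm]
    exact h.congr (h.zero _) (pds_eqOn_zero hD (h0 p) l).symm
  · exact h.mono (h.pds (hu (m - k) hm (by omega) p) l) (by omega)

/-- The exponent `m - 2` leaves exactly the one power of `1/ρ` that the division by `L` costs. It is
also the exponent that decides the size of the residual. -/
theorem lower (h : AmpClass P N D 𝓒) (hS : ContDiff ℝ ∞ P.S) (hD : IsOpen D)
    (hSb : ∀ i : ℕ, 1 ≤ i → ∃ C : ℝ, ∀ z ∈ D, ‖iteratedFDeriv ℝ i P.S z‖ ≤ C)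
    (hρ : ∀ z ∈ D, 0 < resDist P N z) {u : Family}
    {m : ℕ} (h0 : ∀ p, Set.EqOn (u 0 p) 0 (dom D))
    (hu : ∀ q, 1 ≤ q → q < m → ∀ p, 𝓒 (q - 1) (u q p)) (p : Mode) :
    𝓒 (m - 2) (lower P u m p) := by
  have key := h.pds_lower_order hD h0 hu
  have ht := bddCoef_dt_phase hS hD hSb p
  have hx := bddCoef_dx_phase hS hD hSb p
  have hw := bddCoef_wave_phase hS hD hSb p
  have hc := fun c : ℂ => bddCoef_const (D := D) c
  have c1 := h.bdd hρ ((hc (2 * Complex.I)).mul hD ht) (key p 1 [1] (by simp [slowCount]))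
  have c2 := h.bdd hρ ((hc (-(2 * Complex.I))).mul hD hx) (key p 1 [0] (by simp [slowCount]))
  have c3 := key p 2 [1, 1] (by simp [slowCount])
  have c4 := h.bdd hρ (hc (-1)) (key p 2 [0, 0] (by simp [slowCount]))
  have c5 := h.bdd hρ ((hc (2 * Complex.I)).mul hD ht) (key p 2 [3] (by simp [slowCount]))
  have c6 := h.bdd hρ ((hc (-(2 * Complex.I))).mul hD hx) (key p 2 [2] (by simp [slowCount]))
  have c7 := h.bdd hρ ((hc Complex.I).mul hD hw) (key p 2 [] (by simp))
  have c8 := h.bdd hρ (hc 2) (key p 3 [1, 3] (by simp [slowCount]))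
  have c9 := h.bdd hρ (hc (-2)) (key p 3 [0, 2] (by simp [slowCount]))
  have c10 := key p 4 [3, 3] (by simp [slowCount])
  have c11 := h.bdd hρ (hc (-1)) (key p 4 [2, 2] (by simp [slowCount]))
  have c12 := h.bdd hρ (hc (P.f / 2)) (key (p.1, p.2 - 1) 1 [] (by simp))
  have c13 := h.bdd hρ (hc (P.f / 2)) (key (p.1, p.2 + 1) 1 [] (by simp))
  have c14 := h.bdd hρ (hc P.γ) (h.mono (r' := m - 2) (h.cubic (n := m) p
    fun q h1 h2 => hu q h1 (by omega)) (by omega))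
  refine h.congr (h.add (h.add (h.add (h.add (h.add (h.add (h.add (h.add (h.add (h.add (h.add
    (h.add (h.add c1 c2) c3) c4) c5) c6) c7) c8) c9) c10) c11) c12) c13) c14) fun y _ => ?_
  simp only [Pi.add_apply, Pi.mul_apply, pds_cons, pds_nil, WKB.lower]
  ring

theorem algAmp (h : AmpClass P N D 𝓒) (hS : ContDiff ℝ ∞ P.S) (hD : IsOpen D)
    (hSb : ∀ i : ℕ, 1 ≤ i → ∃ C : ℝ, ∀ z ∈ D, ‖iteratedFDeriv ℝ i P.S z‖ ≤ C)
    (hρ : ∀ z ∈ D, 0 < resDist P N z) {u : Family}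
    {m : ℕ} (hm : 2 ≤ m) (h0 : ∀ p, Set.EqOn (u 0 p) 0 (dom D))
    (hu : ∀ q, 1 ≤ q → q < m → ∀ p, 𝓒 (q - 1) (u q p)) {p : Mode} (hp : p ∈ drivenModes N) :
    𝓒 (m - 1) (algAmp P u m p) := by
  have := h.coef (isCoef_inv_eikonal hS hD hSb hρ hp) (h.lower hS hD hSb hρ h0 hu p)
  rwa [show 1 + (m - 2) = m - 1 by omega] at this

end AmpClass

theorem IsAnsatz.zero {D : Set (ℝ × ℝ)} {N : ℕ} {u : Family} (h : IsAnsatz D N u) (p : Mode) :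
    Set.EqOn (u 0 p) 0 (dom D) := fun y hy =>
  h.support 0 (Nat.zero_le _) p (by simp [Omega_zero]) y hy

namespace AmpClass

variable {P : Driver} {N : ℕ} {D : Set (ℝ × ℝ)} {𝓒 : ℕ → Amp → Prop}

theorem carrier_conj (h : AmpClass P N D 𝓒) {u : Family}
    (ha : IsAnsatz D N u) {m r : ℕ} (hmN : m ≤ N) (hcar : 𝓒 r (u m (1, 0))) :
    𝓒 r (u m (-1, 0)) := by
  refine h.congr (h.conj hcar) fun y hy => ?_
  have := ha.real m hmN (1, 0) y hy
  simpa [cconj] using this.symm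

/-- The algebraic equations transfer regularity from the carrier amplitudes to all others. -/
theorem noncarrier (h : AmpClass P N D 𝓒) (hS : ContDiff ℝ ∞ P.S) (hD : IsOpen D)
    (hSb : ∀ i : ℕ, 1 ≤ i → ∃ C : ℝ, ∀ z ∈ D, ‖iteratedFDeriv ℝ i P.S z‖ ≤ C)
    (hρ : ∀ z ∈ D, 0 < resDist P N z) {u : Family}
    (ha : IsAnsatz D N u) (halg : AlgebraicEqs P D N u) {m : ℕ} (hm : 1 ≤ m) (hmN : m ≤ N)
    (hcar : ∀ q, 1 ≤ q → q < m → 𝓒 (q - 1) (u q (1, 0))) {p : Mode} (h1 : p ≠ (1, 0))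
    (h2 : p ≠ (-1, 0)) : 𝓒 (m - 1) (u m p) := by
  induction m using Nat.strong_induction_on generalizing p with
  | _ m ih =>
    have hlow : ∀ q, 1 ≤ q → q < m → ∀ p, 𝓒 (q - 1) (u q p) := by
      intro q hq hqm p
      by_cases e1 : p = (1, 0)
      · rw [e1]; exact hcar q hq hqm
      by_cases e2 : p = (-1, 0)
      · rw [e2]; exact h.carrier_conj ha (by omega) (hcar q hq hqm)
      exact ih q hqm hq (by omega) (fun q' hq' h' => hcar q' hq' (by omega)) e1 e2
    by_cases hp : p ∈ Omega m
    · have hm2 : 2 ≤ m := by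
        by_contra hlt
        obtain rfl : m = 1 := by omega
        rw [Omega_one] at hp
        simp only [Finset.mem_insert, Finset.mem_singleton] at hp
        exact hp.elim h1 h2
      have hd := mem_drivenModes (N := N) (le_max_of_le_left hmN) hp h1 h2
      exact h.congr (h.algAmp hS hD hSb hρ hm2 ha.zero hlow hd)
        fun y hy => (halg m hm hmN p hp h1 h2 y hy).symm
    · exact h.congr (h.zero _) fun y hy => (ha.support m hmN p hp y hy).symm

theorem all_modes (h : AmpClass P N D 𝓒) (hS : ContDiff ℝ ∞ P.S) (hD : IsOpen D)
    (hSb : ∀ i : ℕ, 1 ≤ i → ∃ C : ℝ, ∀ z ∈ D, ‖iteratedFDeriv ℝ i P.S z‖ ≤ C)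
    (hρ : ∀ z ∈ D, 0 < resDist P N z) {u : Family}
    (ha : IsAnsatz D N u) (halg : AlgebraicEqs P D N u) {m : ℕ} (hm : 1 ≤ m) (hmN : m ≤ N)
    (hcar : ∀ q, 1 ≤ q → q ≤ m → 𝓒 (q - 1) (u q (1, 0))) (p : Mode) : 𝓒 (m - 1) (u m p) := by
  by_cases e1 : p = (1, 0)
  · rw [e1]; exact hcar m hm le_rfl
  by_cases e2 : p = (-1, 0)
  · rw [e2]; exact h.carrier_conj ha hmN (hcar m hm le_rfl)
  exact h.noncarrier hS hD hSb hρ ha halg hm hmN (fun q h1 h2 => hcar q h1 h2.le) e1 e2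

end AmpClass

/-! ### Instances of `AmpClass`: smoothness, order of the singularities, dependence on `ζ`. -/

section Instances

variable {P : Driver} {N : ℕ} {D : Set (ℝ × ℝ)}

theorem ampClass_smooth (P : Driver) (N : ℕ) (hD : IsOpen D) :
    AmpClass P N D (fun _ v => SmoothAmp D v) where
  smooth h := h
  congr h e := h.congr_amp e
  zero _ := contDiffOn_const
  add h h' := h.add h'
  mono h _ := h
  pd h i := h.pd hD i
  coef hc h := hc.smooth.mul h
  mul h h' := h.mul h'
  conj h := h.cconj

theorem ampClass_singular (hD : IsOpen D) (hρ : ∀ z ∈ D, 0 < resDist P N z) :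
    AmpClass P N D (fun r v => SmoothAmp D v ∧ SingularOrder P N D r v) where
  smooth h := h.1
  congr h e := ⟨h.1.congr_amp e, h.2.congr hD e⟩
  zero r := ⟨contDiffOn_const, singularOrder_zero r⟩
  add h h' := ⟨h.1.add h'.1, h.2.add hD h.1 h'.1 h'.2⟩
  mono h hr := ⟨h.1, h.2.mono hρ hr⟩
  pd h i := ⟨h.1.pd hD i, h.2.pd hD h.1 i⟩
  coef hc h := ⟨hc.smooth.mul h.1, hc.sing.mul hρ hD hc.smooth h.1 h.2⟩
  mul h h' := ⟨h.1.mul h'.1, h.2.mul hρ hD h.1 h'.1 h'.2⟩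
  conj h := ⟨h.1.cconj, h.2.cconj hD h.1⟩

/-- The translation by `y' - y` changes neither the slow variables nor `ζ`. Hence `v` agrees with
its translate near `y`, and so do the derivatives. -/
theorem DependsOnZeta.pd (hD : IsOpen D) {v : Amp} (h : DependsOnZeta P D v) (i : Fin 4) :
    DependsOnZeta P D (pd i v) := fun y hy y' hy' hs hz => by
  have h1 : (fun w => v (w + (y' - y))) =ᶠ[nhds y] v := by
    filter_upwards [dom_mem_nhds hD hy] with w hw
    have e1 : slow (w + (y' - y)) = slow w := by
      simp only [slow, Pi.add_apply, Pi.sub_apply, Prod.mk.injEq] at hs ⊢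
      exact ⟨by linarith [hs.1], by linarith [hs.2]⟩
    refine h _ ?_ _ hw e1 ?_
    · change slow _ ∈ D
      rw [e1]; exact hw
    · simp only [zeta, Pi.add_apply, Pi.sub_apply] at hz ⊢
      linarith
  have h2 := h1.fderiv_eq (𝕜 := ℝ)
  rw [fderiv_comp_add_right] at h2
  simp only [WKB.pd]
  rw [← h2, add_sub_cancel]

theorem ampClass_zeta (P : Driver) (N : ℕ) (hD : IsOpen D) :
    AmpClass P N D (fun _ v => SmoothAmp D v ∧ DependsOnZeta P D v) where
  smooth h := h.1
  congr h e := ⟨h.1.congr_amp e, fun y hy y' hy' h1 h2 => by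
    rw [← e hy, ← e hy']; exact h.2 y hy y' hy' h1 h2⟩
  zero r := ⟨contDiffOn_const, fun _ _ _ _ _ _ => rfl⟩
  add h h' := ⟨h.1.add h'.1, fun y hy y' hy' h1 h2 => by
    simp only [Pi.add_apply, h.2 y hy y' hy' h1 h2, h'.2 y hy y' hy' h1 h2]⟩
  mono h hr := h
  pd h i := ⟨h.1.pd hD i, h.2.pd hD i⟩
  coef hc h := ⟨hc.smooth.mul h.1, fun y hy y' hy' h1 h2 => by
    simp only [Pi.mul_apply, h.2 y hy y' hy' h1 h2, hc.slow y hy y' hy' h1]⟩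
  mul h h' := ⟨h.1.mul h'.1, fun y hy y' hy' h1 h2 => by
    simp only [Pi.mul_apply, h.2 y hy y' hy' h1 h2, h'.2 y hy y' hy' h1 h2]⟩
  conj h := ⟨h.1.cconj, fun y hy y' hy' h1 h2 => by
    simp only [cconj, h.2 y hy y' hy' h1 h2]⟩

end Instances

/-! ### Dependence of the recurrent system on the family -/

theorem cubic_congr {u v : Family} {n : ℕ} {y : Fin 4 → ℝ}
    (h : ∀ q, q + 2 ≤ n → ∀ p, u q p y = v q p y) (p : Mode) : cubic u n p y = cubic v n p y := by
  refine Finset.sum_congr rfl fun q hq => Finset.sum_congr rfl fun r hr => ?_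
  simp only [Finset.mem_filter, Finset.mem_product] at hq hr
  obtain ⟨-, hq⟩ := hq
  obtain ⟨⟨h1, h2, h3⟩, -⟩ := hr
  have h1 := pos_of_mem_Omega h1
  have h2 := pos_of_mem_Omega h2
  have h3 := pos_of_mem_Omega h3
  rw [h q.1 (by omega), h q.2.1 (by omega), h q.2.2 (by omega)]

theorem lower_congr (P : Driver) {D : Set (ℝ × ℝ)} (hD : IsOpen D) {u v : Family} {n : ℕ}
    (hn : 1 ≤ n) (h : ∀ q < n, ∀ p, Set.EqOn (u q p) (v q p) (dom D)) (p : Mode) :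
    Set.EqOn (lower P u n p) (lower P v n p) (dom D) := fun y hy => by
  have e : ∀ k, 1 ≤ k → ∀ l p, pds l (u (n - k) p) y = pds l (v (n - k) p) y :=
    fun k hk l p => pds_congr hD (h (n - k) (by omega) p) l hy
  have e1 := e 1 (by omega)
  have e2 := e 2 (by omega)
  have e3 := e 3 (by omega)
  have e4 := e 4 (by omega)
  have c := cubic_congr (n := n) (y := y) (fun q hq p => h q (by omega) p hy) p
  simp only [lower]
  rw [c, show pd 1 (u (n - 1) p) y = _ from e1 [1] p, show pd 0 (u (n - 1) p) y = _ from e1 [0] p,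
    show pd 1 (pd 1 (u (n - 2) p)) y = _ from e2 [1, 1] p,
    show pd 0 (pd 0 (u (n - 2) p)) y = _ from e2 [0, 0] p,
    show pd 3 (u (n - 2) p) y = _ from e2 [3] p, show pd 2 (u (n - 2) p) y = _ from e2 [2] p,
    show u (n - 2) p y = _ from e2 [] p, show pd 1 (pd 3 (u (n - 3) p)) y = _ from e3 [1, 3] p,
    show pd 0 (pd 2 (u (n - 3) p)) y = _ from e3 [0, 2] p,
    show pd 3 (pd 3 (u (n - 4) p)) y = _ from e4 [3, 3] p,
    show pd 2 (pd 2 (u (n - 4) p)) y = _ from e4 [2, 2] p,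
    show u (n - 1) (p.1, p.2 - 1) y = _ from e1 [] _,
    show u (n - 1) (p.1, p.2 + 1) y = _ from e1 [] _]
  rfl

theorem algAmp_congr (P : Driver) {D : Set (ℝ × ℝ)} (hD : IsOpen D) {u v : Family} {n : ℕ}
    (hn : 1 ≤ n) (h : ∀ q < n, ∀ p, Set.EqOn (u q p) (v q p) (dom D)) (p : Mode) :
    Set.EqOn (algAmp P u n p) (algAmp P v n p) (dom D) := fun y hy => by
  simp only [algAmp, lower_congr P hD hn h p hy]

theorem cubic_neg {u : Family} {n : ℕ} {y : Fin 4 → ℝ}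
    (h : ∀ q, q + 2 ≤ n → ∀ p, u q (-p) y = (starRingEnd ℂ) (u q p y)) (p : Mode) :
    cubic u n (-p) y = (starRingEnd ℂ) (cubic u n p y) := by
  simp only [cubic, map_sum]
  refine Finset.sum_congr rfl fun q hq => ?_
  simp only [Finset.mem_filter] at hq
  refine Finset.sum_nbij' (fun r => -r) (fun r => -r) ?_ ?_ ?_ ?_ ?_
  · intro r hr
    simp only [Finset.mem_filter, Finset.mem_product] at hr ⊢
    obtain ⟨⟨h1, h2, h3⟩, hs⟩ := hr
    refine ⟨⟨Omega_neg h1, Omega_neg h2, Omega_neg h3⟩, ?_⟩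
    rw [← neg_neg p, ← hs]
    simp only [Prod.fst_neg, Prod.snd_neg]; abel
  · intro r hr
    simp only [Finset.mem_filter, Finset.mem_product] at hr ⊢
    obtain ⟨⟨h1, h2, h3⟩, hs⟩ := hr
    refine ⟨⟨Omega_neg h1, Omega_neg h2, Omega_neg h3⟩, ?_⟩
    rw [← hs]
    simp only [Prod.fst_neg, Prod.snd_neg]; abel
  · intro r _; exact neg_neg r
  · intro r _; exact neg_neg r
  · intro r hr
    simp only [Finset.mem_filter, Finset.mem_product] at hr
    obtain ⟨⟨h1, h2, h3⟩, -⟩ := hr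
    have h1 := pos_of_mem_Omega h1
    have h2 := pos_of_mem_Omega h2
    have h3 := pos_of_mem_Omega h3
    simp only [Prod.fst_neg, Prod.snd_neg, map_mul]
    rw [← h q.1 (by omega), ← h q.2.1 (by omega), ← h q.2.2 (by omega), neg_neg, neg_neg, neg_neg]

/-- Passing from `p` to `-p` reverses the sign of the phase, and conjugation reverses the sign of
`i`. In each term these two occur together or not at all, so the reality condition is inherited from
lower orders. -/
theorem lower_neg (P : Driver) (hS : ContDiff ℝ ∞ P.S) {D : Set (ℝ × ℝ)} (hD : IsOpen D)
    {u : Family} {n : ℕ} (hn : 1 ≤ n) (hs : ∀ q < n, ∀ p, SmoothAmp D (u q p))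
    (h : ∀ q < n, ∀ p, ∀ y ∈ dom D, u q (-p) y = (starRingEnd ℂ) (u q p y)) (p : Mode) :
    ∀ y ∈ dom D, lower P u n (-p) y = (starRingEnd ℂ) (lower P u n p y) := fun y hy => by
  have e : ∀ k, 1 ≤ k → ∀ l p, pds l (u (n - k) (-p)) y
      = (starRingEnd ℂ) (pds l (u (n - k) p) y) := fun k hk l p => by
    have e1 := pds_congr hD (w := cconj (u (n - k) p)) (fun y hy => h (n - k) (by omega) p y hy) l hy
    rw [e1, pds_cconj hD (hs _ (by omega) p) l hy]
    rfl
  have e1 := e 1 (by omega)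
  have e2 := e 2 (by omega)
  have e3 := e 3 (by omega)
  have e4 := e 4 (by omega)
  have c := cubic_neg (n := n) (y := y) (fun q hq p => h q (by omega) p y hy) p
  simp only [lower]
  rw [c, show pd 1 (u (n - 1) (-p)) y = _ from e1 [1] p,
    show pd 0 (u (n - 1) (-p)) y = _ from e1 [0] p,
    show pd 1 (pd 1 (u (n - 2) (-p))) y = _ from e2 [1, 1] p,
    show pd 0 (pd 0 (u (n - 2) (-p))) y = _ from e2 [0, 0] p,
    show pd 3 (u (n - 2) (-p)) y = _ from e2 [3] p, show pd 2 (u (n - 2) (-p)) y = _ from e2 [2] p,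
    show u (n - 2) (-p) y = _ from e2 [] p, show pd 1 (pd 3 (u (n - 3) (-p))) y = _ from e3 [1, 3] p,
    show pd 0 (pd 2 (u (n - 3) (-p))) y = _ from e3 [0, 2] p,
    show pd 3 (pd 3 (u (n - 4) (-p))) y = _ from e4 [3, 3] p,
    show pd 2 (pd 2 (u (n - 4) (-p))) y = _ from e4 [2, 2] p,
    show (((-p).1, (-p).2 - 1) : Mode) = -(p.1, p.2 + 1) by ext <;> simp; ring,
    show (((-p).1, (-p).2 + 1) : Mode) = -(p.1, p.2 - 1) by ext <;> simp; ring,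
    show u (n - 1) (-(p.1, p.2 + 1)) y = _ from e1 [] _,
    show u (n - 1) (-(p.1, p.2 - 1)) y = _ from e1 [] _]
  rw [dt_dt_phase hS, dx_dx_phase hS, dt_dt_phase hS, dx_dx_phase hS]
  simp only [pds_cons, pds_nil, map_add, map_mul, map_sub, Complex.conj_I, Complex.conj_ofReal,
    map_ofNat, map_div₀, dt_phase hS, dx_phase hS, Prod.fst_neg, Prod.snd_neg]
  push_cast
  ring

/-! ### Solution of the algebraic equations -/

/-- The amplitudes of order `n`, if those of lower order and the carrier amplitudes are given. -/
noncomputable def solveStep (P : Driver) (a : ℕ → Amp) (prev : Family) (n : ℕ) : Mode → Amp :=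
  fun p => if p = (1, 0) then a n else if p = (-1, 0) then cconj (a n)
    else if p ∈ Omega n then algAmp P prev n p else 0

/-- The families obtained from the first `n` steps. -/
noncomputable def solveUpTo (P : Driver) (a : ℕ → Amp) : ℕ → Family
  | 0 => fun _ _ => 0
  | n + 1 => Function.update (solveUpTo P a n) (n + 1) (solveStep P a (solveUpTo P a n) (n + 1))

/-- The solution of the algebraic equations with given carrier amplitudes. -/
noncomputable def solveAlg (P : Driver) (a : ℕ → Amp) : Family := fun n => solveUpTo P a n n

theorem solveUpTo_eq (P : Driver) (a : ℕ → Amp) {n q : ℕ} (h : q ≤ n) :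
    solveUpTo P a n q = solveAlg P a q := by
  induction n with
  | zero => obtain rfl : q = 0 := by omega
            rfl
  | succ n ih =>
    rcases Nat.lt_or_ge n q with h' | h'
    · obtain rfl : q = n + 1 := by omega
      rfl
    · rw [solveUpTo, Function.update_of_ne (by omega), ih h']

theorem solveAlg_zero (P : Driver) (a : ℕ → Amp) : solveAlg P a 0 = fun _ => 0 := rfl

/-- Later updates leave the orders up to `n` untouched, and `algAmp` of order `n + 1` sees no
others; so the step may be evaluated at the final family. -/
theorem solveAlg_succ (P : Driver) (a : ℕ → Amp) {D : Set (ℝ × ℝ)} (hD : IsOpen D) (n : ℕ)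
    (p : Mode) : Set.EqOn (solveAlg P a (n + 1) p) (solveStep P a (solveAlg P a) (n + 1) p)
      (dom D) := fun y hy => by
  have e : solveAlg P a (n + 1) = solveStep P a (solveUpTo P a n) (n + 1) := by
    simp [solveAlg, solveUpTo]
  rw [e]
  have := algAmp_congr P hD (n := n + 1) (by omega) (u := solveUpTo P a n) (v := solveAlg P a)
    (fun q hq p y _ => by rw [solveUpTo_eq P a (by omega : q ≤ n)]) p hy
  simp only [solveStep]
  split_ifs
  · rfl
  · rfl
  · exact this
  · rfl

section Solve

variable {P : Driver} {N : ℕ} {D : Set (ℝ × ℝ)}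

theorem algAmp_neg (hS : ContDiff ℝ ∞ P.S) (hD : IsOpen D)
    {u : Family} {n : ℕ} (hn : 1 ≤ n) (hs : ∀ q < n, ∀ p, SmoothAmp D (u q p))
    (h : ∀ q < n, ∀ p, ∀ y ∈ dom D, u q (-p) y = (starRingEnd ℂ) (u q p y)) (p : Mode) :
    ∀ y ∈ dom D, algAmp P u n (-p) y = (starRingEnd ℂ) (algAmp P u n p y) := fun y hy => by
  simp only [algAmp, map_mul, map_div₀, map_one, Complex.conj_ofReal, eikonal_phase_neg hS,
    lower_neg P hS hD hn hs h p y hy]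

/-- The three properties are proved in one induction: smoothness and reality of the next order need
the smoothness of all lower ones, because conjugation is to be exchanged with derivatives. -/
theorem solveAlg_spec (hS : ContDiff ℝ ∞ P.S) (hD : IsOpen D)
    (hSb : ∀ i : ℕ, 1 ≤ i → ∃ C : ℝ, ∀ z ∈ D, ‖iteratedFDeriv ℝ i P.S z‖ ≤ C)
    (hρ : ∀ z ∈ D, 0 < resDist P N z) {a : ℕ → Amp} (ha : ∀ n, SmoothAmp D (a n)) (n : ℕ)
    (hn : n ≤ N) :
    (∀ p, SmoothAmp D (solveAlg P a n p)) ∧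
      (∀ p, p ∉ Omega n → ∀ y ∈ dom D, solveAlg P a n p y = 0) ∧
      ∀ p, ∀ y ∈ dom D, solveAlg P a n (-p) y = (starRingEnd ℂ) (solveAlg P a n p y) := by
  induction n using Nat.strong_induction_on with
  | _ n ih =>
    match n, ih, hn with
    | 0, _, _ =>
      rw [solveAlg_zero]
      exact ⟨fun p => contDiffOn_const, fun p _ y _ => rfl, fun p y _ => by simp⟩
    | n + 1, ih, hn =>
      have hcl := ampClass_smooth P N hD
      have h0 : ∀ p, Set.EqOn (solveAlg P a 0 p) 0 (dom D) := fun p y _ => rfl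
      have hsm : ∀ q < n + 1, ∀ p, SmoothAmp D (solveAlg P a q p) :=
        fun q hq p => (ih q hq (by omega)).1 p
      have hre : ∀ q < n + 1, ∀ p, ∀ y ∈ dom D, solveAlg P a q (-p) y
        = (starRingEnd ℂ) (solveAlg P a q p y) := fun q hq p => (ih q hq (by omega)).2.2 p
      have heq := solveAlg_succ P a hD n
      refine ⟨fun p => SmoothAmp.congr_amp ?_ (heq p).symm, fun p hp y hy => ?_,
        fun p y hy => ?_⟩
      · simp only [solveStep]
        split_ifs with h1 h2 h3
        · exact ha _
        · exact (ha _).cconj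
        · have hd := mem_drivenModes (N := N) (le_max_of_le_left hn) h3 h1 h2
          exact (isCoef_inv_eikonal hS hD hSb hρ hd).smooth.mul
            (hcl.lower hS hD hSb hρ h0 (fun q _ hq p => hsm q hq p) p)
        · exact contDiffOn_const
      · have h1 : p ≠ (1, 0) := by
          rintro rfl; exact hp (carrier_mem_Omega (by omega))
        have h2 : p ≠ (-1, 0) := by
          rintro rfl
          exact hp (by simpa using Omega_neg (carrier_mem_Omega (show 1 ≤ n + 1 by omega)))
        rw [heq p hy]
        simp [solveStep, h1, h2, hp]
      · rw [heq p hy, heq (-p) hy]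
        by_cases h1 : p = (1, 0)
        · subst h1; simp [solveStep, cconj]
        by_cases h2 : p = (-1, 0)
        · subst h2; simp [solveStep, cconj]
        have h1' : -p ≠ (1, 0) := fun h => h2 (by rw [← neg_neg p, h]; simp)
        have h2' : -p ≠ (-1, 0) := fun h => h1 (by rw [← neg_neg p, h]; simp)
        by_cases hp : p ∈ Omega (n + 1)
        · simp only [solveStep, h1, h2, h1', h2', hp, Omega_neg hp, if_true, if_false]
          exact algAmp_neg hS hD (by omega) hsm hre p y hy
        · have hp' : -p ∉ Omega (n + 1) := fun h => hp (by simpa using Omega_neg h)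
          simp [solveStep, h1, h2, h1', h2', hp, hp']

/-- Uniqueness is the same recursion read backwards: the mode `(1, 0)` is prescribed, `(-1, 0)`
follows by reality, modes outside `Ω_n` vanish, and all others are functions of the lower orders. -/
theorem existsUnique_algebraic (hS : ContDiff ℝ ∞ P.S) (hD : IsOpen D)
    (hSb : ∀ i : ℕ, 1 ≤ i → ∃ C : ℝ, ∀ z ∈ D, ‖iteratedFDeriv ℝ i P.S z‖ ≤ C)
    (hρ : ∀ z ∈ D, 0 < resDist P N z) (a : ℕ → Amp) (ha : ∀ n, SmoothAmp D (a n)) :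
    ∃ u : Family, (IsAnsatz D N u ∧ AlgebraicEqs P D N u ∧
        ∀ n, 1 ≤ n → n ≤ N → Set.EqOn (u n (1, 0)) (a n) (dom D)) ∧
      ∀ u' : Family, (IsAnsatz D N u' ∧ AlgebraicEqs P D N u' ∧
          ∀ n, 1 ≤ n → n ≤ N → Set.EqOn (u' n (1, 0)) (a n) (dom D)) →
        ∀ n ≤ N, ∀ p, Set.EqOn (u' n p) (u n p) (dom D) := by
  have hsp := fun n hn => solveAlg_spec (N := N) hS hD hSb hρ ha n hn
  have hans : IsAnsatz D N (solveAlg P a) :=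
    ⟨fun n hn => (hsp n hn).1, fun n hn => (hsp n hn).2.1, fun n hn => (hsp n hn).2.2⟩
  have halg : AlgebraicEqs P D N (solveAlg P a) := by
    intro n h1 _ p hp e1 e2 y hy
    obtain ⟨m, rfl⟩ : ∃ m, n = m + 1 := ⟨n - 1, by omega⟩
    rw [solveAlg_succ P a hD m p hy]
    simp [solveStep, e1, e2, hp]
  have hcar : ∀ n, 1 ≤ n → n ≤ N → Set.EqOn (solveAlg P a n (1, 0)) (a n) (dom D) := by
    intro n h1 _ y hy
    obtain ⟨m, rfl⟩ : ∃ m, n = m + 1 := ⟨n - 1, by omega⟩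
    rw [solveAlg_succ P a hD m _ hy]
    simp [solveStep]
  refine ⟨solveAlg P a, ⟨hans, halg, hcar⟩, ?_⟩
  rintro u ⟨ha', halg', hcar'⟩ n hn
  induction n using Nat.strong_induction_on with
  | _ n ih =>
    intro p y hy
    by_cases hp : p ∈ Omega n
    · have h1 := pos_of_mem_Omega hp
      by_cases e1 : p = (1, 0)
      · rw [e1, hcar' n h1 hn hy, hcar n h1 hn hy]
      by_cases e2 : p = (-1, 0)
      · have r1 := ha'.real n hn (1, 0) y hy
        have r2 := hans.real n hn (1, 0) y hy
        rw [hcar' n h1 hn hy] at r1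
        rw [hcar n h1 hn hy] at r2
        rw [e2]
        simpa using r1.trans r2.symm
      rw [halg' n h1 hn p hp e1 e2 y hy, halg n h1 hn p hp e1 e2 y hy]
      exact algAmp_congr P hD h1 (fun q hq p => ih q hq (by omega) p) p hy
    · rw [ha'.support n hn p hp y hy, hans.support n hn p hp y hy]

end Solve

end WKB

namespace WKB

/-! ### The cubic term -/

/-- The part of the cubic term with given orders of the factors. -/
noncomputable def tri (u : Family) (a b c : ℕ) (p : Mode) (y : Fin 4 → ℝ) : ℂ :=
  ∑ r ∈ (Omega a ×ˢ Omega b ×ˢ Omega c).filter (fun r => r.1 + r.2.1 + r.2.2 = p),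
    u a r.1 y * u b r.2.1 y * u c r.2.2 y

theorem cubic_eq_sum_tri (u : Family) (n : ℕ) (p : Mode) (y : Fin 4 → ℝ) :
    cubic u n p y = ∑ q ∈ (Finset.range (n + 1) ×ˢ Finset.range (n + 1) ×ˢ
      Finset.range (n + 1)).filter (fun q => q.1 + q.2.1 + q.2.2 = n),
        tri u q.1 q.2.1 q.2.2 p y := rfl

theorem tri_swap_left (u : Family) (a b c : ℕ) (p : Mode) (y : Fin 4 → ℝ) :
    tri u a b c p y = tri u b a c p y := by
  refine Finset.sum_nbij' (fun r => (r.2.1, r.1, r.2.2)) (fun r => (r.2.1, r.1, r.2.2))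
    ?_ ?_ (fun _ _ => rfl) (fun _ _ => rfl) (fun _ _ => by ring)
  all_goals
    intro r hr
    simp only [Finset.mem_filter, Finset.mem_product] at hr ⊢
    exact ⟨⟨hr.1.2.1, hr.1.1, hr.1.2.2⟩, by rw [← hr.2]; abel⟩

theorem tri_swap_right (u : Family) (a b c : ℕ) (p : Mode) (y : Fin 4 → ℝ) :
    tri u a b c p y = tri u a c b p y := by
  refine Finset.sum_nbij' (fun r => (r.1, r.2.2, r.2.1)) (fun r => (r.1, r.2.2, r.2.1))
    ?_ ?_ (fun _ _ => rfl) (fun _ _ => rfl) (fun _ _ => by ring)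
  all_goals
    intro r hr
    simp only [Finset.mem_filter, Finset.mem_product] at hr ⊢
    exact ⟨⟨hr.1.1, hr.1.2.2, hr.1.2.1⟩, by rw [← hr.2]; abel⟩

theorem tri_congr {u v : Family} {a b c : ℕ} (ha : u a = v a) (hb : u b = v b) (hc : u c = v c)
    (p : Mode) (y : Fin 4 → ℝ) : tri u a b c p y = tri v a b c p y := by
  simp only [tri, ha, hb, hc]

theorem tri_eq_zero {u : Family} {a b c : ℕ} (h : a = 0 ∨ b = 0 ∨ c = 0)
    (p : Mode) (y : Fin 4 → ℝ) : tri u a b c p y = 0 := by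
  rcases h with rfl | rfl | rfl <;> simp [tri, Omega_zero]

/-- The two factors of order one are carriers, so their modes add up to `(2, 0)`, `(0, 0)` twice, or
`(-2, 0)`, and the mode of the first factor is forced. The contribution of `(3, 0)` contains no
carrier amplitude of order `n` and later remains in the source. -/
theorem tri_one_one {u : Family} {n : ℕ} {y : Fin 4 → ℝ}
    (hs : ∀ p, p ∉ Omega n → u n p y = 0) :
    tri u n 1 1 (1, 0) y = u n (-1, 0) y * u 1 (1, 0) y ^ 2
      + 2 * u n (1, 0) y * u 1 (1, 0) y * u 1 (-1, 0) y + u n (3, 0) y * u 1 (-1, 0) y ^ 2 := by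
  have key : ∀ d : Mode, ∀ c : ℂ, ∑ r ∈ Omega n, (if r + d = (1, 0) then u n r y * c else 0)
      = u n ((1, 0) - d) y * c := by
    intro d c
    have e : ∀ r : Mode, (r + d = (1, 0)) = (r = (1, 0) - d) := fun r => by
      rw [eq_sub_iff_add_eq]
    simp only [e, Finset.sum_ite_eq']
    split_ifs with h
    · rfl
    · rw [hs _ h, zero_mul]
  rw [tri, Finset.sum_filter, Finset.sum_product]
  simp only [Finset.sum_product, Omega_one]
  have hne : ((1, 0) : Mode) ≠ (-1, 0) := by decide
  simp only [Finset.sum_insert (show ((1, 0) : Mode) ∉ ({(-1, 0)} : Finset Mode) by decide),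
    Finset.sum_singleton, Finset.sum_add_distrib]
  have k1 := key ((1, 0) + (1, 0)) (u 1 (1, 0) y * u 1 (1, 0) y)
  have k2 := key ((1, 0) + (-1, 0)) (u 1 (1, 0) y * u 1 (-1, 0) y)
  have k3 := key ((-1, 0) + (1, 0)) (u 1 (-1, 0) y * u 1 (1, 0) y)
  have k4 := key ((-1, 0) + (-1, 0)) (u 1 (-1, 0) y * u 1 (-1, 0) y)
  simp only [← add_assoc, ← mul_assoc] at k1 k2 k3 k4
  rw [k1, k2, k3, k4]
  rw [show ((1, 0) : Mode) - ((1, 0) + (1, 0)) = (-1, 0) by decide,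
    show ((1, 0) : Mode) - ((1, 0) + (-1, 0)) = (1, 0) by decide,
    show ((1, 0) : Mode) - ((-1, 0) + (1, 0)) = (1, 0) by decide,
    show ((1, 0) : Mode) - ((-1, 0) + (-1, 0)) = (3, 0) by decide]
  ring

theorem cubic_three {u : Family} {y : Fin 4 → ℝ} (hs : ∀ p, p ∉ Omega 1 → u 1 p y = 0) :
    cubic u 3 (1, 0) y = 3 * u 1 (-1, 0) y * u 1 (1, 0) y ^ 2 := by
  have h3 : ((3, 0) : Mode) ∉ Omega 1 := by rw [Omega_one]; decide
  have e : cubic u 3 (1, 0) y = tri u 1 1 1 (1, 0) y := by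
    rw [cubic_eq_sum_tri]
    refine Finset.sum_eq_single (1, 1, 1) ?_ ?_
    · intro q hq hne
      refine tri_eq_zero ?_ _ _
      by_contra hc
      simp only [Finset.mem_filter] at hq
      push Not at hc
      refine hne ?_
      ext <;> simp only <;> omega
    · intro h
      exact absurd (by simp) h
  rw [e, tri_one_one hs, hs _ h3]
  ring

theorem dropCarrier_of_ne {n q : ℕ} (h : q ≠ n) (u : Family) : dropCarrier n u q = u q := by
  funext p; simp [dropCarrier, h]

theorem dropCarrier_carrier (n : ℕ) (u : Family) : dropCarrier n u n (1, 0) = 0 := by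
  simp [dropCarrier]

theorem dropCarrier_neg_carrier (n : ℕ) (u : Family) : dropCarrier n u n (-1, 0) = 0 := by
  simp [dropCarrier]

theorem dropCarrier_of_mode {p : Mode} (h1 : p ≠ (1, 0)) (h2 : p ≠ (-1, 0)) (n q : ℕ)
    (u : Family) : dropCarrier n u q p = u q p := by
  simp [dropCarrier, h1, h2]

/-- Orders are positive, so order `n` occurs in a triple with sum `n + 2` only beside two ones. The
three arrangements are distinct because `n ≥ 2`, and they account for the factor `3`; all other
triples are unaffected by the removal. -/
theorem cubic_drop {u : Family} {n : ℕ} (hn : 2 ≤ n) {y : Fin 4 → ℝ}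
    (hs : ∀ p, p ∉ Omega n → u n p y = 0) :
    cubic u (n + 2) (1, 0) y = cubic (dropCarrier n u) (n + 2) (1, 0) y
      + 3 * (u n (-1, 0) y * u 1 (1, 0) y ^ 2
        + 2 * u n (1, 0) y * u 1 (1, 0) y * u 1 (-1, 0) y) := by
  set v := dropCarrier n u with hv
  have hvs : ∀ p, p ∉ Omega n → v n p y = 0 := by
    intro p hp
    simp only [hv, dropCarrier]
    split_ifs
    · rfl
    · exact hs p hp
  have hdiff : tri u n 1 1 (1, 0) y - tri v n 1 1 (1, 0) y = u n (-1, 0) y * u 1 (1, 0) y ^ 2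
        + 2 * u n (1, 0) y * u 1 (1, 0) y * u 1 (-1, 0) y := by
    rw [tri_one_one hs, tri_one_one hvs]
    have e1 : v 1 = u 1 := dropCarrier_of_ne (by omega) u
    have e2 : v n (3, 0) = u n (3, 0) := dropCarrier_of_mode (by decide) (by decide) n n u
    rw [e1, e2, hv, dropCarrier_carrier, dropCarrier_neg_carrier]
    simp only [Pi.zero_apply]
    ring
  rw [← sub_eq_iff_eq_add', cubic_eq_sum_tri, cubic_eq_sum_tri, ← Finset.sum_sub_distrib]
  have hsub : ({(n, 1, 1), (1, n, 1), (1, 1, n)} : Finset (ℕ × ℕ × ℕ)) ⊆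
      (Finset.range (n + 2 + 1) ×ˢ Finset.range (n + 2 + 1) ×ˢ
        Finset.range (n + 2 + 1)).filter (fun q => q.1 + q.2.1 + q.2.2 = n + 2) := by
    rintro ⟨q1, q2, q3⟩ hq
    simp only [Finset.mem_insert, Finset.mem_singleton, Prod.mk.injEq] at hq
    simp only [Finset.mem_filter, Finset.mem_product, Finset.mem_range]
    omega
  rw [← Finset.sum_subset hsub]
  · rw [Finset.sum_insert, Finset.sum_insert, Finset.sum_singleton]
    · have s1 : ∀ w : Family, tri w 1 n 1 (1, 0) y = tri w n 1 1 (1, 0) y :=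
        fun w => tri_swap_left w _ _ _ _ _
      have s2 : ∀ w : Family, tri w 1 1 n (1, 0) y = tri w n 1 1 (1, 0) y :=
        fun w => (tri_swap_right w _ _ _ _ _).trans (tri_swap_left w _ _ _ _ _)
      simp only [s1, s2, hdiff]
      ring
    · simp only [Finset.mem_singleton, Prod.mk.injEq]; omega
    · simp only [Finset.mem_insert, Finset.mem_singleton, Prod.mk.injEq]; omega
  · intro q hq hq'
    simp only [Finset.mem_filter] at hq
    simp only [Finset.mem_insert, Finset.mem_singleton, not_or] at hq'
    obtain ⟨q1, q2, q3⟩ := q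
    simp only [Prod.mk.injEq] at hq hq' ⊢
    by_cases h0 : q1 = 0 ∨ q2 = 0 ∨ q3 = 0
    · rw [tri_eq_zero h0, tri_eq_zero h0, sub_zero]
    · have e : ∀ q, q ≠ n → u q = v q := fun q h => (dropCarrier_of_ne h u).symm
      rw [tri_congr (e q1 (by omega)) (e q2 (by omega)) (e q3 (by omega)), sub_self]

/-! ### The resonant mode -/

/-- The left-hand side of the equation for the carrier amplitude of order `n`. -/
noncomputable def carrierLhs (P : Driver) (u : Family) (n : ℕ) : Amp := fun y =>
  2 * Complex.I * ((P.om : ℂ) * pd 3 (u n (1, 0)) y - (P.k : ℂ) * pd 2 (u n (1, 0)) y)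
    - dzeta P (dzeta P (u n (1, 0))) y + carrierTerms P u n y

section Carrier

variable {P : Driver} {N : ℕ} {D : Set (ℝ × ℝ)}

theorem lower_carrier (hS : ContDiff ℝ ∞ P.S) (u : Family) (m : ℕ) (y : Fin 4 → ℝ) :
    lower P u m (1, 0) y =
      2 * Complex.I * ((P.om : ℂ) * pd 1 (u (m - 1) (1, 0)) y
        - (P.k : ℂ) * pd 0 (u (m - 1) (1, 0)) y)
      + (pd 1 (pd 1 (u (m - 2) (1, 0))) y - pd 0 (pd 0 (u (m - 2) (1, 0))) y)
      + 2 * Complex.I * ((P.om : ℂ) * pd 3 (u (m - 2) (1, 0)) y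
        - (P.k : ℂ) * pd 2 (u (m - 2) (1, 0)) y)
      + 2 * (pd 1 (pd 3 (u (m - 3) (1, 0))) y - pd 0 (pd 2 (u (m - 3) (1, 0))) y)
      + (pd 3 (pd 3 (u (m - 4) (1, 0))) y - pd 2 (pd 2 (u (m - 4) (1, 0))) y)
      + (P.f : ℂ) / 2 * (u (m - 1) (1, -1) y + u (m - 1) (1, 1) y)
      + (P.γ : ℂ) * cubic u m (1, 0) y := by
  simp only [lower]
  rw [dt_dt_phase hS, dx_dx_phase hS, dt_phase hS, dx_phase hS]
  simp

/-- The vector `ω e₁ - k e₀` is tangent to the level lines of `ζ`, so the derivative along it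
vanishes. -/
theorem pd_one_eq (hom : P.om ^ 2 = P.k ^ 2 + 1) (hD : IsOpen D) {v : Amp} (hv : SmoothAmp D v)
    (hz : DependsOnZeta P D v) :
    Set.EqOn (pd 1 v) (fun y => (P.k : ℂ) * (P.om : ℂ)⁻¹ * pd 0 v y) (dom D) := fun y hy => by
  have hom0 : P.om ≠ 0 := by rintro h; rw [h] at hom; nlinarith [sq_nonneg P.k]
  have hom0' : (P.om : ℂ) ≠ 0 := by exact_mod_cast hom0
  set w : Fin 4 → ℝ := P.om • Pi.single 1 1 - P.k • Pi.single 0 1 with hw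
  have h1 := (hv.differentiableAt hD hy).hasFDerivAt
  have hsl : ∀ t : ℝ, slow (y + t • w) = slow y := by
    intro t; simp [slow, hw]
  have hze : ∀ t : ℝ, zeta P (y + t • w) = zeta P y := by
    intro t; simp [zeta, hw]; ring
  have h2 : HasDerivAt (fun t : ℝ => v (y + t • w)) (fderiv ℝ v y w) 0 := by
    have h3 : HasDerivAt (fun t : ℝ => y + t • w) w 0 := by
      simpa using ((hasDerivAt_id (0 : ℝ)).smul_const w).const_add y
    have h1' : HasFDerivAt v (fderiv ℝ v y) (y + (0 : ℝ) • w) := by simpa using h1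
    exact h1'.comp_hasDerivAt 0 h3
  have h4 : (fun t : ℝ => v (y + t • w)) = fun _ => v y := by
    funext t
    refine hz _ ?_ _ hy (hsl t) (hze t)
    change slow _ ∈ D
    rw [hsl t]; exact hy
  rw [h4] at h2
  have h5 := h2.unique (hasDerivAt_const _ _)
  rw [hw, map_sub, map_smul, map_smul] at h5
  change P.om • pd 1 v y - P.k • pd 0 v y = 0 at h5
  simp only [Complex.real_smul] at h5
  field_simp
  linear_combination h5

theorem dzeta_dzeta_eq (hD : IsOpen D) {v : Amp} (hv : SmoothAmp D v) :
    Set.EqOn (dzeta P (dzeta P v)) (fun y => (P.om : ℂ)⁻¹ ^ 2 * pd 0 (pd 0 v) y) (dom D) :=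
  fun y hy => by
    have h := pd_const_mul hD (hv.pd hD 0) (P.om : ℂ)⁻¹ 0 hy
    change (P.om : ℂ)⁻¹ * pd 0 (fun y => (P.om : ℂ)⁻¹ * pd 0 v y) y = _
    rw [h]
    ring

/-- For functions of `ζ` the wave operator is `(k² - ω²) ∂_ζ²`, and `ω² = k² + 1`. -/
theorem wave_eq_neg_dzeta (hom : P.om ^ 2 = P.k ^ 2 + 1) (hD : IsOpen D) {v : Amp}
    (hv : SmoothAmp D v) (hz : DependsOnZeta P D v) {y : Fin 4 → ℝ} (hy : y ∈ dom D) :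
    pd 1 (pd 1 v) y - pd 0 (pd 0 v) y = -dzeta P (dzeta P v) y := by
  have hom0 : P.om ≠ 0 := by rintro h; rw [h] at hom; nlinarith [sq_nonneg P.k]
  have hom0' : (P.om : ℂ) ≠ 0 := by exact_mod_cast hom0
  have hom' : (P.om : ℂ) ^ 2 = (P.k : ℂ) ^ 2 + 1 := by exact_mod_cast hom
  rw [dzeta_dzeta_eq hD hv hy, pd_one_eq hom hD (hv.pd hD 1) (hz.pd hD 1) hy]
  simp only
  rw [pd_comm hD hv 0 1 hy, pd_one_eq hom hD (hv.pd hD 0) (hz.pd hD 0) hy]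
  field_simp
  linear_combination -(pd 0 (pd 0 v) y) * hom'

variable {u : Family}

theorem sideband_mem_Omega {n : ℕ} (hn : 2 ≤ n) {m : ℤ} (hm : m = 1 ∨ m = -1) :
    ((1, m) : Mode) ∈ Omega n := by
  refine Omega_mono hn ?_
  rcases hm with rfl | rfl
  · simpa using Omega_up (carrier_mem_Omega le_rfl)
  · simpa using Omega_down (carrier_mem_Omega le_rfl)

/-- The coefficient of the resonant mode at order `n + 2`. -/
theorem lower_carrier_eq (hS : ContDiff ℝ ∞ P.S) (hom : P.om ^ 2 = P.k ^ 2 + 1) (hD : IsOpen D)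
    (ha : IsAnsatz D N u) (halg : AlgebraicEqs P D N u) {n : ℕ} (hn : 1 ≤ n) (hnN : n + 1 ≤ N)
    (hz : DependsOnZeta P D (u n (1, 0))) {y : Fin 4 → ℝ} (hy : y ∈ dom D) :
    lower P u (n + 2) (1, 0) y = 2 * Complex.I * ((P.om : ℂ) * pd 1 (u (n + 1) (1, 0)) y
        - (P.k : ℂ) * pd 0 (u (n + 1) (1, 0)) y) + carrierLhs P u n y := by
  have e1 := halg (n + 1) (by omega) hnN (1, 1) (sideband_mem_Omega (by omega) (Or.inl rfl))
    (by decide) (by decide) y hy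
  have e2 := halg (n + 1) (by omega) hnN (1, -1) (sideband_mem_Omega (by omega) (Or.inr rfl))
    (by decide) (by decide) y hy
  rw [lower_carrier hS, show n + 2 - 1 = n + 1 by omega, show n + 2 - 2 = n by omega,
    show n + 2 - 3 = n - 1 by omega, show n + 2 - 4 = n - 2 by omega, e1, e2,
    wave_eq_neg_dzeta hom hD (ha.smooth n (by omega) _) hz hy]
  simp only [carrierLhs, carrierTerms]
  ring

/-- At order `n + 1` the carrier of order `n` reaches a sideband only through the driver, which
shifts `m` by one: the derivative terms stay within the mode, and the cubic term contains orders up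
to `n - 1` only. The mode `(1, 2m)`, the other neighbour, is not removed. -/
theorem algAmp_sideband_drop {n : ℕ} (hn : 1 ≤ n)
    {m : ℤ} (hm : m = 1 ∨ m = -1) {y : Fin 4 → ℝ} (h2 : u n (1, 2 * m) y = u n (1, 2 * m) y) :
    algAmp P u (n + 1) (1, m) y = algAmp P (dropCarrier n u) (n + 1) (1, m) y
      + 1 / (eikonal (phase P (1, m)) (slow y) : ℂ) * ((P.f : ℂ) / 2 * u n (1, 0) y) := by
  have hm0 : m ≠ 0 := by omega
  have d1 : dropCarrier n u n (1, m) = u n (1, m) :=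
    dropCarrier_of_mode (by simp [hm0]) (by simp) n n u
  have d2 : dropCarrier n u (n - 1) = u (n - 1) := dropCarrier_of_ne (by omega) u
  have d3 : dropCarrier n u (n - 2) = u (n - 2) := dropCarrier_of_ne (by omega) u
  have d4 : dropCarrier n u (n - 3) = u (n - 3) := dropCarrier_of_ne (by omega) u
  have c : cubic (dropCarrier n u) (n + 1) (1, m) y = cubic u (n + 1) (1, m) y :=
    cubic_congr (fun q hq p => by rw [dropCarrier_of_ne (by omega)]) _
  simp only [algAmp, lower, show n + 1 - 1 = n by omega, show n + 1 - 2 = n - 1 by omega,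
    show n + 1 - 3 = n - 2 by omega, show n + 1 - 4 = n - 3 by omega, d1, d2, d3, d4, c]
  have key : u n (1, m - 1) y + u n (1, m + 1) y = dropCarrier n u n (1, m - 1) y
      + dropCarrier n u n (1, m + 1) y + u n (1, 0) y := by
    rcases hm with rfl | rfl
    · rw [show ((1, 1 - 1) : Mode) = (1, 0) by decide, dropCarrier_carrier,
        dropCarrier_of_mode (p := (1, 1 + 1)) (by decide) (by decide)]
      simp only [Pi.zero_apply]; ring
    · rw [show ((1, -1 + 1) : Mode) = (1, 0) by decide, dropCarrier_carrier,
        dropCarrier_of_mode (p := (1, -1 - 1)) (by decide) (by decide)]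
      simp only [Pi.zero_apply]; ring
  rw [key]
  ring

/-- The carrier amplitude of order `n` enters in two places: through the sidebands, where the two
passages by the driver give `(f/2)² g`, and through the cubic terms with two leading factors.
Removing it isolates the linear operator of the corrections. -/
theorem carrierTerms_drop (ha : IsAnsatz D N u) {n : ℕ} (hn : 2 ≤ n) (hnN : n ≤ N)
    {y : Fin 4 → ℝ} (hy : y ∈ dom D) :
    carrierTerms P u n y = carrierTerms P (dropCarrier n u) n y
      + 3 * (P.γ : ℂ) * (2 * (‖u 1 (1, 0) y‖ ^ 2 : ℝ) * u n (1, 0) y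
          + u 1 (1, 0) y ^ 2 * (starRingEnd ℂ) (u n (1, 0) y))
      + (P.f : ℂ) ^ 2 / 4 * (gFun P (slow y) : ℂ) * u n (1, 0) y := by
  have c1 : u 1 (-1, 0) y = (starRingEnd ℂ) (u 1 (1, 0) y) := by
    simpa using ha.real 1 (by omega) (1, 0) y hy
  have cn : u n (-1, 0) y = (starRingEnd ℂ) (u n (1, 0) y) := by
    simpa using ha.real n hnN (1, 0) y hy
  have hsq : ((‖u 1 (1, 0) y‖ ^ 2 : ℝ) : ℂ) = u 1 (1, 0) y * (starRingEnd ℂ) (u 1 (1, 0) y) := by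
    rw [Complex.mul_conj, Complex.normSq_eq_norm_sq]
  have d2 : dropCarrier n u (n - 1) = u (n - 1) := dropCarrier_of_ne (by omega) u
  have d3 : dropCarrier n u (n - 2) = u (n - 2) := dropCarrier_of_ne (by omega) u
  simp only [carrierTerms]
  rw [algAmp_sideband_drop (by omega) (Or.inl rfl) rfl,
    algAmp_sideband_drop (by omega) (Or.inr rfl) rfl,
    cubic_drop hn (fun p hp => ha.support n hnN p hp y hy), d2, d3, c1, cn, hsq, gFun_eq]
  push_cast
  ring

/-- Separate from `carrierTerms_drop`, because for `n = 1` all three cubic factors are leading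
carriers and the dependence is not linear. Everything of order zero drops out. -/
theorem carrierTerms_one (ha : IsAnsatz D N u) (hD : IsOpen D) (hN : 1 ≤ N)
    {y : Fin 4 → ℝ} (hy : y ∈ dom D) :
    carrierTerms P u 1 y = 3 * (P.γ : ℂ) * (‖u 1 (1, 0) y‖ ^ 2 : ℝ) * u 1 (1, 0) y
      + (P.f : ℂ) ^ 2 / 4 * (gFun P (slow y) : ℂ) * u 1 (1, 0) y := by
  have c1 : u 1 (-1, 0) y = (starRingEnd ℂ) (u 1 (1, 0) y) := by
    simpa using ha.real 1 (by omega) (1, 0) y hy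
  have hsq : ((‖u 1 (1, 0) y‖ ^ 2 : ℝ) : ℂ) = u 1 (1, 0) y * (starRingEnd ℂ) (u 1 (1, 0) y) := by
    rw [Complex.mul_conj, Complex.normSq_eq_norm_sq]
  have z0 : ∀ p l, pds l (u 0 p) y = 0 := fun p l => pds_eqOn_zero hD (ha.zero p) l hy
  have z1 : ∀ p, p ∉ Omega 1 → ∀ l, pds l (u 1 p) y = 0 := fun p hp l =>
    pds_eqOn_zero hD (fun y hy => ha.support 1 hN p hp y hy) l hy
  have hc : ∀ p, cubic u 2 p y = 0 := by
    intro p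
    refine Finset.sum_eq_zero fun q hq => tri_eq_zero ?_ p y
    simp only [Finset.mem_filter] at hq
    omega
  have key : ∀ m : ℤ, (m = 1 ∨ m = -1) → algAmp P u 2 (1, m) y
      = 1 / (eikonal (phase P (1, m)) (slow y) : ℂ) * ((P.f : ℂ) / 2 * u 1 (1, 0) y) := by
    intro m hm
    have n1 : ((1, m) : Mode) ∉ Omega 1 := by
      rw [Omega_one]; rcases hm with rfl | rfl <;> decide
    have k1 : u 1 (1, m - 1) y + u 1 (1, m + 1) y = u 1 (1, 0) y := by
      rcases hm with rfl | rfl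
      · have : u 1 (1, 1 + 1) y = 0 := z1 (1, 1 + 1) (by rw [Omega_one]; decide) []
        rw [this]; simp
      · have : u 1 (1, -1 - 1) y = 0 := z1 (1, -1 - 1) (by rw [Omega_one]; decide) []
        rw [this]; simp
    simp only [algAmp, lower]
    rw [k1, hc, show pd 1 (u (2 - 1) (1, m)) y = 0 from z1 _ n1 [1],
      show pd 0 (u (2 - 1) (1, m)) y = 0 from z1 _ n1 [0],
      show pd 1 (pd 1 (u (2 - 2) (1, m))) y = 0 from z0 _ [1, 1],
      show pd 0 (pd 0 (u (2 - 2) (1, m))) y = 0 from z0 _ [0, 0],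
      show pd 3 (u (2 - 2) (1, m)) y = 0 from z0 _ [3],
      show pd 2 (u (2 - 2) (1, m)) y = 0 from z0 _ [2],
      show u (2 - 2) (1, m) y = 0 from z0 _ [],
      show pd 1 (pd 3 (u (2 - 3) (1, m))) y = 0 from z0 _ [1, 3],
      show pd 0 (pd 2 (u (2 - 3) (1, m))) y = 0 from z0 _ [0, 2],
      show pd 3 (pd 3 (u (2 - 4) (1, m))) y = 0 from z0 _ [3, 3],
      show pd 2 (pd 2 (u (2 - 4) (1, m))) y = 0 from z0 _ [2, 2]]
    ring
  simp only [carrierTerms]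
  rw [show (1 + 1 : ℕ) = 2 from rfl, show (1 + 2 : ℕ) = 3 from rfl, key 1 (Or.inl rfl),
    key (-1) (Or.inr rfl),
    cubic_three (fun p hp => ha.support 1 hN p hp y hy), c1, hsq, gFun_eq,
    show pd 1 (pd 3 (u (1 - 1) (1, 0))) y = 0 from z0 _ [1, 3],
    show pd 0 (pd 2 (u (1 - 1) (1, 0))) y = 0 from z0 _ [0, 2],
    show pd 3 (pd 3 (u (1 - 2) (1, 0))) y = 0 from z0 _ [3, 3],
    show pd 2 (pd 2 (u (1 - 2) (1, 0))) y = 0 from z0 _ [2, 2]]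
  push_cast
  ring

theorem carrierEqs_iff (ha : IsAnsatz D N u) (hD : IsOpen D) {M : ℕ} (hM : M ≤ N) :
    CarrierEqs P D M u ↔ ∀ n, 1 ≤ n → n ≤ M → ∀ y ∈ dom D, carrierLhs P u n y = 0 := by
  have hlead : 1 ≤ N → ∀ y ∈ dom D, carrierLhs P u 1 y =
      2 * Complex.I * ((P.om : ℂ) * pd 3 (u 1 (1, 0)) y - (P.k : ℂ) * pd 2 (u 1 (1, 0)) y)
      - dzeta P (dzeta P (u 1 (1, 0))) y
      + 3 * (P.γ : ℂ) * (‖u 1 (1, 0) y‖ ^ 2 : ℝ) * u 1 (1, 0) y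
      + (P.f : ℂ) ^ 2 / 4 * (gFun P (slow y) : ℂ) * u 1 (1, 0) y := fun hN y hy => by
    simp only [carrierLhs]
    rw [carrierTerms_one ha hD hN hy]; ring
  have hlin : ∀ n, 2 ≤ n → n ≤ N → ∀ y ∈ dom D, carrierLhs P u n y =
      2 * Complex.I * ((P.om : ℂ) * pd 3 (u n (1, 0)) y - (P.k : ℂ) * pd 2 (u n (1, 0)) y)
      - dzeta P (dzeta P (u n (1, 0))) y
      + 3 * (P.γ : ℂ) * (2 * (‖u 1 (1, 0) y‖ ^ 2 : ℝ) * u n (1, 0) y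
          + u 1 (1, 0) y ^ 2 * (starRingEnd ℂ) (u n (1, 0) y))
      + (P.f : ℂ) ^ 2 / 4 * (gFun P (slow y) : ℂ) * u n (1, 0) y
      + carrierTerms P (dropCarrier n u) n y := fun n hn hN y hy => by
    simp only [carrierLhs]
    rw [carrierTerms_drop ha hn hN hy]; ring
  constructor
  · rintro ⟨h1, h2⟩ n hn hnM y hy
    rcases hn.eq_or_lt with rfl | hn
    · rw [hlead (by omega) y hy]; exact h1 hnM y hy
    · rw [hlin n hn (by omega) y hy]; exact h2 n hn hnM y hy
  · intro h
    refine ⟨fun h1 y hy => ?_, fun n hn hnM y hy => ?_⟩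
    · rw [← hlead (by omega) y hy]; exact h 1 le_rfl h1 y hy
    · rw [← hlin n hn (by omega) y hy]; exact h n (by omega) hnM y hy

/-! ### Bounded solutions of the transport equation -/

theorem hasDerivAt_transport (hD : IsOpen D) {v : Amp} (hv : SmoothAmp D v) {y : Fin 4 → ℝ}
    (hy : y ∈ dom D) (t : ℝ) :
    y + t • (P.om • Pi.single 1 1 - P.k • Pi.single 0 1 : Fin 4 → ℝ) ∈ dom D ∧
    HasDerivAt (fun t : ℝ => v (y + t • (P.om • Pi.single 1 1 - P.k • Pi.single 0 1 : Fin 4 → ℝ)))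
      ((P.om : ℂ) * pd 1 v (y + t • (P.om • Pi.single 1 1 - P.k • Pi.single 0 1 : Fin 4 → ℝ))
        - (P.k : ℂ) * pd 0 v (y + t • (P.om • Pi.single 1 1 - P.k • Pi.single 0 1 : Fin 4 → ℝ)))
      t := by
  set w : Fin 4 → ℝ := P.om • Pi.single 1 1 - P.k • Pi.single 0 1 with hw
  have hm : y + t • w ∈ dom D := by
    change slow _ ∈ D
    have : slow (y + t • w) = slow y := by simp [slow, hw]
    rw [this]; exact hy
  refine ⟨hm, ?_⟩
  have h1 := (hv.differentiableAt hD hm).hasFDerivAt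
  have h3 : HasDerivAt (fun t : ℝ => y + t • w) w t := by
    simpa using ((hasDerivAt_id t).smul_const w).const_add y
  have h2 := h1.comp_hasDerivAt t h3
  have e : fderiv ℝ v (y + t • w) w
      = (P.om : ℂ) * pd 1 v (y + t • w) - (P.k : ℂ) * pd 0 v (y + t • w) := by
    conv_lhs => rw [hw, map_sub, map_smul, map_smul]
    simp only [Complex.real_smul]
    rfl
  rw [← e]
  exact h2

/-- Two points with equal slow variables and equal `ζ` lie on one characteristic line of direction
`ω e₁ - k e₀`; the parameter between them is `(t₁' - t₁) / ω`. -/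
theorem dependsOnZeta_of_transport (hom : P.om ^ 2 = P.k ^ 2 + 1) (hD : IsOpen D) {v : Amp}
    (hv : SmoothAmp D v)
    (h : ∀ y ∈ dom D, (P.om : ℂ) * pd 1 v y - (P.k : ℂ) * pd 0 v y = 0) :
    DependsOnZeta P D v := fun y hy y' hy' hs hz => by
  have hom0 : P.om ≠ 0 := by rintro h; rw [h] at hom; nlinarith [sq_nonneg P.k]
  have hd := hasDerivAt_transport (P := P) hD hv hy
  have hconst := is_const_of_deriv_eq_zero (fun t => (hd t).2.differentiableAt)
    (fun t => by rw [(hd t).2.deriv]; exact h _ (hd t).1)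
  have := hconst 0 ((y' 1 - y 1) / P.om)
  simp only [zero_smul, add_zero] at this
  rw [this]
  congr 1
  simp only [slow, Prod.mk.injEq] at hs
  simp only [zeta] at hz
  funext i
  fin_cases i
  · simp; field_simp; linarith
  · simp; field_simp; ring
  · simpa using hs.1
  · simpa using hs.2

/-- Exclusion of secular terms: `G` is constant along a characteristic, so `v` is affine there, with
the transport derivative as slope. A bounded affine function has slope zero. -/
theorem transport_of_bounded (hD : IsOpen D) {v G : Amp} (hv : SmoothAmp D v)
    (hG : DependsOnZeta P D G)
    (hb : ∀ z ∈ D, ∃ C : ℝ, ∀ y, slow y = z → ‖v y‖ ≤ C)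
    (h : ∀ y ∈ dom D,
      2 * Complex.I * ((P.om : ℂ) * pd 1 v y - (P.k : ℂ) * pd 0 v y) + G y = 0) :
    ∀ y ∈ dom D, (P.om : ℂ) * pd 1 v y - (P.k : ℂ) * pd 0 v y = 0 := fun y hy => by
  have hd := hasDerivAt_transport (P := P) hD hv hy
  set w : Fin 4 → ℝ := P.om • Pi.single 1 1 - P.k • Pi.single 0 1 with hw
  set c : ℂ := (P.om : ℂ) * pd 1 v y - (P.k : ℂ) * pd 0 v y with hc
  have hsl : ∀ t : ℝ, slow (y + t • w) = slow y := fun t => by simp [slow, hw]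
  have hc' : ∀ t : ℝ, (P.om : ℂ) * pd 1 v (y + t • w) - (P.k : ℂ) * pd 0 v (y + t • w) = c := by
    intro t
    have h1 := h _ (hd t).1
    have h2 := h y hy
    have h3 : G (y + t • w) = G y :=
      hG _ (hd t).1 _ hy (hsl t) (by simp [zeta, hw]; ring)
    have hI : (2 * Complex.I) ≠ 0 := by simp
    refine mul_left_cancel₀ hI ?_
    rw [h3] at h1
    linear_combination h1 - h2
  have hconst := is_const_of_deriv_eq_zero (f := fun t : ℝ => v (y + t • w) - t * c)
    (fun t => ((hd t).2.sub ((Complex.ofRealCLM.hasDerivAt (x := t)).mul_const c)).differentiableAt)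
    (fun t => by
      have := ((hd t).2.sub ((Complex.ofRealCLM.hasDerivAt (x := t)).mul_const c)).deriv
      rw [hc' t] at this
      refine Eq.trans this ?_
      simp)
  obtain ⟨C, hC⟩ := hb (slow y) hy
  by_contra hne
  have hpos : 0 < ‖c‖ := norm_pos_iff.2 hne
  -- A parameter at which the increment `t c` exceeds `2 C`, the largest difference of two values of
  -- norm at most `C`.
  set t : ℝ := (2 * C + 1) / ‖c‖ with ht
  have e := hconst t 0
  simp only [zero_smul, add_zero, Complex.ofReal_zero, zero_mul, sub_zero] at e
  have b1 := hC (y + t • w) (hsl t)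
  have b2 := hC y rfl
  have e2 : (t : ℂ) * c = v (y + t • w) - v y := by rw [← e]; ring
  have b3 : ‖(t : ℂ) * c‖ ≤ 2 * C := by
    rw [e2]; exact (norm_sub_le _ _).trans (by linarith)
  have b4 : 2 * C + 1 ≤ ‖(t : ℂ) * c‖ := by
    rw [norm_mul, Complex.norm_real, Real.norm_eq_abs]
    calc 2 * C + 1 = t * ‖c‖ := by rw [ht]; field_simp
      _ ≤ |t| * ‖c‖ := mul_le_mul_of_nonneg_right (le_abs_self t) hpos.le
  linarith

/-! ### The recurrent system -/

/-- The sets `Ω_n` contain every mode that lower orders can excite: the same mode, its neighbours by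
the driver, and sums of three modes by the cubic term. -/
theorem lower_eq_zero_of_notMem (P : Driver) (hD : IsOpen D) {n : ℕ} (hn : 1 ≤ n)
    (hs : ∀ q < n, ∀ p, p ∉ Omega q → ∀ y ∈ dom D, u q p y = 0) {p : Mode} (hp : p ∉ Omega n)
    {y : Fin 4 → ℝ} (hy : y ∈ dom D) : lower P u n p y = 0 := by
  have hm : ∀ k, 1 ≤ k → p ∉ Omega (n - k) := fun k _ h => hp (Omega_mono (by omega) h)
  have z : ∀ k, 1 ≤ k → ∀ l, pds l (u (n - k) p) y = 0 := fun k hk l =>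
    pds_eqOn_zero hD (fun y hy => hs (n - k) (by omega) p (hm k hk) y hy) l hy
  have z1 := z 1 le_rfl
  have z2 := z 2 (by omega)
  have z3 := z 3 (by omega)
  have z4 := z 4 (by omega)
  have f1 : u (n - 1) (p.1, p.2 - 1) y = 0 := by
    refine hs _ (by omega) _ (fun h => hp ?_) y hy
    have := Omega_up h
    rwa [show n - 1 + 1 = n by omega, show ((p.1, p.2 - 1 + 1) : Mode) = p by ext <;> simp] at this
  have f2 : u (n - 1) (p.1, p.2 + 1) y = 0 := by
    refine hs _ (by omega) _ (fun h => hp ?_) y hy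
    have := Omega_down h
    rwa [show n - 1 + 1 = n by omega, show ((p.1, p.2 + 1 - 1) : Mode) = p by ext <;> simp] at this
  have c : cubic u n p y = 0 := by
    refine Finset.sum_eq_zero fun q hq => ?_
    simp only [Finset.mem_filter] at hq
    refine Finset.sum_eq_zero fun r hr => absurd ?_ hp
    simp only [Finset.mem_filter, Finset.mem_product] at hr
    rw [← hr.2, ← hq.2]
    exact Omega_add hr.1.1 hr.1.2.1 hr.1.2.2
  simp only [lower]
  rw [f1, f2, c, show pd 1 (u (n - 1) p) y = 0 from z1 [1],
    show pd 0 (u (n - 1) p) y = 0 from z1 [0], show pd 1 (pd 1 (u (n - 2) p)) y = 0 from z2 [1, 1],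
    show pd 0 (pd 0 (u (n - 2) p)) y = 0 from z2 [0, 0],
    show pd 3 (u (n - 2) p) y = 0 from z2 [3], show pd 2 (u (n - 2) p) y = 0 from z2 [2],
    show u (n - 2) p y = 0 from z2 [], show pd 1 (pd 3 (u (n - 3) p)) y = 0 from z3 [1, 3],
    show pd 0 (pd 2 (u (n - 3) p)) y = 0 from z3 [0, 2],
    show pd 3 (pd 3 (u (n - 4) p)) y = 0 from z4 [3, 3],
    show pd 2 (pd 2 (u (n - 4) p)) y = 0 from z4 [2, 2]]
  ring

/-- The terms of the resonant mode without the transport derivative of the last amplitude. -/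
theorem lower_carrier_drop (hS : ContDiff ℝ ∞ P.S) (n : ℕ) (y : Fin 4 → ℝ) :
    lower P u (n + 2) (1, 0) y = 2 * Complex.I * ((P.om : ℂ) * pd 1 (u (n + 1) (1, 0)) y
        - (P.k : ℂ) * pd 0 (u (n + 1) (1, 0)) y)
      + lower P (dropCarrier (n + 1) u) (n + 2) (1, 0) y := by
  have d : ∀ q, q ≤ n → dropCarrier (n + 1) u q = u q := fun q hq =>
    dropCarrier_of_ne (by omega) u
  have c : cubic (dropCarrier (n + 1) u) (n + 2) (1, 0) y = cubic u (n + 2) (1, 0) y :=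
    cubic_congr (fun q hq p => by rw [d q (by omega)]) _
  rw [lower_carrier hS, lower_carrier hS, show n + 2 - 1 = n + 1 by omega,
    show n + 2 - 2 = n by omega, d n le_rfl, d (n + 2 - 3) (by omega), d (n + 2 - 4) (by omega), c,
    dropCarrier_carrier, dropCarrier_of_mode (p := (1, -1)) (by decide) (by decide),
    dropCarrier_of_mode (p := (1, 1)) (by decide) (by decide), pd_zero, pd_zero]
  simp only [Pi.zero_apply]
  ring

variable (hS : ContDiff ℝ ∞ P.S) (hom : P.om ^ 2 = P.k ^ 2 + 1) (hD : IsOpen D)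
include hS hom hD

theorem isFormalSolution_of_eqs (ha : IsAnsatz D N u) (halg : AlgebraicEqs P D N u)
    (hres : ∀ z ∈ D, ∀ p ∈ drivenModes N, eikonal (phase P p) z ≠ 0)
    (hz : CarrierZeta P D (N - 1) u) (hc : CarrierEqs P D (N - 2) u) :
    IsFormalSolution P D N u := by
  rw [carrierEqs_iff ha hD (by omega)] at hc
  have h0 : ∀ p l, ∀ y ∈ dom D, pds l (u 0 p) y = 0 := fun p l y hy =>
    pds_eqOn_zero hD (ha.zero p) l hy
  have hcubic : ∀ n, n ≤ 2 → ∀ p y, cubic u n p y = 0 := by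
    intro n hn p y
    refine Finset.sum_eq_zero fun q hq => tri_eq_zero ?_ p y
    simp only [Finset.mem_filter] at hq
    omega
  have hcar : ∀ n, 1 ≤ n → n ≤ N → ∀ y ∈ dom D, lower P u n (1, 0) y = 0 := by
    intro n hn hnN y hy
    obtain ⟨m, rfl⟩ : ∃ m, n = m + 1 := ⟨n - 1, by omega⟩
    have htr : ∀ q, 1 ≤ q → q ≤ N - 1 → (P.om : ℂ) * pd 1 (u q (1, 0)) y
        - (P.k : ℂ) * pd 0 (u q (1, 0)) y = 0 := by
      intro q h1 h2
      have hom0 : P.om ≠ 0 := by rintro h; rw [h] at hom; nlinarith [sq_nonneg P.k]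
      have hom0' : (P.om : ℂ) ≠ 0 := by exact_mod_cast hom0
      rw [pd_one_eq hom hD (ha.smooth q (by omega) _) (hz q h1 h2) hy]
      field_simp
      ring
    -- Orders one and two are degenerate: at order one nothing is left, at order two only the
    -- transport of the leading amplitude. From order three on, the transport is accompanied by the
    -- equation of the carrier two orders below.
    match m with
    | 0 =>
      rw [lower_carrier hS, hcubic _ (by omega), show pd 1 (u (0 + 1 - 1) (1, 0)) y = 0 from h0 _ [1] y hy,
        show pd 0 (u (0 + 1 - 1) (1, 0)) y = 0 from h0 _ [0] y hy,
        show pd 1 (pd 1 (u (0 + 1 - 2) (1, 0))) y = 0 from h0 _ [1, 1] y hy,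
        show pd 0 (pd 0 (u (0 + 1 - 2) (1, 0))) y = 0 from h0 _ [0, 0] y hy,
        show pd 3 (u (0 + 1 - 2) (1, 0)) y = 0 from h0 _ [3] y hy,
        show pd 2 (u (0 + 1 - 2) (1, 0)) y = 0 from h0 _ [2] y hy,
        show pd 1 (pd 3 (u (0 + 1 - 3) (1, 0))) y = 0 from h0 _ [1, 3] y hy,
        show pd 0 (pd 2 (u (0 + 1 - 3) (1, 0))) y = 0 from h0 _ [0, 2] y hy,
        show pd 3 (pd 3 (u (0 + 1 - 4) (1, 0))) y = 0 from h0 _ [3, 3] y hy,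
        show pd 2 (pd 2 (u (0 + 1 - 4) (1, 0))) y = 0 from h0 _ [2, 2] y hy,
        show u (0 + 1 - 1) (1, -1) y = 0 from h0 _ [] y hy,
        show u (0 + 1 - 1) (1, 1) y = 0 from h0 _ [] y hy]
      ring
    | 1 =>
      rw [lower_carrier hS, hcubic _ (by omega), show 1 + 1 - 1 = 1 from rfl,
        htr 1 le_rfl (by omega),
        show pd 1 (pd 1 (u (1 + 1 - 2) (1, 0))) y = 0 from h0 _ [1, 1] y hy,
        show pd 0 (pd 0 (u (1 + 1 - 2) (1, 0))) y = 0 from h0 _ [0, 0] y hy,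
        show pd 3 (u (1 + 1 - 2) (1, 0)) y = 0 from h0 _ [3] y hy,
        show pd 2 (u (1 + 1 - 2) (1, 0)) y = 0 from h0 _ [2] y hy,
        show pd 1 (pd 3 (u (1 + 1 - 3) (1, 0))) y = 0 from h0 _ [1, 3] y hy,
        show pd 0 (pd 2 (u (1 + 1 - 3) (1, 0))) y = 0 from h0 _ [0, 2] y hy,
        show pd 3 (pd 3 (u (1 + 1 - 4) (1, 0))) y = 0 from h0 _ [3, 3] y hy,
        show pd 2 (pd 2 (u (1 + 1 - 4) (1, 0))) y = 0 from h0 _ [2, 2] y hy,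
        ha.support 1 (by omega) (1, -1) (by rw [Omega_one]; decide) y hy,
        ha.support 1 (by omega) (1, 1) (by rw [Omega_one]; decide) y hy]
      ring
    | m + 2 =>
      rw [show m + 2 + 1 = (m + 1) + 2 by omega, lower_carrier_eq hS hom hD ha halg (by omega)
        (by omega) (hz (m + 1) (by omega) (by omega)) hy, htr (m + 1 + 1) (by omega) (by omega),
        hc (m + 1) (by omega) (by omega) y hy]
      ring
  intro n hnN p y hy
  rcases Nat.eq_zero_or_pos n with rfl | hn
  · have hup := ha.zero
    have e : lower P u 0 p y = 0 := by
      simp only [lower]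
      rw [hcubic _ (by omega), show pd 1 (u (0 - 1) p) y = 0 from h0 _ [1] y hy,
        show pd 0 (u (0 - 1) p) y = 0 from h0 _ [0] y hy,
        show pd 1 (pd 1 (u (0 - 2) p)) y = 0 from h0 _ [1, 1] y hy,
        show pd 0 (pd 0 (u (0 - 2) p)) y = 0 from h0 _ [0, 0] y hy,
        show pd 3 (u (0 - 2) p) y = 0 from h0 _ [3] y hy,
        show pd 2 (u (0 - 2) p) y = 0 from h0 _ [2] y hy,
        show u (0 - 2) p y = 0 from h0 _ [] y hy,
        show pd 1 (pd 3 (u (0 - 3) p)) y = 0 from h0 _ [1, 3] y hy,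
        show pd 0 (pd 2 (u (0 - 3) p)) y = 0 from h0 _ [0, 2] y hy,
        show pd 3 (pd 3 (u (0 - 4) p)) y = 0 from h0 _ [3, 3] y hy,
        show pd 2 (pd 2 (u (0 - 4) p)) y = 0 from h0 _ [2, 2] y hy,
        show u (0 - 1) (p.1, p.2 - 1) y = 0 from h0 _ [] y hy,
        show u (0 - 1) (p.1, p.2 + 1) y = 0 from h0 _ [] y hy]
      ring
    rw [e, ha.zero p hy]
    simp
  by_cases hp : p ∈ Omega n
  · by_cases e1 : p = (1, 0)
    · rw [e1, eikonal_phase_carrier hS hom (Or.inl rfl), hcar n hn hnN y hy]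
      simp
    by_cases e2 : p = (-1, 0)
    -- The condition for the mode `(-1, 0)` is the conjugate of that for `(1, 0)`.
    · have := lower_neg P hS hD hn (fun q hq => ha.smooth q (by omega))
        (fun q hq => ha.real q (by omega)) (1, 0) y hy
      rw [hcar n hn hnN y hy, map_zero] at this
      rw [e2, eikonal_phase_carrier hS hom (Or.inr rfl), show ((-1, 0) : Mode) = -(1, 0) by decide,
        this]
      simp
    have hL : (eikonal (phase P p) (slow y) : ℂ) ≠ 0 := by
      exact_mod_cast hres _ hy p (mem_drivenModes (le_max_of_le_left hnN) hp e1 e2)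
    rw [halg n hn hnN p hp e1 e2 y hy]
    simp only [algAmp]
    field_simp
    ring
  · rw [ha.support n hnN p hp y hy, lower_eq_zero_of_notMem P hD hn
      (fun q hq => ha.support q (by omega)) hp hy]
    simp

theorem isFormalSolution_iff
    (hSb : ∀ i : ℕ, 1 ≤ i → ∃ C : ℝ, ∀ z ∈ D, ‖iteratedFDeriv ℝ i P.S z‖ ≤ C)
    (hres : ∀ z ∈ D, ∀ p ∈ drivenModes N, eikonal (phase P p) z ≠ 0)
    (ha : IsAnsatz D N u)
    (hb : ∀ n ≤ N, ∀ z ∈ D, ∃ C : ℝ, ∀ y, slow y = z → ‖u n (1, 0) y‖ ≤ C) :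
    IsFormalSolution P D N u ↔
      AlgebraicEqs P D N u ∧ CarrierZeta P D (N - 1) u ∧ CarrierEqs P D (N - 2) u := by
  have hρ : ∀ z ∈ D, 0 < resDist P N z := fun z hz => resDist_pos P N (hres z hz)
  refine ⟨fun hf => ?_, fun h => isFormalSolution_of_eqs hS hom hD ha h.1 hres h.2.1 h.2.2⟩
  have halg : AlgebraicEqs P D N u := by
    intro n hn hnN p hp e1 e2 y hy
    have hL : (eikonal (phase P p) (slow y) : ℂ) ≠ 0 := by
      exact_mod_cast hres _ hy p (mem_drivenModes (le_max_of_le_left hnN) hp e1 e2)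
    have := hf n hnN p y hy
    simp only [algAmp]
    field_simp
    linear_combination -this
  have hcl := ampClass_zeta P N hD
  have hlow : ∀ m, m + 2 ≤ N → ∀ y ∈ dom D, lower P u (m + 2) (1, 0) y = 0 := by
    intro m hm y hy
    have := hf (m + 2) hm (1, 0) y hy
    rw [eikonal_phase_carrier hS hom (Or.inl rfl)] at this
    simpa using this
  -- The condition of order `m + 2` is what fixes the fast dependence of `u_{m+1,(1,0)}`; hence
  -- dependence on `ζ` is obtained up to the order `N - 1`.
  have main : ∀ m, m + 2 ≤ N → (∀ y ∈ dom D, (P.om : ℂ) * pd 1 (u (m + 1) (1, 0)) y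
      - (P.k : ℂ) * pd 0 (u (m + 1) (1, 0)) y = 0) ∧ DependsOnZeta P D (u (m + 1) (1, 0)) := by
    intro m
    induction m using Nat.strong_induction_on with
    | _ m ih =>
      intro hm
      have hcar : ∀ q, 1 ≤ q → q < m + 1 →
          SmoothAmp D (u q (1, 0)) ∧ DependsOnZeta P D (u q (1, 0)) := by
        intro q h1 h2
        obtain ⟨j, rfl⟩ : ∃ j, q = j + 1 := ⟨q - 1, by omega⟩
        exact ⟨ha.smooth _ (by omega) _, (ih j (by omega) (by omega)).2⟩
      -- With the carrier of order `m + 1` removed, the remaining terms depend on `ζ` only: lower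
      -- carriers do by the induction hypothesis, and the other modes inherit it through the
      -- algebraic equations.
      have hG := hcl.lower (u := dropCarrier (m + 1) u) (m := m + 2) hS hD hSb hρ
        (fun p => by rw [dropCarrier_of_ne (by omega)]; exact ha.zero p)
        (fun q h1 h2 p => by
          rcases Nat.lt_or_ge q (m + 1) with h | h
          · rw [dropCarrier_of_ne (by omega)]
            exact hcl.all_modes hS hD hSb hρ ha halg h1 (by omega)
              (fun q' h1' h2' => hcar q' h1' (by omega)) p
          · obtain rfl : q = m + 1 := by omega
            by_cases e1 : p = (1, 0)
            · rw [e1, dropCarrier_carrier]; exact hcl.zero 0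
            by_cases e2 : p = (-1, 0)
            · rw [e2, dropCarrier_neg_carrier]; exact hcl.zero 0
            rw [dropCarrier_of_mode e1 e2]
            exact hcl.noncarrier hS hD hSb hρ ha halg h1 (by omega) hcar e1 e2) (1, 0)
      have hsm := ha.smooth (m + 1) (by omega) (1, 0)
      have ht := transport_of_bounded hD hsm hG.2 (hb (m + 1) (by omega))
        (fun y hy => by rw [← lower_carrier_drop hS m y]; exact hlow m hm y hy)
      exact ⟨ht, dependsOnZeta_of_transport hom hD hsm ht⟩
  refine ⟨halg, ?_, ?_⟩
  · intro n h1 h2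
    obtain ⟨m, rfl⟩ : ∃ j, n = j + 1 := ⟨n - 1, by omega⟩
    exact (main m (by omega)).2
  · rw [carrierEqs_iff ha hD (by omega)]
    intro n h1 h2 y hy
    obtain ⟨m, rfl⟩ : ∃ j, n = j + 1 := ⟨n - 1, by omega⟩
    -- After the transport term of order `n + 1` has been shown to vanish, the condition of order `n
    -- + 2` is the equation of `u_{n,(1,0)}`; this limits the latter to `n ≤ N - 2`.
    have e := lower_carrier_eq hS hom hD ha halg h1 (by omega) (main m (by omega)).2 hy
    rw [hlow (m + 1) (by omega) y hy, (main (m + 1) (by omega)).1 y hy] at e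
    simpa using e.symm

end Carrier

end WKB

namespace WKB

/-! ### Second derivatives of the expansion -/

/-- The point `(x₁, t₁, x₂, t₂)` that belongs to `(x, t)`. -/
def scaledPoint (ε x t : ℝ) : Fin 4 → ℝ := ![ε * x, ε * t, ε ^ 2 * x, ε ^ 2 * t]

/-- The derivative in `x` or `t` of a function of `(x₁, t₁, x₂, t₂)`. -/
noncomputable def scaledPd (ε : ℝ) (i j : Fin 4) (F : Amp) : Amp := fun y =>
  (ε : ℂ) * pd i F y + (ε : ℂ) ^ 2 * pd j F y

/-- The exponential `exp (i χ_p / ε²)`. -/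
noncomputable def carrierExp (P : Driver) (ε : ℝ) (p : Mode) : Amp := fun y =>
  Complex.exp (Complex.I * ((phase P p (slow y) / ε ^ 2 : ℝ) : ℂ))

section SecondDeriv

variable {P : Driver} {N : ℕ} {D : Set (ℝ × ℝ)} {ε : ℝ}

theorem SmoothAmp.scaledPd (hD : IsOpen D) {F : Amp} (hF : SmoothAmp D F) (i j : Fin 4) :
    SmoothAmp D (scaledPd ε i j F) :=
  (contDiffOn_const.mul (hF.pd hD i)).add (contDiffOn_const.mul (hF.pd hD j))

theorem scaledPd_congr (hD : IsOpen D) {F G : Amp} (h : Set.EqOn F G (dom D)) (i j : Fin 4) :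
    Set.EqOn (scaledPd ε i j F) (scaledPd ε i j G) (dom D) := fun y hy => by
  simp only [scaledPd, pd_congr hD h i hy, pd_congr hD h j hy]

theorem scaledPd_add (hD : IsOpen D) {F G : Amp} (hF : SmoothAmp D F) (hG : SmoothAmp D G)
    (i j : Fin 4) : Set.EqOn (scaledPd ε i j (F + G)) (scaledPd ε i j F + scaledPd ε i j G)
      (dom D) := fun y hy => by
  simp only [scaledPd, Pi.add_apply, pd_add hD hF hG i hy, pd_add hD hF hG j hy]
  ring

theorem scaledPd_mul (hD : IsOpen D) {F G : Amp} (hF : SmoothAmp D F) (hG : SmoothAmp D G)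
    (i j : Fin 4) : Set.EqOn (scaledPd ε i j (F * G))
      (scaledPd ε i j F * G + F * scaledPd ε i j G) (dom D) := fun y hy => by
  simp only [scaledPd, Pi.add_apply, Pi.mul_apply, pd_mul hD hF hG i hy, pd_mul hD hF hG j hy]
  ring

theorem scaledPd_const_mul (hD : IsOpen D) {F : Amp} (hF : SmoothAmp D F) (c : ℂ)
    (i j : Fin 4) : Set.EqOn (scaledPd ε i j (fun y => c * F y))
      (fun y => c * scaledPd ε i j F y) (dom D) := fun y hy => by
  simp only [scaledPd]
  rw [pd_const_mul hD hF c i hy, pd_const_mul hD hF c j hy]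
  ring

theorem SmoothAmp.finset_sum {ι : Type*} (s : Finset ι) {F : ι → Amp}
    (hF : ∀ i ∈ s, SmoothAmp D (F i)) : SmoothAmp D (fun y => ∑ i ∈ s, F i y) :=
  ContDiffOn.sum hF

theorem scaledPd_sum (hD : IsOpen D) {ι : Type*} (s : Finset ι) {F : ι → Amp}
    (hF : ∀ i ∈ s, SmoothAmp D (F i)) (i j : Fin 4) :
    Set.EqOn (scaledPd ε i j (fun y => ∑ a ∈ s, F a y)) (fun y => ∑ a ∈ s, scaledPd ε i j (F a) y)
      (dom D) := by
  classical
  induction s using Finset.induction_on with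
  | empty =>
    intro y _
    simp [scaledPd, pd]
  | insert a s ha ih =>
    have h1 := hF a (by simp)
    have h2 : ∀ b ∈ s, SmoothAmp D (F b) := fun b hb => hF b (by simp [hb])
    have e : Set.EqOn (fun y => ∑ b ∈ insert a s, F b y) (F a + fun y => ∑ b ∈ s, F b y)
        (dom D) := fun y _ => by
      simp [Finset.sum_insert ha]
    intro y hy
    rw [scaledPd_congr hD e i j hy, scaledPd_add hD h1 (SmoothAmp.finset_sum s h2) i j hy]
    simp only [Pi.add_apply]
    rw [ih h2 hy, Finset.sum_insert ha]

theorem iteratedDeriv_two_eq {f f' : ℝ → ℂ} {f'' : ℂ} {t : ℝ}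
    (h1 : ∀ᶠ s in nhds t, HasDerivAt f (f' s) s) (h2 : HasDerivAt f' f'' t) :
    iteratedDeriv 2 f t = f'' := by
  have e : deriv f =ᶠ[nhds t] f' := h1.mono fun s hs => hs.deriv
  rw [iteratedDeriv_succ, iteratedDeriv_one, e.deriv_eq, h2.deriv]

theorem hasDerivAt_curve (hD : IsOpen D) {F : Amp} (hF : SmoothAmp D F) {c : ℝ → Fin 4 → ℝ}
    {s : ℝ} {i j : Fin 4} (hc : HasDerivAt c (ε • Pi.single i 1 + ε ^ 2 • Pi.single j 1) s)
    (hs : c s ∈ dom D) : HasDerivAt (fun s => F (c s)) (scaledPd ε i j F (c s)) s := by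
  have h := ((hF.differentiableAt hD hs).hasFDerivAt).comp_hasDerivAt s hc
  have e : fderiv ℝ F (c s) (ε • Pi.single i 1 + ε ^ 2 • Pi.single j 1)
      = scaledPd ε i j F (c s) := by
    rw [map_add, map_smul, map_smul]
    simp [scaledPd, pd]
  rw [← e]
  exact h

theorem iteratedDeriv_two_curve (hD : IsOpen D) {F : Amp} (hF : SmoothAmp D F)
    {c : ℝ → Fin 4 → ℝ} {s : ℝ} {i j : Fin 4}
    (hc : ∀ s, HasDerivAt c (ε • Pi.single i 1 + ε ^ 2 • Pi.single j 1) s) (hs : c s ∈ dom D)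
    {f : ℝ → ℂ} (hf : ∀ s, c s ∈ dom D → f s = F (c s)) :
    iteratedDeriv 2 f s = scaledPd ε i j (scaledPd ε i j F) (c s) := by
  have hev : ∀ᶠ r in nhds s, c r ∈ dom D :=
    (hc s).continuousAt.eventually (dom_mem_nhds hD hs)
  have he : f =ᶠ[nhds s] fun r => F (c r) := hev.mono hf
  rw [he.iteratedDeriv_eq 2]
  exact iteratedDeriv_two_eq (hev.mono fun r hr => hasDerivAt_curve hD hF (hc r) hr)
    (hasDerivAt_curve hD (hF.scaledPd hD i j) (hc s) hs)

theorem hasDerivAt_scaledPoint_t (ε x t : ℝ) :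
    HasDerivAt (fun s => scaledPoint ε x s) (ε • Pi.single 1 1 + ε ^ 2 • Pi.single 3 1) t := by
  rw [hasDerivAt_pi]
  intro a
  fin_cases a
  · simpa [scaledPoint] using hasDerivAt_const t (ε * x)
  · simpa [scaledPoint] using (hasDerivAt_id t).const_mul ε
  · simpa [scaledPoint] using hasDerivAt_const t (ε ^ 2 * x)
  · simpa [scaledPoint] using (hasDerivAt_id t).const_mul (ε ^ 2)

theorem hasDerivAt_scaledPoint_x (ε x t : ℝ) :
    HasDerivAt (fun s => scaledPoint ε s t) (ε • Pi.single 0 1 + ε ^ 2 • Pi.single 2 1) x := by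
  rw [hasDerivAt_pi]
  intro a
  fin_cases a
  · simpa [scaledPoint] using (hasDerivAt_id x).const_mul ε
  · simpa [scaledPoint] using hasDerivAt_const x (ε * t)
  · simpa [scaledPoint] using (hasDerivAt_id x).const_mul (ε ^ 2)
  · simpa [scaledPoint] using hasDerivAt_const x (ε ^ 2 * t)

theorem slowDir_values : slowDir 0 = 0 ∧ slowDir 1 = 0 ∧ slowDir 2 = (1, 0) ∧
    slowDir 3 = (0, 1) := by
  simp [slowDir, slow]

variable (hS : ContDiff ℝ ∞ P.S)
include hS

theorem smooth_carrierExp (p : Mode) : SmoothAmp D (carrierExp P ε p) := by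
  have h1 : ContDiff ℝ ∞ (fun y : Fin 4 → ℝ => phase P p (slow y) / ε ^ 2) :=
    ((contDiff_phase hS p).comp contDiff_slow).div_const _
  exact (contDiff_const.mul (Complex.ofRealCLM.contDiff.comp h1)).cexp.contDiffOn

theorem pd_carrierExp (p : Mode) (i : Fin 4) (y : Fin 4 → ℝ) :
    pd i (carrierExp P ε p) y = Complex.I
      * ((fderiv ℝ (phase P p) (slow y) (slowDir i) / ε ^ 2 : ℝ) : ℂ) * carrierExp P ε p y := by
  have h0 := contDiff_phase hS p
  have h1 : ContDiff ℝ ∞ (fun z : ℝ × ℝ => phase P p z / ε ^ 2) := h0.div_const _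
  have h2 : HasFDerivAt (liftSlow fun z : ℝ × ℝ => phase P p z / ε ^ 2)
      (fderiv ℝ (liftSlow fun z : ℝ × ℝ => phase P p z / ε ^ 2) y) y :=
    ((smoothAmp_liftSlow (D := Set.univ) h1).differentiableAt isOpen_univ
      (Set.mem_univ _)).hasFDerivAt
  have h3 := (h2.const_mul Complex.I).cexp
  have h4 : fderiv ℝ (carrierExp P ε p) y = _ := h3.fderiv
  have h5 := congrFun (pd_liftSlow h1 i) y
  simp only [pd] at h5 ⊢
  rw [h4]
  simp only [smul_apply, smul_eq_mul]
  rw [h5]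
  simp only [liftSlow, dirs_cons, carrierExp]
  have h6 : fderiv ℝ (dirs [] fun z : ℝ × ℝ => phase P p z / ε ^ 2) (slow y) (slowDir i)
      = fderiv ℝ (phase P p) (slow y) (slowDir i) / ε ^ 2 := by
    have h7 := ((h0.differentiable (by simp) (slow y)).hasFDerivAt.mul_const (ε ^ 2)⁻¹).fderiv
    have h8 : (dirs [] fun z : ℝ × ℝ => phase P p z / ε ^ 2)
        = fun z => phase P p z * (ε ^ 2)⁻¹ := rfl
    rw [h8, h7]
    simp [div_eq_mul_inv, mul_comm]
  rw [h6]
  ring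

/-- The factor `ε²` from the slow variable cancels the `1/ε²` in the exponent. So the exponential
contributes at order zero, and no negative powers of `ε` arise. -/
theorem scaledPd_carrierExp (hε : ε ≠ 0) (p : Mode) {i j : Fin 4} (hi : slowDir i = 0)
    (y : Fin 4 → ℝ) : scaledPd ε i j (carrierExp P ε p) y = Complex.I
      * ((fderiv ℝ (phase P p) (slow y) (slowDir j) : ℝ) : ℂ) * carrierExp P ε p y := by
  have hε' : (ε : ℂ) ≠ 0 := by exact_mod_cast hε
  simp only [scaledPd, pd_carrierExp hS, hi, map_zero]
  push_cast
  field_simp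
  ring

theorem scaledPd_mode (hD : IsOpen D) (hε : ε ≠ 0) (p : Mode) {i j : Fin 4} (hi : slowDir i = 0)
    {v : Amp} (hv : SmoothAmp D v) :
    Set.EqOn (scaledPd ε i j (v * carrierExp P ε p))
      ((scaledPd ε i j v + (fun y => Complex.I *
        liftSlow (dirs [slowDir j] (phase P p)) y * v y)) * carrierExp P ε p) (dom D) :=
  fun y hy => by
    rw [scaledPd_mul hD hv (smooth_carrierExp hS p) i j hy]
    simp only [Pi.add_apply, Pi.mul_apply]
    rw [scaledPd_carrierExp hS hε p hi]
    simp only [liftSlow, dirs_cons]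
    simp only [dirs, List.foldr_nil]
    ring

/-- The second derivative in one variable of a mode. -/
theorem scaledPd_scaledPd_mode (hD : IsOpen D) (hε : ε ≠ 0) (p : Mode) {i j : Fin 4}
    (hi : slowDir i = 0) {v : Amp} (hv : SmoothAmp D v) {y : Fin 4 → ℝ} (hy : y ∈ dom D) :
    scaledPd ε i j (scaledPd ε i j (v * carrierExp P ε p)) y =
      ((ε : ℂ) ^ 2 * pd i (pd i v) y + 2 * (ε : ℂ) ^ 3 * pd i (pd j v) y
        + (ε : ℂ) ^ 4 * pd j (pd j v) y
        + 2 * Complex.I * (fderiv ℝ (phase P p) (slow y) (slowDir j) : ℂ)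
          * ((ε : ℂ) * pd i v y + (ε : ℂ) ^ 2 * pd j v y)
        + Complex.I * (ε : ℂ) ^ 2
          * (fderiv ℝ (fun z => fderiv ℝ (phase P p) z (slowDir j)) (slow y) (slowDir j) : ℂ) * v y
        - (fderiv ℝ (phase P p) (slow y) (slowDir j) : ℂ) ^ 2 * v y) * carrierExp P ε p y := by
  set φ := dirs [slowDir j] (phase P p) with hφ
  have hφs : ContDiff ℝ ∞ φ := contDiff_dirs (contDiff_phase hS p) _
  have sφ : SmoothAmp D (liftSlow φ) := smoothAmp_liftSlow hφs
  have sc : SmoothAmp D (fun y => Complex.I * liftSlow φ y) := contDiffOn_const.mul sφ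
  have sIv : SmoothAmp D (fun y => Complex.I * liftSlow φ y * v y) := sc.mul hv
  have sw : SmoothAmp D (scaledPd ε i j v + fun y => Complex.I * liftSlow φ y * v y) :=
    (hv.scaledPd hD i j).add sIv
  rw [scaledPd_congr hD (scaledPd_mode hS hD hε p hi hv) i j hy,
    scaledPd_mode hS hD hε p hi sw hy]
  simp only [Pi.mul_apply, Pi.add_apply]
  rw [scaledPd_add hD (hv.scaledPd hD i j) sIv i j hy]
  have e1 : scaledPd ε i j (scaledPd ε i j v) y = (ε : ℂ) ^ 2 * pd i (pd i v) y
      + 2 * (ε : ℂ) ^ 3 * pd i (pd j v) y + (ε : ℂ) ^ 4 * pd j (pd j v) y := by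
    have h1 : Set.EqOn (scaledPd ε i j v)
        ((fun y => (ε : ℂ) * pd i v y) + fun y => (ε : ℂ) ^ 2 * pd j v y) (dom D) :=
      fun _ _ => rfl
    rw [scaledPd_congr hD h1 i j hy, scaledPd_add hD (contDiffOn_const.mul (hv.pd hD i))
      (contDiffOn_const.mul (hv.pd hD j)) i j hy]
    simp only [Pi.add_apply]
    rw [scaledPd_const_mul hD (hv.pd hD i) _ i j hy, scaledPd_const_mul hD (hv.pd hD j) _ i j hy]
    simp only [scaledPd]
    rw [pd_comm hD hv j i hy]
    ring
  have e2 : scaledPd ε i j (fun y => Complex.I * liftSlow φ y * v y) y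
      = Complex.I * (ε : ℂ) ^ 2 * liftSlow (dirs [slowDir j] φ) y * v y
        + Complex.I * liftSlow φ y * ((ε : ℂ) * pd i v y + (ε : ℂ) ^ 2 * pd j v y) := by
    have h1 := scaledPd_mul (ε := ε) hD sc hv i j hy
    have h2 := scaledPd_const_mul (ε := ε) hD sφ Complex.I i j hy
    have h3 : pd i (liftSlow φ) y = 0 := by
      rw [pd_liftSlow hφs, hi]; simp [liftSlow, dirs_cons]
    have h4 : pd j (liftSlow φ) y = liftSlow (dirs [slowDir j] φ) y := by rw [pd_liftSlow hφs]
    change scaledPd ε i j ((fun y => Complex.I * liftSlow φ y) * v) y = _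
    rw [h1]
    simp only [Pi.add_apply, Pi.mul_apply]
    rw [h2]
    simp only [scaledPd, h3, h4]
    ring
  rw [Pi.add_apply, e1, e2]
  have e3 : liftSlow φ y = (fderiv ℝ (phase P p) (slow y) (slowDir j) : ℂ) := rfl
  have e4 : liftSlow (dirs [slowDir j] φ) y
    = (fderiv ℝ (fun z => fderiv ℝ (phase P p) z (slowDir j)) (slow y) (slowDir j) : ℂ) := rfl
  rw [← e3, ← e4]
  simp only [scaledPd]
  linear_combination (liftSlow φ y ^ 2 * v y * carrierExp P ε p y) * Complex.I_mul_I

/-- The linear part of the equation for a mode. -/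
theorem wave_mode (hD : IsOpen D) (hε : ε ≠ 0) (p : Mode) {v : Amp} (hv : SmoothAmp D v)
    {y : Fin 4 → ℝ} (hy : y ∈ dom D) :
    scaledPd ε 1 3 (scaledPd ε 1 3 (v * carrierExp P ε p)) y
      - scaledPd ε 0 2 (scaledPd ε 0 2 (v * carrierExp P ε p)) y + (v * carrierExp P ε p) y =
    (-(eikonal (phase P p) (slow y) : ℂ) * v y
      + (ε : ℂ) ^ 1 * (2 * Complex.I * ((dt (phase P p) (slow y) : ℂ) * pd 1 v y
        - (dx (phase P p) (slow y) : ℂ) * pd 0 v y))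
      + (ε : ℂ) ^ 2 * ((pd 1 (pd 1 v) y - pd 0 (pd 0 v) y)
        + 2 * Complex.I * ((dt (phase P p) (slow y) : ℂ) * pd 3 v y
          - (dx (phase P p) (slow y) : ℂ) * pd 2 v y)
        + Complex.I * ((dt (dt (phase P p)) (slow y) - dx (dx (phase P p)) (slow y) : ℝ) : ℂ)
          * v y)
      + (ε : ℂ) ^ 3 * (2 * (pd 1 (pd 3 v) y - pd 0 (pd 2 v) y))
      + (ε : ℂ) ^ 4 * (pd 3 (pd 3 v) y - pd 2 (pd 2 v) y)) * carrierExp P ε p y := by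
  obtain ⟨s0, s1, s2, s3⟩ := slowDir_values
  rw [scaledPd_scaledPd_mode hS hD hε p s1 hv hy, scaledPd_scaledPd_mode hS hD hε p s0 hv hy,
    s2, s3]
  have ett : dt (dt (phase P p)) (slow y)
    = fderiv ℝ (fun z => fderiv ℝ (phase P p) z (0, 1)) (slow y) (0, 1) := rfl
  have exx : dx (dx (phase P p)) (slow y)
    = fderiv ℝ (fun z => fderiv ℝ (phase P p) z (1, 0)) (slow y) (1, 0) := rfl
  rw [ett, exx]
  simp only [Pi.mul_apply, eikonal, dt, dx]
  push_cast
  ring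

end SecondDeriv

/-! ### Sums over modes and orders -/

theorem carrierExp_add (P : Driver) (ε : ℝ) (p q : Mode) (y : Fin 4 → ℝ) :
    carrierExp P ε (p + q) y = carrierExp P ε p y * carrierExp P ε q y := by
  simp only [carrierExp, ← Complex.exp_add]
  congr 1
  simp only [phase, Prod.fst_add, Prod.snd_add]
  push_cast
  ring

theorem norm_carrierExp (P : Driver) (ε : ℝ) (p : Mode) (y : Fin 4 → ℝ) :
    ‖carrierExp P ε p y‖ = 1 := by
  simp only [carrierExp, mul_comm Complex.I, Complex.norm_exp_ofReal_mul_I]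

/-- Multiplication by `e^k` shifts the index. Nothing is lost at the upper end because the last
terms vanish, and `f 0 = 0` makes the truncated subtraction correct at the lower end. -/
theorem sum_pow_shift {M : ℕ} (e : ℂ) (k : ℕ) (f : ℕ → ℂ) (h0 : f 0 = 0)
    (h1 : ∀ n, M < n + k → f n = 0) :
    ∑ n ∈ Finset.range (M + 1), e ^ n * (e ^ k * f n)
      = ∑ n ∈ Finset.range (M + 1), e ^ n * f (n - k) := by
  induction k with
  | zero => simp
  | succ k ih =>
    have ih' := ih fun n hn => h1 n (by omega)
    have e1 : ∑ n ∈ Finset.range (M + 1), e ^ n * (e ^ (k + 1) * f n)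
        = e * ∑ n ∈ Finset.range (M + 1), e ^ n * f (n - k) := by
      rw [← ih', Finset.mul_sum]
      exact Finset.sum_congr rfl fun n _ => by ring
    have e2 : f (M - k) = 0 := by
      rcases Nat.lt_or_ge M k with h | h
      · rw [show M - k = 0 by omega, h0]
      · exact h1 _ (by omega)
    rw [e1, Finset.sum_range_succ, e2, Finset.sum_range_succ' (n := M), show 0 - (k + 1) = 0 by omega,
      h0]
    simp only [mul_zero, add_zero]
    rw [Finset.mul_sum]
    refine Finset.sum_congr rfl fun n _ => ?_
    rw [show n + 1 - (k + 1) = n - k by omega]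
    ring

/-- Both sides are sums over all modes, which are invariant under translation; the hypotheses say
that `B` contains the support of the summand before and after the shift. -/
theorem sum_mode_shift {B : Finset Mode} (g h : Mode → ℂ) (d : Mode)
    (h1 : ∀ p, g p ≠ 0 → p ∈ B) (h2 : ∀ p, g p ≠ 0 → p + d ∈ B) :
    ∑ p ∈ B, g p * h (p + d) = ∑ p ∈ B, g (p - d) * h p := by
  have e1 : ∑ᶠ p, g p * h (p + d) = ∑ p ∈ B, g p * h (p + d) :=
    finsum_eq_sum_of_support_subset _ fun p hp => h1 p (left_ne_zero_of_mul hp)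
  have e2 : ∑ᶠ p, g (p - d) * h p = ∑ p ∈ B, g (p - d) * h p :=
    finsum_eq_sum_of_support_subset _ fun p hp => by
      have := h2 (p - d) (left_ne_zero_of_mul hp)
      simpa using this
  rw [← e1, ← e2, ← finsum_comp_equiv (Equiv.addRight d) (f := fun p => g (p - d) * h p)]
  refine finsum_congr fun p => ?_
  simp

/-- The triples in the expanded cube are sorted by their total order and then by their total mode. A
total order above `3 N` needs a factor of order above `N`, which is zero. -/
theorem cube_eq_sum_cubic {v : Family} {N M : ℕ} (hM : 3 * N ≤ M) {y : Fin 4 → ℝ}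
    (hv : ∀ n, N < n → ∀ p, v n p y = 0) (P : Driver) (ε : ℝ) (e : ℂ) :
    (∑ n ∈ Finset.range (M + 1), e ^ n * ∑ p ∈ Omega n, v n p y * carrierExp P ε p y) ^ 3
      = ∑ n ∈ Finset.range (M + 1), e ^ n * ∑ p ∈ Omega M, cubic v n p y * carrierExp P ε p y := by
  set R := Finset.range (M + 1) with hR
  set T : ℕ × ℕ × ℕ → ℂ := fun q => ∑ r ∈ Omega q.1 ×ˢ Omega q.2.1 ×ˢ Omega q.2.2,
    v q.1 r.1 y * v q.2.1 r.2.1 y * v q.2.2 r.2.2 y * carrierExp P ε (r.1 + r.2.1 + r.2.2) y with hT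
  have lhs : (∑ n ∈ R, e ^ n * ∑ p ∈ Omega n, v n p y * carrierExp P ε p y) ^ 3
      = ∑ q ∈ R ×ˢ R ×ˢ R, e ^ (q.1 + q.2.1 + q.2.2) * T q := by
    rw [pow_succ, pow_two, mul_assoc, Finset.sum_mul_sum, Finset.sum_mul_sum, Finset.sum_product]
    refine Finset.sum_congr rfl fun a _ => ?_
    rw [Finset.sum_product]
    refine Finset.sum_congr rfl fun b _ => ?_
    rw [Finset.mul_sum]
    refine Finset.sum_congr rfl fun c _ => ?_
    have : T (a, b, c) = (∑ p ∈ Omega a, v a p y * carrierExp P ε p y)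
        * ((∑ p ∈ Omega b, v b p y * carrierExp P ε p y)
        * ∑ p ∈ Omega c, v c p y * carrierExp P ε p y) := by
      simp only [hT]
      rw [Finset.sum_mul_sum, Finset.sum_mul_sum, Finset.sum_product]
      refine Finset.sum_congr rfl fun r1 _ => ?_
      rw [Finset.sum_product]
      refine Finset.sum_congr rfl fun r2 _ => ?_
      rw [Finset.mul_sum]
      refine Finset.sum_congr rfl fun r3 _ => ?_
      rw [carrierExp_add, carrierExp_add]
      ring
    rw [this]
    ring
  have tz : ∀ q ∈ R ×ˢ R ×ˢ R, e ^ (q.1 + q.2.1 + q.2.2) * T q ≠ 0 →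
      q.1 + q.2.1 + q.2.2 ∈ R := by
    intro q _ hq
    have hTq : T q ≠ 0 := right_ne_zero_of_mul hq
    rw [hR, Finset.mem_range]
    by_contra hlt
    refine hTq (Finset.sum_eq_zero fun r _ => ?_)
    rcases (by omega : N < q.1 ∨ N < q.2.1 ∨ N < q.2.2) with h | h | h <;> simp [hv _ h]
  rw [lhs, ← Finset.sum_filter_of_ne tz,
    ← Finset.sum_fiberwise_of_maps_to (g := fun q : ℕ × ℕ × ℕ => q.1 + q.2.1 + q.2.2) (t := R)
      (fun q hq => (Finset.mem_filter.1 hq).2)]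
  refine Finset.sum_congr rfl fun n hn => ?_
  have hn' : n ≤ M := by simpa [hR, Nat.lt_succ_iff] using hn
  have hfil : ((R ×ˢ R ×ˢ R).filter (fun q => q.1 + q.2.1 + q.2.2 ∈ R)).filter
      (fun q => q.1 + q.2.1 + q.2.2 = n)
      = (Finset.range (n + 1) ×ˢ Finset.range (n + 1) ×ˢ Finset.range (n + 1)).filter
        (fun q => q.1 + q.2.1 + q.2.2 = n) := by
    ext q
    simp only [hR, Finset.mem_filter, Finset.mem_product, Finset.mem_range]
    omega
  rw [hfil]
  simp only [cubic_eq_sum_tri, Finset.sum_mul]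
  rw [Finset.sum_comm, Finset.mul_sum]
  refine Finset.sum_congr rfl fun q hq => ?_
  have hq' : q.1 + q.2.1 + q.2.2 = n := (Finset.mem_filter.1 hq).2
  rw [hq']
  congr 1
  simp only [hT, tri]
  rw [← Finset.sum_fiberwise_of_maps_to (g := fun r : Mode × Mode × Mode => r.1 + r.2.1 + r.2.2)
    (t := Omega M)]
  · refine Finset.sum_congr rfl fun p _ => ?_
    rw [Finset.sum_mul]
    refine Finset.sum_congr rfl fun r hr => ?_
    rw [(Finset.mem_filter.1 hr).2]
  · intro r hr
    simp only [Finset.mem_product] at hr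
    exact Omega_mono (by omega) (Omega_add hr.1 hr.2.1 hr.2.2)

/-! ### The residual -/

/-- The family with all amplitudes of orders above `N` removed. -/
def truncate (N : ℕ) (u : Family) : Family := fun n p => if n ≤ N then u n p else 0

theorem truncate_of_le {N n : ℕ} (h : n ≤ N) (u : Family) : truncate N u n = u n := by
  funext p; simp [truncate, h]

theorem truncate_of_lt {N n : ℕ} (h : N < n) (u : Family) (p : Mode) : truncate N u n p = 0 := by
  simp [truncate, not_le.2 h]

section Residual

variable {P : Driver} {N : ℕ} {D : Set (ℝ × ℝ)} {ε : ℝ} {u : Family}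

theorem truncate_smooth (ha : IsAnsatz D N u) (n : ℕ) (p : Mode) :
    SmoothAmp D (truncate N u n p) := by
  rcases Nat.lt_or_ge N n with h | h
  · rw [truncate_of_lt h]; exact contDiffOn_const
  · rw [truncate_of_le h]; exact ha.smooth n h p

theorem truncate_support (ha : IsAnsatz D N u) (n : ℕ) (p : Mode) (hp : p ∉ Omega n)
    {y : Fin 4 → ℝ} (hy : y ∈ dom D) : truncate N u n p y = 0 := by
  rcases Nat.lt_or_ge N n with h | h
  · rw [truncate_of_lt h]; rfl
  · rw [truncate_of_le h]; exact ha.support n h p hp y hy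

/-- The expansion as a function of `(x₁, t₁, x₂, t₂)`. -/
noncomputable def wkbAmp (P : Driver) (v : Family) (M : ℕ) (ε : ℝ) : Amp := fun y =>
  ∑ i ∈ Finset.range (M + 1) ×ˢ Omega M,
    (ε : ℂ) ^ i.1 * (v i.1 i.2 * carrierExp P ε i.2) y

theorem wkbAmp_eq (ha : IsAnsatz D N u) {M : ℕ} {y : Fin 4 → ℝ} (hy : y ∈ dom D) :
    wkbAmp P (truncate N u) M ε y = ∑ n ∈ Finset.range (M + 1), (ε : ℂ) ^ n
      * ∑ p ∈ Omega n, truncate N u n p y * carrierExp P ε p y := by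
  rw [wkbAmp, Finset.sum_product]
  refine Finset.sum_congr rfl fun n hn => ?_
  simp only [Finset.mem_range] at hn
  change ∑ p ∈ Omega M, (ε : ℂ) ^ n * (truncate N u n p * carrierExp P ε p) y = _
  rw [← Finset.mul_sum]
  congr 1
  refine (Finset.sum_subset (Omega_mono (by omega)) fun p _ hp => ?_).symm
  rw [Pi.mul_apply, truncate_support ha n p hp hy, zero_mul]

theorem wkb_eq_wkbAmp (ha : IsAnsatz D N u) {M : ℕ} (hM : N ≤ M) {x t : ℝ}
    (hy : scaledPoint ε x t ∈ dom D) :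
    wkb P u N ε x t = wkbAmp P (truncate N u) M ε (scaledPoint ε x t) := by
  rw [wkbAmp_eq ha hy, wkb]
  have hsub : Finset.Icc 1 N ⊆ Finset.range (M + 1) := fun n hn => by
    simp only [Finset.mem_Icc, Finset.mem_range] at hn ⊢; omega
  refine Eq.trans (Finset.sum_congr rfl fun n hn => ?_) (Finset.sum_subset hsub fun n _ hn => ?_)
  · simp only [Finset.mem_Icc] at hn
    rw [truncate_of_le hn.2]
    rfl
  · simp only [Finset.mem_Icc, not_and, not_le] at hn
    rcases Nat.eq_zero_or_pos n with rfl | h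
    · simp [Omega_zero]
    · simp [truncate_of_lt (hn h)]

theorem cos_eq_carrierExp (P : Driver) (ε x t : ℝ) :
    ((Real.cos (P.S (ε ^ 2 * x, ε ^ 2 * t) / ε ^ 2) : ℝ) : ℂ)
      = (carrierExp P ε (0, 1) (scaledPoint ε x t)
        + carrierExp P ε (0, -1) (scaledPoint ε x t)) / 2 := by
  rw [Complex.ofReal_cos, Complex.cos]
  have hs : slow (scaledPoint ε x t) = (ε ^ 2 * x, ε ^ 2 * t) := rfl
  simp only [carrierExp, phase, hs]
  congr 2
  · congr 1; push_cast; ring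
  · congr 1; push_cast; ring

/-- An exact identity, with no remainder. The bound `3 N + 4` leaves room for the cube, of order at
most `3 N`, and for the derivatives, which raise the order by at most four; it also makes `Ω_M`
contain every mode that occurs. -/
theorem kleinGordon_eq_sum (hS : ContDiff ℝ ∞ P.S) (hD : IsOpen D) (ha : IsAnsatz D N u)
    {M : ℕ} (hM : 3 * N + 4 ≤ M) (hε : ε ≠ 0) {x t : ℝ} (hy : scaledPoint ε x t ∈ dom D) :
    kleinGordon P ε (wkb P u N ε) x t = ∑ n ∈ Finset.range (M + 1), (ε : ℂ) ^ n * ∑ p ∈ Omega M,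
      (-(eikonal (phase P p) (slow (scaledPoint ε x t)) : ℂ)
        * truncate N u n p (scaledPoint ε x t)
        + lower P (truncate N u) n p (scaledPoint ε x t))
        * carrierExp P ε p (scaledPoint ε x t) := by
  set y := scaledPoint ε x t with hydef
  set v := truncate N u with hv
  have sv : ∀ n p, SmoothAmp D (v n p) := truncate_smooth ha
  have sE : ∀ p, SmoothAmp D (carrierExp P ε p) := fun p => smooth_carrierExp hS p
  have sF : ∀ i : ℕ × Mode, SmoothAmp D (fun y => (ε : ℂ) ^ i.1 * (v i.1 i.2 * carrierExp P ε i.2) y) :=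
    fun i => contDiffOn_const.mul ((sv _ _).mul (sE _))
  have sU : SmoothAmp D (wkbAmp P v M ε) := SmoothAmp.finset_sum _ fun i _ => sF i
  have d1 : iteratedDeriv 2 (fun s => wkb P u N ε x s) t
      = scaledPd ε 1 3 (scaledPd ε 1 3 (wkbAmp P v M ε)) y :=
    iteratedDeriv_two_curve (c := fun s => scaledPoint ε x s) hD sU
      (hasDerivAt_scaledPoint_t ε x) hy
      (fun s hs => wkb_eq_wkbAmp ha (by omega) hs)
  have d2 : iteratedDeriv 2 (fun s => wkb P u N ε s t) x
      = scaledPd ε 0 2 (scaledPd ε 0 2 (wkbAmp P v M ε)) y :=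
    iteratedDeriv_two_curve (c := fun s => scaledPoint ε s t) hD sU
      (fun s => hasDerivAt_scaledPoint_x ε s t) hy
      (fun s hs => wkb_eq_wkbAmp ha (by omega) hs)
  have d3 : wkb P u N ε x t = wkbAmp P v M ε y := wkb_eq_wkbAmp ha (by omega) hy
  have dd : ∀ i j, scaledPd ε i j (scaledPd ε i j (wkbAmp P v M ε)) y
      = ∑ a ∈ Finset.range (M + 1) ×ˢ Omega M, (ε : ℂ) ^ a.1
        * scaledPd ε i j (scaledPd ε i j (v a.1 a.2 * carrierExp P ε a.2)) y := by
    intro i j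
    have s1 : ∀ a : ℕ × Mode, SmoothAmp D (v a.1 a.2 * carrierExp P ε a.2) :=
      fun a => (sv _ _).mul (sE _)
    have h1 : Set.EqOn (scaledPd ε i j (wkbAmp P v M ε)) (fun y =>
        ∑ a ∈ Finset.range (M + 1) ×ˢ Omega M, (ε : ℂ) ^ a.1
          * scaledPd ε i j (v a.1 a.2 * carrierExp P ε a.2) y) (dom D) := by
      refine (scaledPd_sum hD _ (fun a _ => sF a) i j).trans fun y hy => ?_
      exact Finset.sum_congr rfl fun a _ => scaledPd_const_mul hD (s1 a) _ i j hy
    rw [scaledPd_congr hD h1 i j hy, scaledPd_sum hD _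
      (fun a _ => contDiffOn_const.mul ((s1 a).scaledPd hD i j)) i j hy]
    exact Finset.sum_congr rfl fun a _ => scaledPd_const_mul hD ((s1 a).scaledPd hD i j) _ i j hy
  have hzero : ∀ p l, pds l (v 0 p) y = 0 := fun p l => by
    rw [hv, truncate_of_le (Nat.zero_le N)]
    exact pds_eqOn_zero hD (ha.zero p) l hy
  have hbig : ∀ n, N < n → ∀ p l, pds l (v n p) y = 0 := fun n hn p l => by
    rw [hv, truncate_of_lt hn, pds_zero]; rfl
  have shift : ∀ k, k ≤ 4 → ∀ G : ℕ → ℂ, G 0 = 0 → (∀ n, N < n → G n = 0) →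
      ∑ n ∈ Finset.range (M + 1), (ε : ℂ) ^ n * ((ε : ℂ) ^ k * G n)
        = ∑ n ∈ Finset.range (M + 1), (ε : ℂ) ^ n * G (n - k) :=
    fun k hk G h0 h1 => sum_pow_shift _ k G h0 fun n hn => h1 n (by omega)
  have hsup : ∀ n p, v n p y ≠ 0 → p ∈ Omega N := fun n p h => by
    by_contra hp
    refine h ?_
    rcases Nat.lt_or_ge N n with hn | hn
    · exact hbig n hn p []
    · exact truncate_support ha n p (fun h' => hp (Omega_mono hn h')) hy
  have lin : scaledPd ε 1 3 (scaledPd ε 1 3 (wkbAmp P v M ε)) y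
      - scaledPd ε 0 2 (scaledPd ε 0 2 (wkbAmp P v M ε)) y + wkbAmp P v M ε y
      = ∑ n ∈ Finset.range (M + 1), (ε : ℂ) ^ n * ∑ p ∈ Omega M,
        (-(eikonal (phase P p) (slow y) : ℂ) * v n p y
          + 2 * Complex.I * ((dt (phase P p) (slow y) : ℂ) * pd 1 (v (n - 1) p) y
            - (dx (phase P p) (slow y) : ℂ) * pd 0 (v (n - 1) p) y)
          + ((pd 1 (pd 1 (v (n - 2) p)) y - pd 0 (pd 0 (v (n - 2) p)) y)
            + 2 * Complex.I * ((dt (phase P p) (slow y) : ℂ) * pd 3 (v (n - 2) p) y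
              - (dx (phase P p) (slow y) : ℂ) * pd 2 (v (n - 2) p) y)
            + Complex.I * ((dt (dt (phase P p)) (slow y) - dx (dx (phase P p)) (slow y) : ℝ) : ℂ)
              * v (n - 2) p y)
          + 2 * (pd 1 (pd 3 (v (n - 3) p)) y - pd 0 (pd 2 (v (n - 3) p)) y)
          + (pd 3 (pd 3 (v (n - 4) p)) y - pd 2 (pd 2 (v (n - 4) p)) y))
          * carrierExp P ε p y := by
    rw [dd 1 3, dd 0 2, wkbAmp, ← Finset.sum_sub_distrib, ← Finset.sum_add_distrib]
    have e1 : ∀ a ∈ Finset.range (M + 1) ×ˢ Omega M, (ε : ℂ) ^ a.1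
        * scaledPd ε 1 3 (scaledPd ε 1 3 (v a.1 a.2 * carrierExp P ε a.2)) y
        - (ε : ℂ) ^ a.1 * scaledPd ε 0 2 (scaledPd ε 0 2 (v a.1 a.2 * carrierExp P ε a.2)) y
        + (ε : ℂ) ^ a.1 * (v a.1 a.2 * carrierExp P ε a.2) y = (ε : ℂ) ^ a.1 * _ := fun a _ => by
      rw [← mul_sub, ← mul_add, wave_mode hS hD hε a.2 (sv a.1 a.2) hy]
    rw [Finset.sum_congr rfl e1, Finset.sum_product_right]
    simp only [Finset.mul_sum]
    rw [Finset.sum_comm (s := Finset.range (M + 1))]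
    refine Finset.sum_congr rfl fun p _ => ?_
    have k1 := shift 1 (by omega) (fun n => 2 * Complex.I * ((dt (phase P p) (slow y) : ℂ)
      * pd 1 (v n p) y - (dx (phase P p) (slow y) : ℂ) * pd 0 (v n p) y) * carrierExp P ε p y)
      (by simp only [show pd 1 (v 0 p) y = 0 from hzero p [1],
            show pd 0 (v 0 p) y = 0 from hzero p [0]]; ring)
      (fun n hn => by simp only [show pd 1 (v n p) y = 0 from hbig n hn p [1],
            show pd 0 (v n p) y = 0 from hbig n hn p [0]]; ring)
    have k2 := shift 2 (by omega) (fun n => ((pd 1 (pd 1 (v n p)) y - pd 0 (pd 0 (v n p)) y)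
        + 2 * Complex.I * ((dt (phase P p) (slow y) : ℂ) * pd 3 (v n p) y
          - (dx (phase P p) (slow y) : ℂ) * pd 2 (v n p) y)
        + Complex.I * ((dt (dt (phase P p)) (slow y) - dx (dx (phase P p)) (slow y) : ℝ) : ℂ)
          * v n p y) * carrierExp P ε p y)
      (by simp only [show pd 1 (pd 1 (v 0 p)) y = 0 from hzero p [1, 1],
            show pd 0 (pd 0 (v 0 p)) y = 0 from hzero p [0, 0],
            show pd 3 (v 0 p) y = 0 from hzero p [3], show pd 2 (v 0 p) y = 0 from hzero p [2],
            show v 0 p y = 0 from hzero p []]; ring)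
      (fun n hn => by simp only [show pd 1 (pd 1 (v n p)) y = 0 from hbig n hn p [1, 1],
            show pd 0 (pd 0 (v n p)) y = 0 from hbig n hn p [0, 0],
            show pd 3 (v n p) y = 0 from hbig n hn p [3],
            show pd 2 (v n p) y = 0 from hbig n hn p [2],
            show v n p y = 0 from hbig n hn p []]; ring)
    have k3 := shift 3 (by omega) (fun n => 2 * (pd 1 (pd 3 (v n p)) y - pd 0 (pd 2 (v n p)) y)
        * carrierExp P ε p y)
      (by simp only [show pd 1 (pd 3 (v 0 p)) y = 0 from hzero p [1, 3],
            show pd 0 (pd 2 (v 0 p)) y = 0 from hzero p [0, 2]]; ring)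
      (fun n hn => by simp only [show pd 1 (pd 3 (v n p)) y = 0 from hbig n hn p [1, 3],
            show pd 0 (pd 2 (v n p)) y = 0 from hbig n hn p [0, 2]]; ring)
    have k4 := shift 4 (by omega) (fun n => (pd 3 (pd 3 (v n p)) y - pd 2 (pd 2 (v n p)) y)
        * carrierExp P ε p y)
      (by simp only [show pd 3 (pd 3 (v 0 p)) y = 0 from hzero p [3, 3],
            show pd 2 (pd 2 (v 0 p)) y = 0 from hzero p [2, 2]]; ring)
      (fun n hn => by simp only [show pd 3 (pd 3 (v n p)) y = 0 from hbig n hn p [3, 3],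
            show pd 2 (pd 2 (v n p)) y = 0 from hbig n hn p [2, 2]]; ring)
    -- Each power `ε^k` from the chain rule is turned into a shift of the order by `k`; `k1` to `k4`
    -- collect the terms according to this power.
    simp only [add_mul, mul_add, mul_assoc, Finset.sum_add_distrib] at k1 k2 k3 k4 ⊢
    linear_combination k1 + k2 + k3 + k4
  have upd : ∀ n, ∑ p ∈ Omega M, v n p y * carrierExp P ε (p + (0, 1)) y
      = ∑ p ∈ Omega M, v n (p.1, p.2 - 1) y * carrierExp P ε p y := fun n => by
    rw [sum_mode_shift (fun p => v n p y) (fun p => carrierExp P ε p y) (0, 1)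
      (fun p hp => Omega_mono (by omega) (hsup n p hp)) (fun p hp => by
        have := Omega_up (hsup n p hp)
        have e : p + (0, 1) = (p.1, p.2 + 1) := by ext <;> simp
        rw [e]
        exact Omega_mono (by omega) this)]
    refine Finset.sum_congr rfl fun p _ => ?_
    rw [show p - (0, 1) = (p.1, p.2 - 1) by ext <;> simp]
  have downd : ∀ n, ∑ p ∈ Omega M, v n p y * carrierExp P ε (p + (0, -1)) y
      = ∑ p ∈ Omega M, v n (p.1, p.2 + 1) y * carrierExp P ε p y := fun n => by
    rw [sum_mode_shift (fun p => v n p y) (fun p => carrierExp P ε p y) (0, -1)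
      (fun p hp => Omega_mono (by omega) (hsup n p hp)) (fun p hp => by
        have := Omega_down (hsup n p hp)
        have e : p + (0, -1) = (p.1, p.2 - 1) := by ext <;> simp [sub_eq_add_neg]
        rw [e]
        exact Omega_mono (by omega) this)]
    refine Finset.sum_congr rfl fun p _ => ?_
    rw [show p - (0, -1) = (p.1, p.2 + 1) by ext <;> simp]
  have drive : ((ε * P.f * Real.cos (P.S (ε ^ 2 * x, ε ^ 2 * t) / ε ^ 2) : ℝ) : ℂ)
      * wkbAmp P v M ε y = ∑ n ∈ Finset.range (M + 1), (ε : ℂ) ^ n * ∑ p ∈ Omega M,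
        (P.f : ℂ) / 2 * (v (n - 1) (p.1, p.2 - 1) y + v (n - 1) (p.1, p.2 + 1) y)
          * carrierExp P ε p y := by
    have k := shift 1 (by omega) (fun n => ∑ p ∈ Omega M, (P.f : ℂ) / 2
        * (v n (p.1, p.2 - 1) y + v n (p.1, p.2 + 1) y) * carrierExp P ε p y)
      (Finset.sum_eq_zero fun p _ => by
        rw [show v 0 (p.1, p.2 - 1) y = 0 from hzero _ [],
          show v 0 (p.1, p.2 + 1) y = 0 from hzero _ []]; ring)
      (fun n hn => Finset.sum_eq_zero fun p _ => by
        rw [show v n (p.1, p.2 - 1) y = 0 from hbig n hn _ [],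
          show v n (p.1, p.2 + 1) y = 0 from hbig n hn _ []]; ring)
    rw [← k, wkbAmp, Finset.sum_product, Finset.mul_sum]
    refine Finset.sum_congr rfl fun n _ => ?_
    have e1 : ∑ p ∈ Omega M, (P.f : ℂ) / 2 * (v n (p.1, p.2 - 1) y + v n (p.1, p.2 + 1) y)
        * carrierExp P ε p y = (P.f : ℂ) / 2 * (∑ p ∈ Omega M, v n p y * carrierExp P ε (p + (0, 1)) y
          + ∑ p ∈ Omega M, v n p y * carrierExp P ε (p + (0, -1)) y) := by
      rw [upd, downd, ← Finset.sum_add_distrib, Finset.mul_sum]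
      exact Finset.sum_congr rfl fun p _ => by ring
    rw [e1, ← Finset.sum_add_distrib, Complex.ofReal_mul, cos_eq_carrierExp, Finset.mul_sum,
      Finset.mul_sum, Finset.mul_sum, Finset.mul_sum]
    refine Finset.sum_congr rfl fun p _ => ?_
    rw [carrierExp_add, carrierExp_add, ← hydef]
    simp only [Pi.mul_apply]
    push_cast
    ring
  have cub := cube_eq_sum_cubic (v := v) (N := N) (M := M) (by omega) (y := y)
    (fun n hn p => hbig n hn p []) P ε (ε : ℂ)
  rw [← wkbAmp_eq ha hy] at cub
  rw [kleinGordon, d1, d2, d3]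
  have split : scaledPd ε 1 3 (scaledPd ε 1 3 (wkbAmp P v M ε)) y
      - scaledPd ε 0 2 (scaledPd ε 0 2 (wkbAmp P v M ε)) y
      + ((1 + ε * P.f * Real.cos (P.S (ε ^ 2 * x, ε ^ 2 * t) / ε ^ 2) : ℝ) : ℂ)
        * wkbAmp P v M ε y + (P.γ : ℂ) * wkbAmp P v M ε y ^ 3
      = (scaledPd ε 1 3 (scaledPd ε 1 3 (wkbAmp P v M ε)) y
      - scaledPd ε 0 2 (scaledPd ε 0 2 (wkbAmp P v M ε)) y + wkbAmp P v M ε y)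
      + ((ε * P.f * Real.cos (P.S (ε ^ 2 * x, ε ^ 2 * t) / ε ^ 2) : ℝ) : ℂ) * wkbAmp P v M ε y
      + (P.γ : ℂ) * wkbAmp P v M ε y ^ 3 := by
    push_cast; ring
  rw [split, lin, drive, cub, Finset.mul_sum, ← Finset.sum_add_distrib, ← Finset.sum_add_distrib]
  refine Finset.sum_congr rfl fun n _ => ?_
  rw [mul_left_comm (P.γ : ℂ), ← mul_add, ← mul_add, Finset.mul_sum, ← Finset.sum_add_distrib,
    ← Finset.sum_add_distrib]
  congr 1
  refine Finset.sum_congr rfl fun p _ => ?_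
  simp only [lower]
  ring

theorem wkbTerm_conj (ha : IsAnsatz D N u) {n : ℕ} (hn : n ≤ N) {x t : ℝ}
    (hy : scaledPoint ε x t ∈ dom D) :
    (starRingEnd ℂ) (wkbTerm P u n ε x t) = wkbTerm P u n ε x t := by
  rw [wkbTerm, map_sum]
  refine Finset.sum_nbij' (fun p => -p) (fun p => -p) (fun p hp => Omega_neg hp)
    (fun p hp => Omega_neg hp) (fun p _ => neg_neg p) (fun p _ => neg_neg p) fun p _ => ?_
  have h1 := ha.real n hn p _ hy
  simp only [scaledPoint] at h1
  rw [h1, map_mul, ← Complex.exp_conj]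
  simp only [map_mul, Complex.conj_I, Complex.conj_ofReal, phase, Prod.fst_neg, Prod.snd_neg]
  congr 2
  push_cast
  ring

theorem wkb_im (ha : IsAnsatz D N u) {x t : ℝ}
    (hy : scaledPoint ε x t ∈ dom D) : (wkb P u N ε x t).im = 0 := by
  rw [← Complex.conj_eq_iff_im, wkb, map_sum]
  refine Finset.sum_congr rfl fun n hn => ?_
  rw [map_mul, wkbTerm_conj ha (Finset.mem_Icc.1 hn).2 hy, map_pow, Complex.conj_ofReal]

theorem validity (hS : ContDiff ℝ ∞ P.S) (hom : P.om ^ 2 = P.k ^ 2 + 1) (hD : IsOpen D)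
    (hSb : ∀ i : ℕ, 1 ≤ i → ∃ C : ℝ, ∀ z ∈ D, ‖iteratedFDeriv ℝ i P.S z‖ ≤ C)
    (hN : 1 ≤ N) (hres : ∀ z ∈ D, ∀ p ∈ drivenModes N, eikonal (phase P p) z ≠ 0)
    (ha : IsAnsatz D N u) (halg : AlgebraicEqs P D N u)
    (hz : CarrierZeta P D N u) (hc : CarrierEqs P D N u)
    (hs : ∀ n, 1 ≤ n → n ≤ N → SingularOrder P N D (n - 1) (u n (1, 0))) :
    (∀ n, 1 ≤ n → n ≤ N → ∀ p, SingularOrder P N D (n - 1) (u n p)) ∧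
      ∃ C : ℝ, ∀ ε x t : ℝ, 0 < ε → (ε ^ 2 * x, ε ^ 2 * t) ∈ D →
        ε ≤ resDist P N (ε ^ 2 * x, ε ^ 2 * t) →
        (wkb P u N ε x t).im = 0 ∧
        (∀ n, 1 ≤ n → n ≤ N → ‖(ε : ℂ) ^ n * wkbTerm P u n ε x t‖ ≤
          C * ε * (ε / resDist P N (ε ^ 2 * x, ε ^ 2 * t)) ^ (n - 1)) ∧
        ‖kleinGordon P ε (wkb P u N ε) x t‖ ≤
          C * ε ^ 2 * (ε / resDist P N (ε ^ 2 * x, ε ^ 2 * t)) ^ (N - 1) := by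
  have hρ : ∀ z ∈ D, 0 < resDist P N z := fun z hz => resDist_pos P N (hres z hz)
  have hcl := ampClass_singular (P := P) (N := N) hD hρ
  have hall : ∀ n, 1 ≤ n → n ≤ N → ∀ p,
      SmoothAmp D (u n p) ∧ SingularOrder P N D (n - 1) (u n p) := fun n h1 h2 p =>
    hcl.all_modes hS hD hSb hρ ha halg h1 h2
      (fun q h1 h2 => ⟨ha.smooth q (by omega) _, hs q h1 (by omega)⟩) p
  refine ⟨fun n h1 h2 p => (hall n h1 h2 p).2, ?_⟩
  have hform : IsFormalSolution P D N u := by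
    refine isFormalSolution_of_eqs hS hom hD ha halg hres (fun n h1 h2 => hz n h1 (by omega))
      ⟨fun h => hc.1 (by omega), fun n h1 h2 => hc.2 n h1 (by omega)⟩
  -- The members of `u` above order `N` are arbitrary and absent from the sum, so the residual is
  -- expressed by the truncated family.
  set v := truncate N u with hv
  set M := 3 * N + 4 with hM
  have hlow : ∀ n p, SmoothAmp D (lower P v n p) ∧ SingularOrder P N D (n - 2) (lower P v n p) := by
    intro n p
    refine hcl.lower hS hD hSb hρ (fun p => ?_) (fun q h1 _ p => ?_) p
    · rw [hv, truncate_of_le (Nat.zero_le N)]; exact ha.zero p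
    · rcases Nat.lt_or_ge N q with h | h
      · rw [hv, truncate_of_lt h]; exact hcl.zero _
      · rw [hv, truncate_of_le h]; exact hall q h1 h p
  have hA : ∀ n p, ∃ C : ℝ, 0 ≤ C ∧ (1 ≤ n → n ≤ N → ∀ y ∈ dom D,
      ‖u n p y‖ ≤ C * (1 / resDist P N (slow y) ^ (n - 1))) := by
    intro n p
    by_cases h : 1 ≤ n ∧ n ≤ N
    · obtain ⟨C, h0, hC⟩ := (hall n h.1 h.2 p).2.nonneg_bound hρ []
      exact ⟨C, h0, fun _ _ y hy => by simpa using hC y hy⟩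
    · exact ⟨0, le_rfl, fun h1 h2 => absurd ⟨h1, h2⟩ h⟩
  have hB : ∀ n p, ∃ C : ℝ, 0 ≤ C ∧ ∀ y ∈ dom D,
      ‖lower P v n p y‖ ≤ C * (1 / resDist P N (slow y) ^ (n - 2)) := by
    intro n p
    obtain ⟨C, h0, hC⟩ := (hlow n p).2.nonneg_bound hρ []
    exact ⟨C, h0, fun y hy => by simpa using hC y hy⟩
  choose A hA0 hA using hA
  choose B hB0 hB using hB
  refine ⟨(∑ n ∈ Finset.Icc 1 N, ∑ p ∈ Omega n, A n p)
    + ∑ n ∈ Finset.range (M + 1), ∑ p ∈ Omega M, B n p, ?_⟩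
  intro ε x t hε hD' hερ
  have hy : scaledPoint ε x t ∈ dom D := hD'
  set ρ := resDist P N (ε ^ 2 * x, ε ^ 2 * t) with hρdef
  have hρ0 : 0 < ρ := hρ _ hD'
  have hsl : slow (scaledPoint ε x t) = (ε ^ 2 * x, ε ^ 2 * t) := rfl
  have hq0 : 0 ≤ ε / ρ := by positivity
  have hq1 : ε / ρ ≤ 1 := (div_le_one hρ0).2 hερ
  have hAs : 0 ≤ ∑ n ∈ Finset.Icc 1 N, ∑ p ∈ Omega n, A n p :=
    Finset.sum_nonneg fun n _ => Finset.sum_nonneg fun p _ => hA0 n p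
  have hBs : 0 ≤ ∑ n ∈ Finset.range (M + 1), ∑ p ∈ Omega M, B n p :=
    Finset.sum_nonneg fun n _ => Finset.sum_nonneg fun p _ => hB0 n p
  have nε : ∀ n : ℕ, ‖(ε : ℂ) ^ n‖ = ε ^ n := fun n => by
    rw [norm_pow, Complex.norm_real, Real.norm_of_nonneg hε.le]
  refine ⟨wkb_im ha hy, fun n h1 h2 => ?_, ?_⟩
  · have e1 : ‖wkbTerm P u n ε x t‖ ≤ (∑ p ∈ Omega n, A n p) * (1 / ρ ^ (n - 1)) := by
      rw [wkbTerm, Finset.sum_mul]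
      refine (norm_sum_le _ _).trans (Finset.sum_le_sum fun p _ => ?_)
      have e2 := norm_carrierExp P ε p (scaledPoint ε x t)
      simp only [carrierExp, hsl] at e2
      rw [norm_mul, e2, mul_one]
      exact hA n p h1 h2 _ hy
    have e3 : ∑ p ∈ Omega n, A n p ≤ (∑ n ∈ Finset.Icc 1 N, ∑ p ∈ Omega n, A n p)
        + ∑ n ∈ Finset.range (M + 1), ∑ p ∈ Omega M, B n p := by
      have := Finset.single_le_sum (f := fun n => ∑ p ∈ Omega n, A n p)
        (fun n _ => Finset.sum_nonneg fun p _ => hA0 n p) (Finset.mem_Icc.2 ⟨h1, h2⟩)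
      linarith
    obtain ⟨m, rfl⟩ : ∃ m, n = m + 1 := ⟨n - 1, by omega⟩
    rw [norm_mul, nε]
    simp only [Nat.add_sub_cancel] at e1 ⊢
    calc ε ^ (m + 1) * ‖wkbTerm P u (m + 1) ε x t‖
        ≤ ε ^ (m + 1) * ((∑ p ∈ Omega (m + 1), A (m + 1) p) * (1 / ρ ^ m)) :=
          mul_le_mul_of_nonneg_left e1 (by positivity)
      _ = (∑ p ∈ Omega (m + 1), A (m + 1) p) * (ε * (ε / ρ) ^ m) := by
          rw [div_pow]; field_simp; ring
      _ ≤ _ := by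
          rw [mul_assoc]
          exact mul_le_mul_of_nonneg_right e3 (by positivity)
  · rw [kleinGordon_eq_sum hS hD ha (M := M) le_rfl hε.ne' hy]
    refine (norm_sum_le _ _).trans ?_
    have e1 : ∀ n ∈ Finset.range (M + 1), ‖(ε : ℂ) ^ n * ∑ p ∈ Omega M,
        (-(eikonal (phase P p) (slow (scaledPoint ε x t)) : ℂ) * v n p (scaledPoint ε x t)
        + lower P v n p (scaledPoint ε x t)) * carrierExp P ε p (scaledPoint ε x t)‖
        ≤ (∑ p ∈ Omega M, B n p) * (ε ^ 2 * (ε / ρ) ^ (N - 1)) := by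
      intro n _
      rw [norm_mul, nε]
      rcases Nat.lt_or_ge N n with hn | hn
      · have e2 : ‖∑ p ∈ Omega M, (-(eikonal (phase P p) (slow (scaledPoint ε x t)) : ℂ)
            * v n p (scaledPoint ε x t) + lower P v n p (scaledPoint ε x t))
            * carrierExp P ε p (scaledPoint ε x t)‖ ≤ (∑ p ∈ Omega M, B n p) * (1 / ρ ^ (n - 2)) := by
          rw [Finset.sum_mul]
          refine (norm_sum_le _ _).trans (Finset.sum_le_sum fun p _ => ?_)
          rw [norm_mul, norm_carrierExp, mul_one, hv, truncate_of_lt hn]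
          simp only [Pi.zero_apply, mul_zero, zero_add]
          exact hB n p _ hy
        obtain ⟨m, rfl⟩ : ∃ m, n = m + 2 := ⟨n - 2, by omega⟩
        have hB0' : 0 ≤ ∑ p ∈ Omega M, B (m + 2) p := Finset.sum_nonneg fun p _ => hB0 _ p
        simp only [Nat.add_sub_cancel] at e2
        refine (mul_le_mul_of_nonneg_left e2 (by positivity)).trans ?_
        calc ε ^ (m + 2) * ((∑ p ∈ Omega M, B (m + 2) p) * (1 / ρ ^ m))
            = (∑ p ∈ Omega M, B (m + 2) p) * (ε ^ 2 * (ε / ρ) ^ m) := by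
              rw [div_pow]; field_simp; ring
          _ ≤ _ := by
              refine mul_le_mul_of_nonneg_left (mul_le_mul_of_nonneg_left ?_ (by positivity)) hB0'
              -- Here `n = m + 2 > N`, so the exponent `m` is at least `N - 1`, and `ε ≤ ρ` makes
              -- the lowest power the largest.
              exact pow_le_pow_of_le_one hq0 hq1 (by omega)
      · have e2 : ∀ p ∈ Omega M, (-(eikonal (phase P p) (slow (scaledPoint ε x t)) : ℂ)
            * v n p (scaledPoint ε x t) + lower P v n p (scaledPoint ε x t))
            * carrierExp P ε p (scaledPoint ε x t) = 0 := by
          intro p _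
          have h1 := hform n hn p _ hy
          -- Up to order `N` truncation changes nothing, so the coefficients vanish by the formal
          -- solution.
          have h2 : lower P v n p (scaledPoint ε x t) = lower P u n p (scaledPoint ε x t) := by
            have hq : ∀ q, q ≤ n → v q = u q := fun q hq => truncate_of_le (by omega) u
            have hcub : cubic v n p (scaledPoint ε x t) = cubic u n p (scaledPoint ε x t) :=
              cubic_congr (fun q h p => by rw [hq q (by omega)]) p
            simp only [lower]
            rw [hcub, hq (n - 1) (by omega), hq (n - 2) (by omega), hq (n - 3) (by omega),
              hq (n - 4) (by omega)]
          rw [h2, hv, truncate_of_le hn, h1, zero_mul]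
        rw [Finset.sum_eq_zero e2, norm_zero, mul_zero]
        exact mul_nonneg (Finset.sum_nonneg fun p _ => hB0 _ p) (by positivity)
    refine (Finset.sum_le_sum e1).trans ?_
    rw [← Finset.sum_mul, mul_assoc]
    exact mul_le_mul_of_nonneg_right (by linarith) (by positivity)

end Residual

end WKB

namespace WKB

/-! ### Integrals over the lines `(x₂, t₂) = const`, `t₁ = 0` -/

/-- The direction of the group lines. -/
noncomputable abbrev groupDir (P : Driver) : ℝ × ℝ := (-P.k / P.om, 1)

/-- The point with `x₁ = x`, `t₁ = 0` and the slow coordinates `z`. -/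
def linePoint (z : ℝ × ℝ) (x : ℝ) : Fin 4 → ℝ := ![x, 0, z.1, z.2]

/-- The derivative along the group lines. -/
noncomputable def groupPd (P : Driver) (v : Amp) : Amp := fun y =>
  pd 3 v y - ((P.k / P.om : ℝ) : ℂ) * pd 2 v y

@[simp] theorem slow_linePoint (z : ℝ × ℝ) (x : ℝ) : slow (linePoint z x) = z := rfl

@[simp] theorem zeta_linePoint (P : Driver) (z : ℝ × ℝ) (x : ℝ) :
    zeta P (linePoint z x) = P.om * x := by simp [zeta, linePoint]

theorem linePoint_mem {D : Set (ℝ × ℝ)} {z : ℝ × ℝ} (hz : z ∈ D) (x : ℝ) :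
    linePoint z x ∈ dom D := hz

theorem one_le_abs_om {P : Driver} (hom : P.om ^ 2 = P.k ^ 2 + 1) : 1 ≤ |P.om| := by
  rw [← sq_le_sq₀ zero_le_one (abs_nonneg _), sq_abs, hom]
  nlinarith [sq_nonneg P.k]

theorem linePoint_eq (z : ℝ × ℝ) (x : ℝ) :
    linePoint z x = x • Pi.single (0 : Fin 4) (1 : ℝ) + linePoint z 0 := by
  funext i; fin_cases i <;> simp [linePoint]

theorem linePoint_group_eq (P : Driver) (z : ℝ × ℝ) (s x : ℝ) :
    linePoint (z + s • groupDir P) x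
      = s • (Pi.single (3 : Fin 4) (1 : ℝ) - (P.k / P.om) • Pi.single (2 : Fin 4) (1 : ℝ))
        + linePoint z x := by
  funext i; fin_cases i <;> simp [linePoint] <;> ring

theorem hasDerivAt_linePoint {D : Set (ℝ × ℝ)} (hD : IsOpen D) {v : Amp} (hv : SmoothAmp D v)
    {z : ℝ × ℝ} (hz : z ∈ D) (x : ℝ) :
    HasDerivAt (fun x => v (linePoint z x)) (pd 0 v (linePoint z x)) x := by
  have h1 := (hv.differentiableAt hD (linePoint_mem hz x)).hasFDerivAt
  have h2 : HasDerivAt (linePoint z) (Pi.single (0 : Fin 4) (1 : ℝ)) x := by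
    rw [show linePoint z = fun x => x • Pi.single (0 : Fin 4) (1 : ℝ) + linePoint z 0 from
      funext (linePoint_eq z)]
    simpa using ((hasDerivAt_id x).smul_const (Pi.single (0 : Fin 4) (1 : ℝ))).add_const
      (linePoint z 0)
  exact h1.comp_hasDerivAt x h2

theorem hasDerivAt_linePoint_group {D : Set (ℝ × ℝ)} (hD : IsOpen D) (P : Driver) {v : Amp}
    (hv : SmoothAmp D v) {z : ℝ × ℝ} {s : ℝ} (hz : z + s • groupDir P ∈ D) (x : ℝ) :
    HasDerivAt (fun s => v (linePoint (z + s • groupDir P) x))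
      (groupPd P v (linePoint (z + s • groupDir P) x)) s := by
  have h1 := (hv.differentiableAt hD (linePoint_mem hz x)).hasFDerivAt
  have h2 : HasDerivAt (fun s => linePoint (z + s • groupDir P) x)
      (Pi.single (3 : Fin 4) (1 : ℝ) - (P.k / P.om) • Pi.single (2 : Fin 4) (1 : ℝ)) s := by
    rw [show (fun s => linePoint (z + s • groupDir P) x) = _ from
      funext (fun s => linePoint_group_eq P z s x)]
    simpa using ((hasDerivAt_id s).smul_const (Pi.single (3 : Fin 4) (1 : ℝ)
      - (P.k / P.om) • Pi.single (2 : Fin 4) (1 : ℝ))).add_const (linePoint z x)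
  have h3 := h1.comp_hasDerivAt s h2
  rw [map_sub, map_smul] at h3
  refine (h3.congr_deriv ?_ : HasDerivAt (v ∘ fun s => linePoint (z + s • groupDir P) x) _ s)
  simp [groupPd, pd, Complex.real_smul]

theorem continuous_linePoint {D : Set (ℝ × ℝ)} (hD : IsOpen D) {v : Amp} (hv : SmoothAmp D v)
    {z : ℝ × ℝ} (hz : z ∈ D) : Continuous fun x => v (linePoint z x) :=
  continuous_iff_continuousAt.2 fun x => (hasDerivAt_linePoint hD hv hz x).continuousAt

theorem LocallyDecaying.congr {P : Driver} {D : Set (ℝ × ℝ)} (hD : IsOpen D) {v w : Amp}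
    (h : LocallyDecaying P D v) (hvw : Set.EqOn v w (dom D)) : LocallyDecaying P D w := by
  intro K hK hc d l
  obtain ⟨C, hC⟩ := h K hK hc d l
  refine ⟨C, fun y hy => ?_⟩
  rw [← pds_congr hD hvw l (hK hy)]
  exact hC y hy

theorem LocallyDecaying.pds {P : Driver} {D : Set (ℝ × ℝ)} {v : Amp}
    (h : LocallyDecaying P D v) (l : List (Fin 4)) : LocallyDecaying P D (pds l v) := by
  intro K hK hc d l'
  obtain ⟨C, hC⟩ := h K hK hc d (l' ++ l)
  exact ⟨C, fun y hy => by rw [← pds_append]; exact hC y hy⟩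

theorem LocallyDecaying.pd {P : Driver} {D : Set (ℝ × ℝ)} {v : Amp}
    (h : LocallyDecaying P D v) (i : Fin 4) : LocallyDecaying P D (pd i v) := h.pds [i]

theorem LocallyDecaying.add {P : Driver} {D : Set (ℝ × ℝ)} (hD : IsOpen D) {v w : Amp}
    (hv : SmoothAmp D v) (hw : SmoothAmp D w)
    (h : LocallyDecaying P D v) (h' : LocallyDecaying P D w) : LocallyDecaying P D (v + w) := by
  intro K hK hc d l
  obtain ⟨C, hC⟩ := h K hK hc d l
  obtain ⟨C', hC'⟩ := h' K hK hc d l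
  refine ⟨C + C', fun y hy => ?_⟩
  rw [pds_add hD hv hw l (hK hy)]
  calc _ ≤ (1 + |zeta P y|) ^ d * (‖WKB.pds l v y‖ + ‖WKB.pds l w y‖) := by
        gcongr; exact norm_add_le _ _
    _ ≤ C + C' := by rw [mul_add]; exact add_le_add (hC y hy) (hC' y hy)

theorem LocallyDecaying.mul {P : Driver} {D : Set (ℝ × ℝ)} (hD : IsOpen D) {v w : Amp}
    (hv : SmoothAmp D v) (hw : SmoothAmp D w)
    (h : LocallyDecaying P D v) (h' : LocallyDecaying P D w) : LocallyDecaying P D (v * w) := by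
  intro K hK hc d l
  refine leibniz_induction hD hv hw l
    (fun f => ∃ C : ℝ, ∀ y ∈ dom K, (1 + |zeta P y|) ^ d * ‖f y‖ ≤ C) ?_ ?_ ?_
  · rintro f g - - ⟨C, hC⟩ ⟨C', hC'⟩
    refine ⟨C + C', fun y hy => ?_⟩
    calc _ ≤ (1 + |zeta P y|) ^ d * (‖f y‖ + ‖g y‖) := by gcongr; exact norm_add_le _ _
      _ ≤ C + C' := by rw [mul_add]; exact add_le_add (hC y hy) (hC' y hy)
  · rintro f g - hfg ⟨C, hC⟩
    exact ⟨C, fun y hy => by rw [← hfg (hK hy)]; exact hC y hy⟩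
  · intro a b _
    obtain ⟨C, hC⟩ := h K hK hc d a
    obtain ⟨C', hC'⟩ := h' K hK hc 0 b
    refine ⟨C * C', fun y hy => ?_⟩
    have h1 := hC y hy
    have h2 := hC' y hy
    simp only [pow_zero, one_mul] at h2
    rw [Pi.mul_apply, norm_mul, ← mul_assoc]
    exact mul_le_mul h1 h2 (norm_nonneg _) (le_trans (by positivity) h1)

theorem LocallyDecaying.const_mul {P : Driver} {D : Set (ℝ × ℝ)} (hD : IsOpen D) {v : Amp}
    (hv : SmoothAmp D v) (h : LocallyDecaying P D v) (c : ℂ) :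
    LocallyDecaying P D (fun y => c * v y) := by
  intro K hK hc d l
  obtain ⟨C, hC⟩ := h K hK hc d l
  refine ⟨‖c‖ * C, fun y hy => ?_⟩
  rw [pds_const_mul hD hv c l (hK hy), norm_mul, mul_left_comm]
  exact mul_le_mul_of_nonneg_left (hC y hy) (norm_nonneg _)

theorem LocallyDecaying.cconj {P : Driver} {D : Set (ℝ × ℝ)} (hD : IsOpen D) {v : Amp}
    (hv : SmoothAmp D v) (h : LocallyDecaying P D v) : LocallyDecaying P D (cconj v) := by
  intro K hK hc d l
  obtain ⟨C, hC⟩ := h K hK hc d l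
  refine ⟨C, fun y hy => ?_⟩
  rw [pds_cconj hD hv l (hK hy)]
  simpa [WKB.cconj] using hC y hy

theorem SmoothAmp.groupPd {D : Set (ℝ × ℝ)} (hD : IsOpen D) (P : Driver) {v : Amp}
    (hv : SmoothAmp D v) : SmoothAmp D (groupPd P v) :=
  ContDiffOn.sub (hv.pd hD 3) (contDiffOn_const.mul (hv.pd hD 2))

/-- On a line, a locally decaying amplitude is bounded by an integrable function. -/
theorem LocallyDecaying.exists_line_bound {P : Driver} (hom : P.om ^ 2 = P.k ^ 2 + 1)
    {D : Set (ℝ × ℝ)} {v : Amp} (h : LocallyDecaying P D v) {K : Set (ℝ × ℝ)} (hK : K ⊆ D)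
    (hc : IsCompact K) :
    ∃ C : ℝ, 0 ≤ C ∧ ∀ z ∈ K, ∀ x, ‖v (linePoint z x)‖ ≤ C * (1 + x ^ 2)⁻¹ := by
  obtain ⟨C, hC⟩ := h K hK hc 2 []
  refine ⟨max C 0, le_max_right _ _, fun z hz x => ?_⟩
  have h1 := hC (linePoint z x) hz
  rw [zeta_linePoint, pds_nil] at h1
  have h2 : 1 + x ^ 2 ≤ (1 + |P.om * x|) ^ 2 := by
    have h3 : |x| ≤ |P.om * x| := by
      rw [abs_mul]; exact le_mul_of_one_le_left (abs_nonneg _) (one_le_abs_om hom)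
    have h4 := abs_nonneg x
    nlinarith [sq_abs x]
  rw [← div_eq_mul_inv, le_div_iff₀ (by positivity), mul_comm]
  exact (mul_le_mul_of_nonneg_right h2 (norm_nonneg _)).trans (h1.trans (le_max_left _ _))

section line

variable {P : Driver} (hom : P.om ^ 2 = P.k ^ 2 + 1) {D : Set (ℝ × ℝ)} (hD : IsOpen D)

include hom hD

theorem LocallyDecaying.integrable {v : Amp} (hv : SmoothAmp D v) (h : LocallyDecaying P D v)
    {z : ℝ × ℝ} (hz : z ∈ D) : MeasureTheory.Integrable fun x => v (linePoint z x) := by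
  obtain ⟨C, -, hC⟩ := h.exists_line_bound hom (Set.singleton_subset_iff.2 hz) isCompact_singleton
  exact (integrable_inv_one_add_sq.const_mul C).mono'
    (continuous_linePoint hD hv hz).aestronglyMeasurable
    (Filter.Eventually.of_forall fun x => hC z rfl x)

omit hD in
theorem LocallyDecaying.tendsto_line {v : Amp} (h : LocallyDecaying P D v)
    {z : ℝ × ℝ} (hz : z ∈ D) : Filter.Tendsto (fun x => v (linePoint z x)) Filter.atBot (nhds 0) := by
  obtain ⟨C, -, hC⟩ := h.exists_line_bound hom (Set.singleton_subset_iff.2 hz) isCompact_singleton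
  refine squeeze_zero_norm (fun x => hC z rfl x) ?_
  have h1 : Filter.Tendsto (fun x : ℝ => (1 + x ^ 2)⁻¹) Filter.atBot (nhds 0) :=
    Filter.Tendsto.inv_tendsto_atTop (Filter.tendsto_atTop_add_const_left _ _ (by
      simpa [sq] using Filter.tendsto_id.atBot_mul_atBot₀ (f := fun x : ℝ => x)
        Filter.tendsto_id))
  simpa using h1.const_mul C

omit hom in
theorem LocallyDecaying.groupPd {v : Amp} (hv : SmoothAmp D v)
    (h : LocallyDecaying P D v) : LocallyDecaying P D (groupPd P v) := by
  have h1 := LocallyDecaying.add hD (hv.pd hD 3)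
    (w := fun y => (-((P.k / P.om : ℝ) : ℂ)) * WKB.pd 2 v y)
    (contDiffOn_const.mul (hv.pd hD 2)) (h.pd 3) ((h.pd 2).const_mul hD (hv.pd hD 2) _)
  refine h1.congr hD fun y _ => ?_
  simp only [Pi.add_apply, WKB.groupPd]
  ring

theorem integral_pd_zero {v : Amp} (hv : SmoothAmp D v) (h : LocallyDecaying P D v)
    {z : ℝ × ℝ} (hz : z ∈ D) : ∫ x, pd 0 v (linePoint z x) = 0 :=
  MeasureTheory.integral_eq_zero_of_hasDerivAt_of_integrable
    (fun x => hasDerivAt_linePoint hD hv hz x)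
    ((h.pd 0).integrable hom hD (hv.pd hD 0) hz) (h.integrable hom hD hv hz)

/-- Differentiation of line integrals along the group lines. -/
theorem hasDerivAt_integral_linePoint {v : Amp} (hv : SmoothAmp D v)
    (h : LocallyDecaying P D v) {z : ℝ × ℝ} {s : ℝ} (hz : z + s • groupDir P ∈ D) :
    HasDerivAt (fun s => ∫ x, v (linePoint (z + s • groupDir P) x))
      (∫ x, groupPd P v (linePoint (z + s • groupDir P) x)) s := by
  obtain ⟨K, hKc, hzK, hKD⟩ := exists_compact_subset hD hz
  obtain ⟨C, -, hC⟩ := (h.groupPd hD hv).exists_line_bound hom hKD hKc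
  have hcont : Continuous fun s : ℝ => z + s • groupDir P := by fun_prop
  have hs : {s : ℝ | z + s • groupDir P ∈ K} ∈ nhds s :=
    hcont.continuousAt.preimage_mem_nhds (mem_interior_iff_mem_nhds.1 hzK)
  refine (hasDerivAt_integral_of_dominated_loc_of_deriv_le (bound := fun x => C * (1 + x ^ 2)⁻¹)
    (F := fun s x => v (linePoint (z + s • groupDir P) x))
    (F' := fun s x => WKB.groupPd P v (linePoint (z + s • groupDir P) x)) hs
    ?_ (h.integrable hom hD hv hz)
    (continuous_linePoint hD (hv.groupPd hD P) hz).aestronglyMeasurable ?_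
    (integrable_inv_one_add_sq.const_mul C) ?_).2
  · filter_upwards [hs] with s' hs'
    exact (continuous_linePoint hD hv (hKD hs')).aestronglyMeasurable
  · exact Filter.Eventually.of_forall fun x s' hs' => hC _ hs' x
  · exact Filter.Eventually.of_forall fun x s' hs' =>
      hasDerivAt_linePoint_group hD P hv (hKD hs') x

omit hom hD in
/-- The square of the `L²`-norm on a line. -/
noncomputable def mass (w : Amp) (z : ℝ × ℝ) : ℝ := ∫ x, ‖w (linePoint z x)‖ ^ 2

omit hom hD in
/-- The derivative of the mass along the group lines. -/
noncomputable def massDeriv (P : Driver) (w : Amp) (z : ℝ × ℝ) : ℝ :=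
  (∫ x, groupPd P (w * cconj w) (linePoint z x)).re

omit hom hD in
theorem mass_nonneg (w : Amp) (z : ℝ × ℝ) : 0 ≤ mass w z :=
  MeasureTheory.integral_nonneg fun _ => by positivity

omit hom hD in
theorem mass_eq (w : Amp) (z : ℝ × ℝ) :
    (mass w z : ℂ) = ∫ x, (w * cconj w) (linePoint z x) := by
  rw [mass]
  refine (integral_ofReal (𝕜 := ℂ)).symm.trans ?_
  congr 1 with x
  simp [cconj, Complex.mul_conj, Complex.normSq_eq_norm_sq]

omit hom in
theorem LocallyDecaying.mul_cconj {w : Amp} (hw : SmoothAmp D w) (h : LocallyDecaying P D w) :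
    LocallyDecaying P D (w * WKB.cconj w) := by
  exact h.mul hD hw hw.cconj (h.cconj hD hw)

theorem LocallyDecaying.integrable_sq {w : Amp} (hw : SmoothAmp D w) (h : LocallyDecaying P D w)
    {z : ℝ × ℝ} (hz : z ∈ D) : MeasureTheory.Integrable fun x => ‖w (linePoint z x)‖ ^ 2 := by
  have h1 := ((h.mul_cconj hD hw).integrable hom hD (hw.mul hw.cconj) hz).norm
  refine h1.congr (Filter.Eventually.of_forall fun x => ?_)
  simp [WKB.cconj, sq]

theorem hasDerivAt_mass {w : Amp} (hw : SmoothAmp D w) (h : LocallyDecaying P D w)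
    {z : ℝ × ℝ} {s : ℝ} (hz : z + s • groupDir P ∈ D) :
    HasDerivAt (fun s => mass w (z + s • groupDir P)) (massDeriv P w (z + s • groupDir P)) s := by
  have h1 := hasDerivAt_integral_linePoint hom hD (hw.mul hw.cconj) (h.mul_cconj hD hw) hz
  have h2 := Complex.reCLM.hasFDerivAt.comp_hasDerivAt s h1
  refine h2.congr_of_eventuallyEq (Filter.Eventually.of_forall fun s' => ?_)
  simp only [Function.comp_apply, ← mass_eq]; simp

/-- Sobolev's inequality on a line. -/
theorem sq_norm_le_mass {w : Amp} (hw : SmoothAmp D w) (h : LocallyDecaying P D w)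
    {z : ℝ × ℝ} (hz : z ∈ D) (x : ℝ) {η : ℝ} (hη : 0 < η) :
    ‖w (linePoint z x)‖ ^ 2 ≤ η * mass (pd 0 w) z + η⁻¹ * mass w z := by
  have hd : ∀ x, HasDerivAt (fun x => ‖w (linePoint z x)‖ ^ 2)
      (2 * inner ℝ (w (linePoint z x)) (pd 0 w (linePoint z x))) x :=
    fun x => (hasDerivAt_linePoint hD hw hz x).norm_sq
  have hi := h.integrable_sq hom hD hw hz
  have hi' := (h.pd 0).integrable_sq hom hD (hw.pd hD 0) hz
  have hg : MeasureTheory.Integrable fun x =>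
      η * ‖pd 0 w (linePoint z x)‖ ^ 2 + η⁻¹ * ‖w (linePoint z x)‖ ^ 2 :=
    (hi'.const_mul η).add (hi.const_mul η⁻¹)
  have hle : ∀ x, |2 * inner ℝ (w (linePoint z x)) (pd 0 w (linePoint z x))|
      ≤ η * ‖pd 0 w (linePoint z x)‖ ^ 2 + η⁻¹ * ‖w (linePoint z x)‖ ^ 2 := by
    intro x
    have h1 := abs_real_inner_le_norm (w (linePoint z x)) (pd 0 w (linePoint z x))
    -- Young's inequality with a free parameter; a small `η` is needed later to absorb the quartic
    -- part of the energy.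
    have h2 : 0 ≤ η⁻¹ * (η * ‖pd 0 w (linePoint z x)‖ - ‖w (linePoint z x)‖) ^ 2 := by positivity
    have h3 : η⁻¹ * (η * ‖pd 0 w (linePoint z x)‖ - ‖w (linePoint z x)‖) ^ 2
        = η * ‖pd 0 w (linePoint z x)‖ ^ 2 + η⁻¹ * ‖w (linePoint z x)‖ ^ 2
          - 2 * (‖w (linePoint z x)‖ * ‖pd 0 w (linePoint z x)‖) := by
      field_simp; ring
    rw [abs_mul, abs_two]
    linarith
  have hcont : Continuous fun x => 2 * inner ℝ (w (linePoint z x)) (pd 0 w (linePoint z x)) :=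
    continuous_const.mul ((continuous_linePoint hD hw hz).inner
      (continuous_linePoint hD (hw.pd hD 0) hz))
  have hdi : MeasureTheory.Integrable fun x =>
      2 * inner ℝ (w (linePoint z x)) (pd 0 w (linePoint z x)) :=
    hg.mono' hcont.aestronglyMeasurable (Filter.Eventually.of_forall hle)
  have ht : Filter.Tendsto (fun x => ‖w (linePoint z x)‖ ^ 2) Filter.atBot (nhds 0) := by
    simpa using ((h.tendsto_line hom hz).norm).pow 2
  have h1 := MeasureTheory.integral_Iic_of_hasDerivAt_of_tendsto (a := x)
    (hd x).continuousAt.continuousWithinAt (fun x _ => hd x) hdi.integrableOn ht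
  rw [sub_zero] at h1
  rw [← h1]
  calc _ ≤ ∫ x in Set.Iic x, (η * ‖pd 0 w (linePoint z x)‖ ^ 2
          + η⁻¹ * ‖w (linePoint z x)‖ ^ 2) :=
        MeasureTheory.setIntegral_mono hdi.integrableOn hg.integrableOn
          fun x => (le_abs_self _).trans (hle x)
    _ ≤ ∫ x, (η * ‖pd 0 w (linePoint z x)‖ ^ 2 + η⁻¹ * ‖w (linePoint z x)‖ ^ 2) :=
        MeasureTheory.setIntegral_le_integral hg
          (Filter.Eventually.of_forall fun x => by positivity)
    _ = _ := by
        rw [MeasureTheory.integral_add (hi'.const_mul η) (hi.const_mul η⁻¹),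
          MeasureTheory.integral_const_mul, MeasureTheory.integral_const_mul]
        rfl

/-- The mass of a solution of a Schrödinger equation with real potential changes along the group
lines due to the source only. -/
theorem abs_massDeriv_le {w X : Amp} (hw : SmoothAmp D w) (h : LocallyDecaying P D w)
    {q : (Fin 4 → ℝ) → ℝ}
    (heq : ∀ y ∈ dom D, 2 * Complex.I * ((P.om : ℂ) * pd 3 w y - (P.k : ℂ) * pd 2 w y)
      - (P.om : ℂ)⁻¹ ^ 2 * pd 0 (pd 0 w) y + (q y : ℂ) * w y + X y = 0)
    {z : ℝ × ℝ} (hz : z ∈ D) {g : ℝ → ℝ} (hg : MeasureTheory.Integrable g)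
    (hle : ∀ x, ‖w (linePoint z x)‖ * ‖X (linePoint z x)‖ ≤ g x) :
    |massDeriv P w z| ≤ ∫ x, g x := by
  have hom0 : (P.om : ℂ) ≠ 0 := by
    have := one_le_abs_om hom
    simp only [ne_eq, Complex.ofReal_eq_zero]
    rintro h0; rw [h0, abs_zero] at this; linarith
  -- `c (A - B)` is the mass flux: its `x₁`-derivative accounts for the dispersion and integrates to
  -- zero.
  set c : ℂ := (2 * Complex.I * (P.om : ℂ))⁻¹ * (P.om : ℂ)⁻¹ ^ 2 with hc
  set A : Amp := pd 0 w * cconj w with hA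
  set B : Amp := w * cconj (pd 0 w) with hB
  have hAs : SmoothAmp D A := (hw.pd hD 0).mul hw.cconj
  have hBs : SmoothAmp D B := hw.mul (hw.pd hD 0).cconj
  have hAd : LocallyDecaying P D A := (h.pd 0).mul hD (hw.pd hD 0) hw.cconj (h.cconj hD hw)
  have hBd : LocallyDecaying P D B :=
    h.mul hD hw (hw.pd hD 0).cconj ((h.pd 0).cconj hD (hw.pd hD 0))
  set v : Amp := w * cconj w with hv
  have hvs : SmoothAmp D v := hw.mul hw.cconj
  have hvd : LocallyDecaying P D v := h.mul_cconj hD hw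
  have hpt : ∀ x, ‖groupPd P v (linePoint z x)
      - c * (pd 0 A (linePoint z x) - pd 0 B (linePoint z x))‖ ≤ g x := by
    intro x
    set y := linePoint z x with hy
    have hyD : y ∈ dom D := linePoint_mem hz x
    have e1 : groupPd P v y = groupPd P w y * cconj w y + w y * cconj (groupPd P w) y := by
      simp only [groupPd, hv]
      rw [pd_mul hD hw hw.cconj 3 hyD, pd_mul hD hw hw.cconj 2 hyD]
      simp only [Pi.add_apply, Pi.mul_apply]
      rw [pd_cconj hD hw 3 hyD, pd_cconj hD hw 2 hyD]
      simp only [cconj, groupPd, map_sub, map_mul, Complex.conj_ofReal]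
      ring
    have e2 : pd 0 A y = pd 0 (pd 0 w) y * cconj w y + pd 0 w y * cconj (pd 0 w) y := by
      rw [hA, pd_mul hD (hw.pd hD 0) hw.cconj 0 hyD]
      simp only [Pi.add_apply, Pi.mul_apply]
      rw [pd_cconj hD hw 0 hyD]
    have e3 : pd 0 B y = pd 0 w y * cconj (pd 0 w) y + w y * cconj (pd 0 (pd 0 w)) y := by
      rw [hB, pd_mul hD hw (hw.pd hD 0).cconj 0 hyD]
      simp only [Pi.add_apply, Pi.mul_apply]
      rw [pd_cconj hD (hw.pd hD 0) 0 hyD]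
    have e4 : groupPd P w y = c * pd 0 (pd 0 w) y
        - (2 * Complex.I * (P.om : ℂ))⁻¹ * ((q y : ℂ) * w y + X y) := by
      have h1 := heq y hyD
      have h2 : 2 * Complex.I * (P.om : ℂ) * groupPd P w y
          = (P.om : ℂ)⁻¹ ^ 2 * pd 0 (pd 0 w) y - ((q y : ℂ) * w y + X y) := by
        have : 2 * Complex.I * (P.om : ℂ) * groupPd P w y
            = 2 * Complex.I * ((P.om : ℂ) * pd 3 w y - (P.k : ℂ) * pd 2 w y) := by
          simp only [groupPd]; push_cast; field_simp
        rw [this]; linear_combination h1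
      have h3 : (2 * Complex.I * (P.om : ℂ)) ≠ 0 := by simp [hom0]
      rw [hc, mul_assoc, ← mul_sub, ← h2, inv_mul_cancel_left₀ h3]
    -- The real potential cancels between the equation and its conjugate, so only the source is
    -- left. As `|ω| ≥ 1`, its coefficient is at most `1/2`.
    have e5 : groupPd P v y - c * (pd 0 A y - pd 0 B y)
        = -(2 * Complex.I * (P.om : ℂ))⁻¹
          * (X y * (starRingEnd ℂ) (w y) - w y * (starRingEnd ℂ) (X y)) := by
      rw [e1, e2, e3]
      simp only [cconj]
      rw [e4, hc]
      simp only [map_sub, map_mul, map_add, map_inv₀, map_pow, Complex.conj_ofReal, Complex.conj_I,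
        map_ofNat]
      rw [show (2 * -Complex.I * (P.om : ℂ))⁻¹ = -(2 * Complex.I * (P.om : ℂ))⁻¹ by
        rw [← inv_neg]; congr 1; ring]
      ring
    rw [e5, norm_mul, norm_neg, norm_inv, norm_mul, norm_mul, Complex.norm_I, Complex.norm_real,
      Real.norm_eq_abs, Complex.norm_ofNat, mul_one]
    have h6 : ‖X y * (starRingEnd ℂ) (w y) - w y * (starRingEnd ℂ) (X y)‖
        ≤ 2 * (‖w y‖ * ‖X y‖) := by
      refine (norm_sub_le _ _).trans (le_of_eq ?_)
      rw [norm_mul, norm_mul, RCLike.norm_conj, RCLike.norm_conj]; ring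
    have h7 : (2 * |P.om|)⁻¹ ≤ 2⁻¹ := by
      have := one_le_abs_om hom
      gcongr; linarith
    calc _ ≤ 2⁻¹ * (2 * (‖w y‖ * ‖X y‖)) :=
          mul_le_mul h7 h6 (norm_nonneg _) (by norm_num)
      _ = ‖w y‖ * ‖X y‖ := by ring
      _ ≤ g x := hle x
  have hiv := (hvd.groupPd hD hvs).integrable hom hD (hvs.groupPd hD P) hz
  have hiA := (hAd.pd 0).integrable hom hD (hAs.pd hD 0) hz
  have hiB := (hBd.pd 0).integrable hom hD (hBs.pd hD 0) hz
  have hiAB : MeasureTheory.Integrable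
      fun x => c * (pd 0 A (linePoint z x) - pd 0 B (linePoint z x)) := (hiA.sub hiB).const_mul c
  have hint : ∫ x, groupPd P v (linePoint z x)
      = ∫ x, (groupPd P v (linePoint z x)
        - c * (pd 0 A (linePoint z x) - pd 0 B (linePoint z x))) := by
    rw [MeasureTheory.integral_sub hiv hiAB,
      MeasureTheory.integral_const_mul, MeasureTheory.integral_sub hiA hiB,
      integral_pd_zero hom hD hAs hAd hz, integral_pd_zero hom hD hBs hBd hz]
    simp
  rw [massDeriv, ← hv, hint]
  exact (Complex.abs_re_le_norm _).trans
    (MeasureTheory.norm_integral_le_of_norm_le hg (Filter.Eventually.of_forall hpt))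

end line

end WKB

namespace WKB

/-! ### Growth along the group lines -/

/-- A differential inequality with coefficients that are singular at a distance `ρ₀`. -/
theorem le_of_singular_growth {J J' : ℝ → ℝ} {s₀ ρ₀ C K T : ℝ} {r : ℕ} (hρ₀ : 0 < ρ₀)
    (hC : 0 ≤ C) (hK : C < K) (hT : |s₀| ≤ T)
    (hJ : ∀ s ∈ Set.uIcc 0 s₀, HasDerivAt J (J' s) s)
    (hJ' : ∀ s ∈ Set.uIcc 0 s₀, |J' s| ≤ C * J s + C / (ρ₀ + |s|) ^ (2 * r)
      + r * (J s / (ρ₀ + |s|) + C / (ρ₀ + |s|) ^ (2 * r + 1)))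
    (hdata : J s₀ ≤ K / (ρ₀ + |s₀|) ^ (2 * r)) :
    J 0 ≤ K * Real.exp ((C + 1) * T) / ρ₀ ^ (2 * r) := by
  have hK0 : 0 < K := hC.trans_lt hK
  -- The segment is run from the data, `τ = 0`, to the point in question, `τ = 1`, whichever sign
  -- `s₀` has. The weight `R^{2r}` decreases on the way; its derivative contributes `-2r J/R`, which
  -- overcompensates the singular growth `r J/R`.
  set R : ℝ → ℝ := fun τ => ρ₀ + |s₀| * (1 - τ) with hR
  set H : ℝ → ℝ := fun τ => J (s₀ * (1 - τ)) * R τ ^ (2 * r) with hH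
  set H' : ℝ → ℝ := fun τ => J' (s₀ * (1 - τ)) * -s₀ * R τ ^ (2 * r)
    + J (s₀ * (1 - τ)) * ((2 * r : ℕ) * R τ ^ (2 * r - 1) * -|s₀|) with hH'
  set B : ℝ → ℝ := fun τ => K * Real.exp ((C + 1) * |s₀| * τ) with hB
  have hmem : ∀ τ ∈ Set.Icc (0 : ℝ) 1, s₀ * (1 - τ) ∈ Set.uIcc 0 s₀ := by
    intro τ hτ
    rcases le_total 0 s₀ with h | h
    · rw [Set.uIcc_of_le h]
      exact ⟨mul_nonneg h (by linarith [hτ.2]), by nlinarith [hτ.1]⟩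
    · rw [Set.uIcc_of_ge h]
      exact ⟨by nlinarith [hτ.1], by nlinarith [hτ.2]⟩
  have habs : ∀ τ ∈ Set.Icc (0 : ℝ) 1, ρ₀ + |s₀ * (1 - τ)| = R τ := by
    intro τ hτ
    rw [abs_mul, abs_of_nonneg (by linarith [hτ.2] : (0 : ℝ) ≤ 1 - τ)]
  have hRpos : ∀ τ ∈ Set.Icc (0 : ℝ) 1, 0 < R τ := fun τ hτ =>
    add_pos_of_pos_of_nonneg hρ₀ (mul_nonneg (abs_nonneg _) (by linarith [hτ.2]))
  have hHd : ∀ τ ∈ Set.Icc (0 : ℝ) 1, HasDerivAt H (H' τ) τ := by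
    intro τ hτ
    have h1 : HasDerivAt (fun τ : ℝ => s₀ * (1 - τ)) (-s₀) τ := by
      simpa using ((hasDerivAt_id τ).const_sub 1).const_mul s₀
    have h2 : HasDerivAt R (-|s₀|) τ := by
      refine ((((hasDerivAt_id τ).const_sub 1).const_mul |s₀|).const_add ρ₀).congr_deriv ?_
      simp
    have h3 := (hJ _ (hmem τ hτ)).comp τ h1
    exact h3.mul (h2.pow (2 * r))
  have hBd : ∀ τ, HasDerivAt B ((C + 1) * |s₀| * B τ) τ := by
    intro τ
    have h1 : HasDerivAt (fun τ : ℝ => (C + 1) * |s₀| * τ) ((C + 1) * |s₀|) τ := by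
      simpa using (hasDerivAt_id τ).const_mul ((C + 1) * |s₀|)
    refine (h1.exp.const_mul K).congr_deriv ?_
    simp only [hB]; ring
  rcases eq_or_ne s₀ 0 with h0 | h0
  · subst h0
    rw [abs_zero, add_zero] at hdata
    refine hdata.trans ?_
    have h1 : 1 ≤ Real.exp ((C + 1) * T) := Real.one_le_exp (by
      rw [abs_zero] at hT; positivity)
    gcongr
    nlinarith
  have hs₀ : 0 < |s₀| := abs_pos.2 h0
  -- A barrier argument: the strict inequality of derivatives is only needed where `H = B`.
  have key : ∀ ⦃τ⦄, τ ∈ Set.Icc (0 : ℝ) 1 → H τ ≤ B τ := by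
    refine image_le_of_deriv_right_lt_deriv_boundary' (f' := H')
      (B' := fun τ => (C + 1) * |s₀| * B τ)
      (fun τ hτ => (hHd τ hτ).continuousAt.continuousWithinAt)
      (fun τ hτ => (hHd τ (Set.Ico_subset_Icc_self hτ)).hasDerivWithinAt) ?_
      (fun τ _ => (hBd τ).continuousAt.continuousWithinAt)
      (fun τ _ => (hBd τ).hasDerivWithinAt) ?_
    · have : R 0 = ρ₀ + |s₀| := by simp [hR]
      simp only [hH, hB, this, sub_zero, mul_one, mul_zero, Real.exp_zero]
      rwa [le_div_iff₀ (by positivity)] at hdata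
    · intro τ hτ' heq
      have hτ := Set.Ico_subset_Icc_self hτ'
      have hr := hRpos τ hτ
      have hKB : K ≤ B τ := by
        have h1 : 1 ≤ Real.exp ((C + 1) * |s₀| * τ) := Real.one_le_exp (by
          have := hτ.1; positivity)
        simp only [hB]; nlinarith
      have hbd := hJ' _ (hmem τ hτ)
      rw [habs τ hτ] at hbd
      set j := J (s₀ * (1 - τ)) with hj
      set j' := J' (s₀ * (1 - τ)) with hj'
      have hpow : ((2 * r : ℕ) : ℝ) * R τ ^ (2 * r - 1) = 2 * r * (R τ ^ (2 * r) / R τ) := by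
        rcases Nat.eq_zero_or_pos r with hr0 | hr0
        · simp [hr0]
        · rw [← Nat.sub_add_cancel (by omega : 1 ≤ 2 * r), pow_succ, Nat.add_sub_cancel]
          push_cast [Nat.cast_sub (by omega : 1 ≤ 2 * r)]
          field_simp
          ring
      have hHτ : H τ = j * R τ ^ (2 * r) := rfl
      have h1 : H' τ ≤ |s₀| * (C * H τ + C + (r / R τ) * (C - H τ)) := by
        have e1 : j' * -s₀ ≤ |j'| * |s₀| := by
          rw [← abs_neg s₀, ← abs_mul]; exact le_abs_self _
        have hRp : 0 < R τ ^ (2 * r) := pow_pos hr _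
        calc H' τ = j' * -s₀ * R τ ^ (2 * r) - |s₀| * (2 * (r / R τ) * H τ) := by
              simp only [hH', ← hj, ← hj', hpow, hHτ]; field_simp; ring
          _ ≤ |j'| * |s₀| * R τ ^ (2 * r) - |s₀| * (2 * (r / R τ) * H τ) := by gcongr
          _ ≤ (C * j + C / R τ ^ (2 * r) + r * (j / R τ + C / R τ ^ (2 * r + 1))) * |s₀|
                * R τ ^ (2 * r) - |s₀| * (2 * (r / R τ) * H τ) := by gcongr
          _ = _ := by rw [hHτ, pow_succ]; field_simp; ring
      -- All singular terms combine into this one. It is harmless at a contact point because the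
      -- barrier stays above `K`, and `K > C`.
      have h2 : (r / R τ) * (C - H τ) ≤ 0 :=
        mul_nonpos_of_nonneg_of_nonpos (by positivity) (by rw [heq]; linarith)
      calc H' τ ≤ |s₀| * (C * H τ + C + (r / R τ) * (C - H τ)) := h1
        _ ≤ |s₀| * (C * B τ + C) := by
            rw [← heq]; exact mul_le_mul_of_nonneg_left (by linarith) hs₀.le
        _ < |s₀| * ((C + 1) * B τ) := mul_lt_mul_of_pos_left (by linarith) hs₀
        _ = (C + 1) * |s₀| * B τ := by ring
  have h1 := key (Set.right_mem_Icc.2 zero_le_one)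
  simp only [hH, hB, hR, sub_self, mul_zero, add_zero, mul_one] at h1
  rw [le_div_iff₀ (by positivity)]
  refine h1.trans ?_
  gcongr

section Propagation

variable {P : Driver} {N : ℕ} {D : Set (ℝ × ℝ)}

/-- Bounds for the mass are propagated along the group lines. -/
theorem exists_mass_le (hom : P.om ^ 2 = P.k ^ 2 + 1) (hD : IsOpen D)
    (hρ : ∀ z ∈ D, 0 < resDist P N z) {D₀ : Set (ℝ × ℝ)} (hD₀ : D₀ ⊆ D)
    (htr : TransversalFrom P N D D₀) {w : Amp} (hw : SmoothAmp D w)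
    (hdec : LocallyDecaying P D w) {r : ℕ}
    (hderiv : ∃ C : ℝ, 0 ≤ C ∧ ∀ z ∈ D, ∀ lam : ℝ, 0 < lam → |massDeriv P w z|
      ≤ C * mass w z + C / resDist P N z ^ (2 * r)
        + r * (lam * mass w z + C / (lam * resDist P N z ^ (2 * r + 2))))
    (hdata : ∃ C : ℝ, ∀ z ∈ D₀, mass w z ≤ C / resDist P N z ^ (2 * r)) :
    ∃ C : ℝ, 0 ≤ C ∧ ∀ z ∈ D, mass w z ≤ C * (1 / resDist P N z ^ (2 * r)) := by
  obtain ⟨T, c, hc, htr⟩ := htr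
  obtain ⟨C, hC, hderiv⟩ := hderiv
  obtain ⟨C₀, hC₀⟩ := hdata
  -- The powers of `c` come from transversality, by which `ρ` at the parameter `s` is at least `c
  -- (ρ(z) + |s|)`.
  set C₁ : ℝ := C + C / c ^ (2 * r) + C / c ^ (2 * r + 2) with hC₁
  have hC₁0 : 0 ≤ C₁ := by positivity
  have hCC₁ : C ≤ C₁ ∧ C / c ^ (2 * r) ≤ C₁ ∧ C / c ^ (2 * r + 2) ≤ C₁ := by
    have h1 : 0 ≤ C / c ^ (2 * r) := by positivity
    have h2 : 0 ≤ C / c ^ (2 * r + 2) := by positivity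
    exact ⟨by linarith, by linarith, by linarith⟩
  set K : ℝ := C₁ + 1 + |C₀| / c ^ (2 * r) with hK
  have hKC : C₁ < K := by
    have : 0 ≤ |C₀| / c ^ (2 * r) := by positivity
    linarith
  refine ⟨K * Real.exp ((C₁ + 1) * T), by have := hC₁0.trans hKC.le; positivity,
    fun z hz => ?_⟩
  obtain ⟨s₀, hs₀, hz₀, hs⟩ := htr z hz
  have hρz := hρ z hz
  have hle : ∀ s ∈ Set.uIcc 0 s₀, ∀ m : ℕ, ∀ A : ℝ, 0 ≤ A →
      A / resDist P N (z + s • groupDir P) ^ m ≤ A / c ^ m / (resDist P N z + |s|) ^ m := by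
    intro s hs' m A hA
    rw [div_div, ← mul_pow]
    have h1 := (hs s hs').2
    have h2 : 0 < c * (resDist P N z + |s|) := by positivity
    exact div_le_div_of_nonneg_left hA (by positivity) (pow_le_pow_left₀ h2.le h1 m)
  have := le_of_singular_growth (J := fun s => mass w (z + s • groupDir P))
    (J' := fun s => massDeriv P w (z + s • groupDir P)) (r := r) hρz hC₁0 hKC hs₀
    (fun s hs' => hasDerivAt_mass hom hD hw hdec (hs s hs').1) ?_ ?_
  · simpa [div_eq_mul_one_div (K * _)] using this
  · intro s hs'
    set R := resDist P N z + |s| with hR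
    have hRp : 0 < R := by positivity
    have hm := mass_nonneg w (z + s • groupDir P)
    -- The choice `lam = 1/R` balances the two parts of the Young inequality: they become `J/R` and
    -- `C/R^{2r+1}`.
    have h1 := hderiv _ (hs s hs').1 R⁻¹ (by positivity)
    have h2 := hle s hs' (2 * r) C hC
    have h3 := hle s hs' (2 * r + 2) C hC
    rw [← hR] at h2 h3
    have hρs := hρ _ (hs s hs').1
    refine h1.trans ?_
    have e1 : C / (R⁻¹ * resDist P N (z + s • groupDir P) ^ (2 * r + 2))
        ≤ C₁ / R ^ (2 * r + 1) := by
      calc _ = R * (C / resDist P N (z + s • groupDir P) ^ (2 * r + 2)) := by field_simp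
        _ ≤ R * (C / c ^ (2 * r + 2) / R ^ (2 * r + 2)) := by gcongr
        _ = C / c ^ (2 * r + 2) / R ^ (2 * r + 1) := by
          rw [pow_succ R (2 * r + 1)]; field_simp
        _ ≤ _ := by gcongr; exact hCC₁.2.2
    have e2 : C / resDist P N (z + s • groupDir P) ^ (2 * r) ≤ C₁ / R ^ (2 * r) :=
      h2.trans (by gcongr; exact hCC₁.2.1)
    have e3 : C * mass w (z + s • groupDir P) ≤ C₁ * mass w (z + s • groupDir P) := by
      gcongr; exact hCC₁.1
    have e4 : R⁻¹ * mass w (z + s • groupDir P) = mass w (z + s • groupDir P) / R := by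
      rw [div_eq_inv_mul]
    rw [e4]
    gcongr
  · refine (hC₀ _ hz₀).trans (((div_le_div_of_nonneg_right (le_abs_self C₀) ?_).trans
      (hle s₀ Set.right_mem_uIcc (2 * r) |C₀| (abs_nonneg _))).trans ?_)
    · have := hρ _ (hD₀ hz₀); positivity
    · gcongr; linarith

/-! ### Square integrable amplitudes -/

/-- The mass of `v` on the lines is at most a multiple of `M`. -/
def SqBounded (D : Set (ℝ × ℝ)) (v : Amp) (M : ℝ × ℝ → ℝ) : Prop :=
  ∃ C : ℝ, 0 ≤ C ∧ ∀ z ∈ D,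
    (MeasureTheory.Integrable fun x => ‖v (linePoint z x)‖ ^ 2) ∧ mass v z ≤ C * M z

theorem SqBounded.congr {v w : Amp} {M : ℝ × ℝ → ℝ} (h : SqBounded D v M)
    (hvw : Set.EqOn v w (dom D)) : SqBounded D w M := by
  obtain ⟨C, hC, h⟩ := h
  refine ⟨C, hC, fun z hz => ?_⟩
  have e : (fun x => ‖w (linePoint z x)‖ ^ 2) = fun x => ‖v (linePoint z x)‖ ^ 2 :=
    funext fun x => by rw [hvw (linePoint_mem hz x)]
  rw [mass, e]
  exact h z hz

theorem SqBounded.mono {v : Amp} {M M' : ℝ × ℝ → ℝ} (h : SqBounded D v M)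
    (hM : ∀ z ∈ D, M z ≤ M' z) : SqBounded D v M' := by
  obtain ⟨C, hC, h⟩ := h
  exact ⟨C, hC, fun z hz => ⟨(h z hz).1, (h z hz).2.trans (by gcongr; exact hM z hz)⟩⟩

theorem sqBounded_zero (M : ℝ × ℝ → ℝ) : SqBounded D 0 M :=
  ⟨0, le_rfl, fun z _ => by simp [mass]⟩

theorem SqBounded.add (hD : IsOpen D) {v w : Amp} (hv : SmoothAmp D v) (hw : SmoothAmp D w)
    {M : ℝ × ℝ → ℝ} (h : SqBounded D v M) (h' : SqBounded D w M) : SqBounded D (v + w) M := by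
  obtain ⟨C, hC, h⟩ := h
  obtain ⟨C', hC', h'⟩ := h'
  refine ⟨2 * C + 2 * C', by positivity, fun z hz => ?_⟩
  obtain ⟨i1, m1⟩ := h z hz
  obtain ⟨i2, m2⟩ := h' z hz
  have hi := (i1.const_mul 2).add (i2.const_mul 2)
  have hle : ∀ x, ‖(v + w) (linePoint z x)‖ ^ 2
      ≤ 2 * ‖v (linePoint z x)‖ ^ 2 + 2 * ‖w (linePoint z x)‖ ^ 2 := by
    intro x
    have h1 := norm_add_le (v (linePoint z x)) (w (linePoint z x))
    have h2 := norm_nonneg (v (linePoint z x) + w (linePoint z x))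
    rw [Pi.add_apply]
    nlinarith [sq_nonneg (‖v (linePoint z x)‖ - ‖w (linePoint z x)‖)]
  have hint : MeasureTheory.Integrable fun x => ‖(v + w) (linePoint z x)‖ ^ 2 := by
    refine hi.mono' ((continuous_linePoint hD (hv.add hw) hz).norm.pow 2).aestronglyMeasurable ?_
    refine Filter.Eventually.of_forall fun x => ?_
    rw [Real.norm_of_nonneg (by positivity)]
    exact hle x
  refine ⟨hint, ?_⟩
  calc mass (v + w) z ≤ ∫ x, (2 * ‖v (linePoint z x)‖ ^ 2 + 2 * ‖w (linePoint z x)‖ ^ 2) :=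
        MeasureTheory.integral_mono hint hi hle
    _ = 2 * mass v z + 2 * mass w z := by
        rw [MeasureTheory.integral_add (i1.const_mul 2) (i2.const_mul 2),
          MeasureTheory.integral_const_mul, MeasureTheory.integral_const_mul]
        rfl
    _ ≤ _ := by linarith

theorem SqBounded.cconj {v : Amp} {M : ℝ × ℝ → ℝ} (h : SqBounded D v M) :
    SqBounded D (cconj v) M := by
  simpa [SqBounded, mass, WKB.cconj] using h

/-- Multiplication by a function that is bounded on each line. -/
theorem SqBounded.sup_mul (hD : IsOpen D) {c v : Amp} (hc : SmoothAmp D c) (hv : SmoothAmp D v)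
    {B M M' : ℝ × ℝ → ℝ}
    (hB : ∃ C : ℝ, 0 ≤ C ∧ ∀ z ∈ D, ∀ x, ‖c (linePoint z x)‖ ^ 2 ≤ C * B z)
    (h : SqBounded D v M) (hM : ∀ z ∈ D, B z * M z ≤ M' z) : SqBounded D (c * v) M' := by
  obtain ⟨C, hC, h⟩ := h
  obtain ⟨C', hC', hB⟩ := hB
  refine ⟨C' * C, by positivity, fun z hz => ?_⟩
  obtain ⟨i1, m1⟩ := h z hz
  have hB0 : 0 ≤ C' * B z := (sq_nonneg _).trans (hB z hz 0)
  have hle : ∀ x, ‖(c * v) (linePoint z x)‖ ^ 2 ≤ C' * B z * ‖v (linePoint z x)‖ ^ 2 := by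
    intro x
    rw [Pi.mul_apply, norm_mul, mul_pow]
    exact mul_le_mul_of_nonneg_right (hB z hz x) (by positivity)
  have hi := i1.const_mul (C' * B z)
  have hint : MeasureTheory.Integrable fun x => ‖(c * v) (linePoint z x)‖ ^ 2 := by
    refine hi.mono' ((continuous_linePoint hD (hc.mul hv) hz).norm.pow 2).aestronglyMeasurable ?_
    refine Filter.Eventually.of_forall fun x => ?_
    rw [Real.norm_of_nonneg (by positivity)]
    exact hle x
  refine ⟨hint, ?_⟩
  calc mass (c * v) z ≤ ∫ x, C' * B z * ‖v (linePoint z x)‖ ^ 2 :=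
        MeasureTheory.integral_mono hint hi hle
    _ = C' * B z * mass v z := MeasureTheory.integral_const_mul _ _
    _ ≤ C' * B z * (C * M z) := by gcongr
    _ = C' * C * (B z * M z) := by ring
    _ ≤ _ := by gcongr; exact hM z hz

/-- The square of the admissible size of an amplitude with singularities of order `e`. -/
noncomputable abbrev resWeight (P : Driver) (N e : ℕ) (z : ℝ × ℝ) : ℝ :=
  1 / resDist P N z ^ (2 * e)

theorem resWeight_mul (P : Driver) (N e e' : ℕ) (z : ℝ × ℝ) :
    resWeight P N e z * resWeight P N e' z = resWeight P N (e + e') z := by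
  simp only [resWeight]
  rw [mul_add, pow_add, one_div_mul_one_div]

theorem resWeight_zero (P : Driver) (N : ℕ) (z : ℝ × ℝ) : resWeight P N 0 z = 1 := by
  simp [resWeight]

theorem resWeight_nonneg (hρ : ∀ z ∈ D, 0 < resDist P N z) (e : ℕ) {z : ℝ × ℝ} (hz : z ∈ D) :
    0 ≤ resWeight P N e z := by
  have := hρ z hz; positivity

theorem resWeight_mono (hρ : ∀ z ∈ D, 0 < resDist P N z) {e e' : ℕ} (h : e ≤ e') {z : ℝ × ℝ}
    (hz : z ∈ D) : resWeight P N e z ≤ resWeight P N e' z :=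
  div_pow_mono (hρ z hz) (resDist_le_one P N z) zero_le_one (by omega)

theorem SingularOrder.sq_bound (hρ : ∀ z ∈ D, 0 < resDist P N z) {r : ℕ} {v : Amp}
    (h : SingularOrder P N D r v) (l : List (Fin 4)) :
    ∃ C : ℝ, 0 ≤ C ∧ ∀ z ∈ D, ∀ x,
      ‖pds l v (linePoint z x)‖ ^ 2 ≤ C * resWeight P N (r + slowCount l) z := by
  obtain ⟨C, hC, h⟩ := h.nonneg_bound hρ l
  refine ⟨C ^ 2, by positivity, fun z hz x => ?_⟩
  calc _ ≤ (C * (1 / resDist P N z ^ (r + slowCount l))) ^ 2 :=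
        pow_le_pow_left₀ (norm_nonneg _) (h _ (linePoint_mem hz x)) 2
    _ = _ := by rw [mul_pow, div_pow, one_pow, ← pow_mul, mul_comm _ 2]

/-- Products with a function with singularities of known order. -/
theorem SqBounded.singular_mul (hD : IsOpen D) (hρ : ∀ z ∈ D, 0 < resDist P N z) {r e : ℕ}
    {c v : Amp} (hc : SmoothAmp D c) (h : SingularOrder P N D r c) (l : List (Fin 4))
    (hv : SmoothAmp D v) (h' : SqBounded D v (resWeight P N e)) {e' : ℕ}
    (he : r + slowCount l + e = e') :
    SqBounded D (pds l c * v) (resWeight P N e') :=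
  SqBounded.sup_mul hD (hc.pds hD l) hv (h.sq_bound hρ l) h' fun z _ => by
    rw [resWeight_mul, he]

/-- Smooth amplitudes with singularities of order at most `r`, with respect to the supremum and
the mass on the lines. -/
structure Localized (P : Driver) (N : ℕ) (D : Set (ℝ × ℝ)) (r : ℕ) (v : Amp) : Prop where
  smooth : SmoothAmp D v
  sing : SingularOrder P N D r v
  sq : ∀ l, SqBounded D (pds l v) (resWeight P N (r + slowCount l))

theorem sqBounded_pds_mul (hD : IsOpen D) {v w : Amp} (hv : SmoothAmp D v) (hw : SmoothAmp D w)
    (l : List (Fin 4)) {M : ℝ × ℝ → ℝ}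
    (h : ∀ a b, Split l a b → SqBounded D (pds a v * pds b w) M) :
    SqBounded D (pds l (v * w)) M :=
  leibniz_induction hD hv hw l (fun f => SqBounded D f M)
    (fun _ _ hf hg h h' => h.add hD hf hg h') (fun _ _ _ e h => h.congr e) h

theorem Localized.singular_mul (hD : IsOpen D) (hρ : ∀ z ∈ D, 0 < resDist P N z) {r s : ℕ}
    {c v : Amp} (hc : SmoothAmp D c) (h : SingularOrder P N D s c) (hv : Localized P N D r v) :
    Localized P N D (s + r) (c * v) where
  smooth := hc.mul hv.smooth
  sing := h.mul hρ hD hc hv.smooth hv.sing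
  sq l := sqBounded_pds_mul hD hc hv.smooth l fun a b hab =>
    SqBounded.singular_mul hD hρ hc h a (hv.smooth.pds hD b) (hv.sq b) (by
      rw [← hab.slowCount]; omega)

theorem ampClass_localized (hD : IsOpen D) (hρ : ∀ z ∈ D, 0 < resDist P N z) :
    AmpClass P N D (Localized P N D) where
  smooth h := h.smooth
  congr h e := ⟨h.smooth.congr_amp e, h.sing.congr hD e,
    fun l => (h.sq l).congr (pds_congr hD e l)⟩
  zero r := ⟨contDiffOn_const, singularOrder_zero r,
    fun l => by rw [pds_zero]; exact sqBounded_zero _⟩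
  add h h' := ⟨h.smooth.add h'.smooth, h.sing.add hD h.smooth h'.smooth h'.sing, fun l =>
    ((h.sq l).add hD (h.smooth.pds hD l) (h'.smooth.pds hD l) (h'.sq l)).congr
      (pds_add hD h.smooth h'.smooth l).symm⟩
  mono h hr := ⟨h.smooth, h.sing.mono hρ hr, fun l => (h.sq l).mono fun z hz =>
    resWeight_mono hρ (by omega) hz⟩
  pd h i := ⟨h.smooth.pd hD i, h.sing.pd hD h.smooth i, fun l => by
    have := h.sq (l ++ [i])
    rw [slowCount_append, pds_append] at this
    rw [add_assoc, add_comm (slowCount [i])]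
    exact this⟩
  coef hc h := h.singular_mul hD hρ hc.smooth hc.sing
  mul h h' := h'.singular_mul hD hρ h.smooth h.sing
  conj h := ⟨h.smooth.cconj, h.sing.cconj hD h.smooth, fun l =>
    (h.sq l).cconj.congr (pds_cconj hD h.smooth l).symm⟩

/-- Bounds for the masses of all derivatives are bounds for the derivatives. -/
theorem Localized.of_sq (hom : P.om ^ 2 = P.k ^ 2 + 1) (hD : IsOpen D)
    (hρ : ∀ z ∈ D, 0 < resDist P N z) {v : Amp} (hv : SmoothAmp D v)
    (hz : DependsOnZeta P D v) (hdec : LocallyDecaying P D v) {r : ℕ}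
    (hsq : ∀ l, SqBounded D (pds l v) (resWeight P N (r + slowCount l))) :
    Localized P N D r v := by
  refine ⟨hv, fun l => ?_, hsq⟩
  have hzl : DependsOnZeta P D (pds l v) := by
    induction l with
    | nil => exact hz
    | cons i l ih => exact ih.pd hD i
  obtain ⟨C, hC, h⟩ := hsq l
  -- The additional derivative in Sobolev's inequality is a fast one, so it costs no power of `ρ`.
  obtain ⟨C', hC', h'⟩ := hsq (0 :: l)
  refine ⟨Real.sqrt (C' + C), fun y hy => ?_⟩
  have hom0 : P.om ≠ 0 := by rintro h; rw [h] at hom; nlinarith [sq_nonneg P.k]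
  -- Dependence on `ζ` carries every point to one with `t₁ = 0`, where the line integrals are taken.
  have e : pds l v y = pds l v (linePoint (slow y) (zeta P y / P.om)) := by
    refine hzl y hy _ (linePoint_mem hy _) rfl ?_
    rw [zeta_linePoint, mul_div_cancel₀ _ hom0]
  have h1 := sq_norm_le_mass hom hD (hv.pds hD l) (hdec.pds l) hy (zeta P y / P.om) one_pos
  have h2 := (h _ hy).2
  have h3 := (h' _ hy).2
  rw [pds_cons, show slowCount (0 :: l) = slowCount l by rw [slowCount_cons]; simp [slowCount]]
    at h3
  have hρy := hρ _ hy
  rw [e]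
  refine le_of_sq_le_sq ?_ (by positivity)
  rw [div_pow, Real.sq_sqrt (by positivity), ← pow_mul, mul_comm _ 2]
  refine h1.trans ?_
  rw [inv_one, one_mul, one_mul, div_eq_mul_one_div, add_mul]
  exact add_le_add h3 h2

end Propagation

end WKB

namespace WKB

/-! ### Schrödinger equations along the group lines -/

section Schrodinger

variable {P : Driver} {N : ℕ} {D : Set (ℝ × ℝ)}

/-- Differentiation of a Schrödinger equation. -/
theorem pds_schrodinger (hD : IsOpen D) {a c X : Amp} (ha : SmoothAmp D a) (hc : SmoothAmp D c)
    (hX : SmoothAmp D X)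
    (heq : ∀ y ∈ dom D, 2 * Complex.I * ((P.om : ℂ) * pd 3 a y - (P.k : ℂ) * pd 2 a y)
      - (P.om : ℂ)⁻¹ ^ 2 * pd 0 (pd 0 a) y + c y * a y + X y = 0) (l : List (Fin 4)) :
    ∀ y ∈ dom D, 2 * Complex.I * ((P.om : ℂ) * pd 3 (pds l a) y - (P.k : ℂ) * pd 2 (pds l a) y)
      - (P.om : ℂ)⁻¹ ^ 2 * pd 0 (pd 0 (pds l a)) y + c y * pds l a y
      + (pds l X + (pds l (c * a) - c * pds l a)) y = 0 := by
  intro y hy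
  have s3 : SmoothAmp D (fun y => 2 * Complex.I * (P.om : ℂ) * pd 3 a y) :=
    contDiffOn_const.mul (ha.pd hD 3)
  have s2 : SmoothAmp D (fun y => -(2 * Complex.I * (P.k : ℂ)) * pd 2 a y) :=
    contDiffOn_const.mul (ha.pd hD 2)
  have s0 : SmoothAmp D (fun y => -(P.om : ℂ)⁻¹ ^ 2 * pd 0 (pd 0 a) y) :=
    contDiffOn_const.mul ((ha.pd hD 0).pd hD 0)
  have h1 : Set.EqOn ((fun y => 2 * Complex.I * (P.om : ℂ) * pd 3 a y)
      + (fun y => -(2 * Complex.I * (P.k : ℂ)) * pd 2 a y)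
      + (fun y => -(P.om : ℂ)⁻¹ ^ 2 * pd 0 (pd 0 a) y) + c * a + X) 0 (dom D) := fun y hy => by
    simp only [Pi.add_apply, Pi.mul_apply, Pi.zero_apply]
    linear_combination heq y hy
  have h2 := pds_eqOn_zero hD h1 l hy
  rw [pds_add hD (((s3.add s2).add s0).add (hc.mul ha)) hX l hy, Pi.add_apply,
    pds_add hD ((s3.add s2).add s0) (hc.mul ha) l hy, Pi.add_apply,
    pds_add hD (s3.add s2) s0 l hy, Pi.add_apply, pds_add hD s3 s2 l hy, Pi.add_apply,
    pds_const_mul hD (ha.pd hD 3) _ l hy, pds_const_mul hD (ha.pd hD 2) _ l hy,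
    pds_const_mul hD ((ha.pd hD 0).pd hD 0) _ l hy] at h2
  beta_reduce at h2
  rw [pd_pds_comm hD ha 3 l hy, pd_pds_comm hD ha 2 l hy,
    pd_pds_comm hD (ha.pd hD 0) 0 l hy, pd_congr hD (pd_pds_comm hD ha 0 l) 0 hy] at h2
  simp only [Pi.add_apply, Pi.sub_apply, Pi.mul_apply, Pi.zero_apply] at h2 ⊢
  linear_combination h2

theorem fast_of_slowCount_eq_zero {i : Fin 4} (h : slowCount [i] = 0) : i = 0 ∨ i = 1 := by
  revert h
  fin_cases i <;> simp [slowCount]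

/-- The fast derivatives of functions of the slow variables vanish. -/
theorem pds_eqOn_zero_of_slow (hD : IsOpen D) {c : Amp} (hc : SmoothAmp D c)
    (hs : ∀ y ∈ dom D, ∀ y' ∈ dom D, slow y = slow y' → c y = c y') {l : List (Fin 4)}
    (hl : l ≠ []) (h0 : slowCount l = 0) : Set.EqOn (pds l c) 0 (dom D) := by
  obtain ⟨i, t, rfl⟩ := List.exists_cons_of_ne_nil hl
  rw [slowCount_cons] at h0
  rw [pds_cons]
  exact (pd_pds_comm hD hc i t).symm.trans (pds_eqOn_zero hD
    (pd_eq_zero_of_slow hD hs hc (fast_of_slowCount_eq_zero (by omega))) t)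

/-- One power of decay in `ζ` suffices, since `|x₁| ≤ |ζ|` at `t₁ = 0` and `(1 + x²)⁻¹` is
integrable with integral `π`. -/
theorem mass_data (hom : P.om ^ 2 = P.k ^ 2 + 1) {D₀ : Set (ℝ × ℝ)} {r : ℕ} {a : Amp}
    (h : DecayingData P N D₀ r a) (hρ : ∀ z ∈ D₀, 0 < resDist P N z) (l : List (Fin 4)) :
    ∃ C : ℝ, ∀ z ∈ D₀, mass (pds l a) z ≤ C / resDist P N z ^ (2 * (r + slowCount l)) := by
  obtain ⟨C, hC⟩ := h 1 l
  refine ⟨C ^ 2 * Real.pi, fun z hz => ?_⟩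
  have hρz := hρ z hz
  set A := C / resDist P N z ^ (r + slowCount l) with hA
  have hle : ∀ x, ‖pds l a (linePoint z x)‖ ^ 2 ≤ A ^ 2 * (1 + x ^ 2)⁻¹ := by
    intro x
    have h1 := hC (linePoint z x) hz
    rw [zeta_linePoint, pow_one, slow_linePoint, ← hA] at h1
    have h2 : 1 + x ^ 2 ≤ (1 + |P.om * x|) ^ 2 := by
      have h3 : |x| ≤ |P.om * x| := by
        rw [abs_mul]; exact le_mul_of_one_le_left (abs_nonneg _) (one_le_abs_om hom)
      have h4 := abs_nonneg x
      nlinarith [sq_abs x]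
    rw [← div_eq_mul_inv, le_div_iff₀ (by positivity)]
    calc _ ≤ ‖pds l a (linePoint z x)‖ ^ 2 * (1 + |P.om * x|) ^ 2 := by gcongr
      _ = ((1 + |P.om * x|) * ‖pds l a (linePoint z x)‖) ^ 2 := by ring
      _ ≤ A ^ 2 := pow_le_pow_left₀ (by positivity) h1 2
  calc mass (pds l a) z ≤ ∫ x, A ^ 2 * (1 + x ^ 2)⁻¹ :=
        MeasureTheory.integral_mono_of_nonneg (Filter.Eventually.of_forall fun x => by positivity)
          (integrable_inv_one_add_sq.const_mul _) (Filter.Eventually.of_forall hle)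
    _ = A ^ 2 * Real.pi := by
        rw [MeasureTheory.integral_const_mul, integral_univ_inv_one_add_sq]
    _ = _ := by rw [hA, div_pow, ← pow_mul, mul_comm _ 2]; ring

/-- The common hypotheses on an amplitude that is to be controlled along the group lines. -/
structure Transported (P : Driver) (N : ℕ) (D D₀ : Set (ℝ × ℝ)) (r : ℕ) (a : Amp) : Prop where
  om_sq : P.om ^ 2 = P.k ^ 2 + 1
  isOpen : IsOpen D
  pos : ∀ z ∈ D, 0 < resDist P N z
  subset : D₀ ⊆ D
  trans : TransversalFrom P N D D₀
  smooth : SmoothAmp D a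
  dec : LocallyDecaying P D a
  data : DecayingData P N D₀ r a

/-- The energy estimate for the derivatives of a solution of a Schrödinger equation. The part `R`
of the source may have singularities of an order that is higher by one. -/
theorem Transported.sqBounded_pds {D₀ : Set (ℝ × ℝ)} {r : ℕ} {a : Amp}
    (h : Transported P N D D₀ r a) {q : (Fin 4 → ℝ) → ℝ} {X R : Amp}
    (hq : IsCoef P N D 1 (fun y => (q y : ℂ))) (hX : SmoothAmp D X) (hR : SmoothAmp D R)
    (heq : ∀ y ∈ dom D, 2 * Complex.I * ((P.om : ℂ) * pd 3 a y - (P.k : ℂ) * pd 2 a y)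
      - (P.om : ℂ)⁻¹ ^ 2 * pd 0 (pd 0 a) y + (q y : ℂ) * a y + (X + R) y = 0)
    (l : List (Fin 4))
    (hshort : ∀ b c, Split l b c → b ≠ [] →
      SqBounded D (pds c a) (resWeight P N (r + slowCount c)))
    (hY : SqBounded D (pds l X)
      (fun z => mass (pds l a) z + resWeight P N (r + slowCount l) z))
    (hRl : SqBounded D (pds l R) (resWeight P N (r + slowCount l + 1)))
    (hR0 : r + slowCount l = 0 → Set.EqOn (pds l R) 0 (dom D)) :
    SqBounded D (pds l a) (resWeight P N (r + slowCount l)) := by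
  have hD := h.isOpen
  have hρ := h.pos
  set w := pds l a with hw
  set c : Amp := fun y => (q y : ℂ) with hc
  set e := r + slowCount l with he
  set Y := pds l X with hYdef
  set Z₁ : Amp := pds l (c * a) - c * w with hZ₁def
  set Z : Amp := Z₁ + pds l R with hZdef
  have hws : SmoothAmp D w := h.smooth.pds hD l
  have hwd : LocallyDecaying P D w := h.dec.pds l
  -- The commutator of `∂^l` with the potential: `q` is itself of order one, and the remaining
  -- derivatives of `a` form strictly shorter lists. The total is one order more than that of `∂^l
  -- a`.
  have hZ₁ : SqBounded D Z₁ (resWeight P N (e + 1)) :=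
    leibniz_commutator_induction hD hq.smooth h.smooth l
      (fun f => SqBounded D f (resWeight P N (e + 1))) (sqBounded_zero _)
      (fun _ _ hf hg h h' => h.add hD hf hg h') (fun _ _ _ e h => h.congr e)
      fun b b' hb hne => SqBounded.singular_mul hD hρ hq.smooth hq.sing b (h.smooth.pds hD b')
        (hshort b b' hb hne) (by have := hb.slowCount; omega)
  -- For `e = 0` integration along the group lines would give a logarithm instead of a regained
  -- power. But then all derivatives are fast, and those of `q` vanish.
  have hZ₁0 : e = 0 → Set.EqOn Z₁ 0 (dom D) := fun he0 =>
    leibniz_commutator_induction hD hq.smooth h.smooth l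
      (fun f => Set.EqOn f 0 (dom D)) (fun _ _ => rfl)
      (fun f g _ _ h h' y hy => by rw [Pi.add_apply, h hy, h' hy]; simp)
      (fun f g _ e h => e.symm.trans h)
      fun b b' hb hne y hy => by
        have h0 : slowCount b = 0 := by have := hb.slowCount; omega
        rw [Pi.mul_apply, pds_eqOn_zero_of_slow hD hq.smooth hq.slow hne h0 hy]
        simp
  have sZ₁ : SmoothAmp D Z₁ :=
    ContDiffOn.sub ((hq.smooth.mul h.smooth).pds hD l) (hq.smooth.mul hws)
  have hZ : SqBounded D Z (resWeight P N (e + 1)) := hZ₁.add hD sZ₁ (hR.pds hD l) hRl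
  have hZ0 : e = 0 → Set.EqOn Z 0 (dom D) := fun he0 y hy => by
    rw [hZdef, Pi.add_apply, hZ₁0 he0 hy, hR0 he0 hy]; simp
  have heq' : ∀ y ∈ dom D, 2 * Complex.I * ((P.om : ℂ) * pd 3 w y - (P.k : ℂ) * pd 2 w y)
      - (P.om : ℂ)⁻¹ ^ 2 * pd 0 (pd 0 w) y + (q y : ℂ) * w y + (Y + Z) y = 0 := fun y hy => by
    have h1 := pds_schrodinger (c := c) hD h.smooth hq.smooth (hX.add hR) heq l y hy
    rw [Pi.add_apply, pds_add hD hX hR l hy, Pi.add_apply] at h1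
    simp only [hZdef, Pi.add_apply]
    linear_combination h1
  obtain ⟨CY, hCY, hY⟩ := hY
  obtain ⟨CZ, hCZ, hZ⟩ := hZ
  have hderiv : ∃ C : ℝ, 0 ≤ C ∧ ∀ z ∈ D, ∀ lam : ℝ, 0 < lam → |massDeriv P w z|
      ≤ C * mass w z + C / resDist P N z ^ (2 * e)
        + e * (lam * mass w z + C / (lam * resDist P N z ^ (2 * e + 2))) := by
    refine ⟨1 + CY + CZ, by positivity, fun z hz lam hlam => ?_⟩
    obtain ⟨iY, mY⟩ := hY z hz
    obtain ⟨iZ, mZ⟩ := hZ z hz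
    have iw := hwd.integrable_sq h.om_sq hD hws hz
    have hρz := hρ z hz
    have i1 := iw.add iY
    have i2 := ((iw.const_mul lam).add (iZ.const_mul lam⁻¹)).const_mul (e : ℝ)
    have hle : ∀ x, ‖w (linePoint z x)‖ * ‖(Y + Z) (linePoint z x)‖
        ≤ (‖w (linePoint z x)‖ ^ 2 + ‖Y (linePoint z x)‖ ^ 2)
          + e * (lam * ‖w (linePoint z x)‖ ^ 2 + lam⁻¹ * ‖Z (linePoint z x)‖ ^ 2) := by
      intro x
      set p := ‖w (linePoint z x)‖
      set p' := ‖Y (linePoint z x)‖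
      set p'' := ‖Z (linePoint z x)‖ with hp''
      have hp : 0 ≤ p := norm_nonneg _
      have hp0 : 0 ≤ p'' := norm_nonneg _
      have e1 : p * ‖(Y + Z) (linePoint z x)‖ ≤ p * (p' + p'') :=
        mul_le_mul_of_nonneg_left (norm_add_le _ _) hp
      -- The factor `e` may be inserted because `Z` vanishes for `e = 0`. It keeps the singular
      -- growth below the gain `2 e` from the weight.
      have e2 : p * p'' ≤ e * (lam * p ^ 2 + lam⁻¹ * p'' ^ 2) := by
        rcases Nat.eq_zero_or_pos e with he0 | he0
        · rw [hp'', hZ0 he0 (linePoint_mem hz x), he0]; simp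
        · have e3 : (1 : ℝ) ≤ e := by exact_mod_cast he0
          have e4 : 0 ≤ lam * p ^ 2 + lam⁻¹ * p'' ^ 2 := by positivity
          have e5 : 0 ≤ lam⁻¹ * (lam * p - p'') ^ 2 := by positivity
          have e6 : lam⁻¹ * (lam * p - p'') ^ 2
              = lam * p ^ 2 + lam⁻¹ * p'' ^ 2 - 2 * (p * p'') := by field_simp; ring
          have e7 := mul_nonneg hp hp0
          nlinarith
      nlinarith [sq_nonneg (p - p'), sq_nonneg p, sq_nonneg p']
    refine (abs_massDeriv_le h.om_sq hD hws hwd heq' hz (i1.add i2) hle).trans ?_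
    have eint : ∫ x, ((fun x => ‖w (linePoint z x)‖ ^ 2) + fun x => ‖Y (linePoint z x)‖ ^ 2) x
          + e * ((fun x => lam * ‖w (linePoint z x)‖ ^ 2)
            + fun x => lam⁻¹ * ‖Z (linePoint z x)‖ ^ 2) x
        = (mass w z + mass Y z) + e * (lam * mass w z + lam⁻¹ * mass Z z) := by
      rw [MeasureTheory.integral_add i1 i2, MeasureTheory.integral_const_mul]
      simp only [Pi.add_apply]
      rw [MeasureTheory.integral_add iw iY,
        MeasureTheory.integral_add (iw.const_mul lam) (iZ.const_mul lam⁻¹),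
        MeasureTheory.integral_const_mul, MeasureTheory.integral_const_mul]
      rfl
    refine (le_of_eq eint).trans ?_
    have hm := mass_nonneg w z
    have hR : 0 ≤ 1 / resDist P N z ^ (2 * e) := by positivity
    have e1 : mass w z + mass Y z
        ≤ (1 + CY + CZ) * mass w z + (1 + CY + CZ) / resDist P N z ^ (2 * e) := by
      rw [div_eq_mul_one_div (1 + CY + CZ)]
      simp only [resWeight] at mY
      nlinarith [mul_nonneg hCZ hm, mul_nonneg hCZ hR]
    have e2 : lam⁻¹ * mass Z z ≤ (1 + CY + CZ) / (lam * resDist P N z ^ (2 * e + 2)) := by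
      calc lam⁻¹ * mass Z z ≤ lam⁻¹ * (CZ * resWeight P N (e + 1) z) := by gcongr
        _ = CZ / (lam * resDist P N z ^ (2 * e + 2)) := by
          simp only [resWeight, show 2 * (e + 1) = 2 * e + 2 by ring]; field_simp
        _ ≤ _ := by gcongr; linarith
    gcongr
  obtain ⟨C, hC, hle⟩ := exists_mass_le h.om_sq hD hρ h.subset h.trans hws hwd hderiv
    (mass_data h.om_sq h.data (fun z hz => hρ z (h.subset hz)) l)
  exact ⟨C, hC, fun z hz => ⟨hwd.integrable_sq h.om_sq hD hws hz, hle z hz⟩⟩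

/-- Terms that are linear in `a` with localized coefficients. -/
theorem Transported.sqBounded_pds_mul {D₀ : Set (ℝ × ℝ)} {r : ℕ} {a a' V : Amp}
    (h : Transported P N D D₀ r a) (ha' : SmoothAmp D a')
    (haa' : ∀ l : List (Fin 4), ∀ y ∈ dom D, ‖pds l a' y‖ = ‖pds l a y‖)
    (hV : SmoothAmp D V) (hVs : SingularOrder P N D 0 V) (l : List (Fin 4))
    (hshort : ∀ b c, Split l b c → b ≠ [] →
      SqBounded D (pds c a) (resWeight P N (r + slowCount c))) :
    SqBounded D (pds l (V * a'))
      (fun z => mass (pds l a) z + resWeight P N (r + slowCount l) z) := by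
  have hD := h.isOpen
  have hρ := h.pos
  have hcopy : ∀ c M, SqBounded D (pds c a) M → SqBounded D (pds c a') M := by
    rintro c M ⟨C, hC, h1⟩
    refine ⟨C, hC, fun z hz => ?_⟩
    have e : (fun x => ‖pds c a' (linePoint z x)‖ ^ 2)
        = fun x => ‖pds c a (linePoint z x)‖ ^ 2 :=
      funext fun x => by rw [haa' c _ (linePoint_mem hz x)]
    rw [mass, e]
    exact h1 z hz
  refine WKB.sqBounded_pds_mul hD hV ha' l fun b c hbc => ?_
  -- The term with all derivatives on `a'` cannot be bounded yet; it is dominated by the mass of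
  -- `∂^l a` and left to the growth estimate. All other terms have shorter lists.
  by_cases hb : b = []
  · subst hb
    rw [hbc.eq_of_left_nil]
    have h0 : SqBounded D (pds l a) (mass (pds l a)) := ⟨1, zero_le_one, fun z hz =>
      ⟨(h.dec.pds l).integrable_sq h.om_sq hD (h.smooth.pds hD l) hz, by rw [one_mul]⟩⟩
    refine SqBounded.sup_mul hD hV (ha'.pds hD l) (B := fun _ => 1) ?_ (hcopy _ _ h0) ?_
    · simpa [resWeight, slowCount] using hVs.sq_bound hρ []
    · intro z hz
      rw [one_mul]
      exact le_add_of_nonneg_right (resWeight_nonneg hρ _ hz)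
  · refine (SqBounded.singular_mul hD hρ hV hVs b (ha'.pds hD c)
      (hcopy _ _ (hshort b c hbc hb)) (e' := r + slowCount l) ?_).mono fun z _ =>
        le_add_of_nonneg_left (mass_nonneg _ _)
    rw [← hbc.slowCount]; omega

/-- Solutions of the linearized equation. -/
theorem Transported.localized_linear {D₀ : Set (ℝ × ℝ)} {r : ℕ} (hr : 1 ≤ r)
    {a V W R : Amp} (h : Transported P N D D₀ r a) (hz : DependsOnZeta P D a) {q : (Fin 4 → ℝ) → ℝ}
    (hq : IsCoef P N D 1 (fun y => (q y : ℂ))) (hV : Localized P N D 0 V)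
    (hW : Localized P N D 0 W) (hR : Localized P N D (r + 1) R)
    (heq : ∀ y ∈ dom D, 2 * Complex.I * ((P.om : ℂ) * pd 3 a y - (P.k : ℂ) * pd 2 a y)
      - (P.om : ℂ)⁻¹ ^ 2 * pd 0 (pd 0 a) y + (q y : ℂ) * a y
      + (V * a + W * cconj a + R) y = 0) : Localized P N D r a := by
  have hD := h.isOpen
  have hρ := h.pos
  refine Localized.of_sq h.om_sq hD hρ h.smooth hz h.dec fun l => ?_
  induction hn : l.length using Nat.strong_induction_on generalizing l with
  | _ n ih =>
    have s1 := hV.smooth.mul h.smooth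
    have s2 := hW.smooth.mul h.smooth.cconj
    have hshort : ∀ b c, Split l b c → b ≠ [] →
        SqBounded D (pds c a) (resWeight P N (r + slowCount c)) := by
      intro b c hbc hb
      have h1 := hbc.length
      have h2 := List.length_pos_iff.2 hb
      exact ih c.length (by omega) c rfl
    have t1 := h.sqBounded_pds_mul h.smooth (fun _ _ _ => rfl) hV.smooth hV.sing l hshort
    have t2 := h.sqBounded_pds_mul h.smooth.cconj (fun l y hy => by
      rw [pds_cconj hD h.smooth l hy]; simp [cconj]) hW.smooth hW.sing l hshort
    refine h.sqBounded_pds hq (s1.add s2) hR.smooth heq l hshort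
      ((t1.add hD (s1.pds hD l) (s2.pds hD l) t2).congr (pds_add hD s1 s2 l).symm) ?_
      fun h0 => by omega
    -- The source may be one order worse than the solution: this is what transversality pays for. As
    -- `r ≥ 1`, the logarithmic case does not arise.
    rw [show r + slowCount l + 1 = r + 1 + slowCount l by omega]
    exact hR.sq l

end Schrodinger

end WKB

namespace WKB

/-! ### The nonlinear Schrödinger equation -/

section Nonlinear

variable {P : Driver} {N : ℕ} {D : Set (ℝ × ℝ)}

theorem groupPd_mul (hD : IsOpen D) {v w : Amp} (hv : SmoothAmp D v) (hw : SmoothAmp D w) :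
    Set.EqOn (groupPd P (v * w)) (groupPd P v * w + v * groupPd P w) (dom D) := fun y hy => by
  simp only [groupPd, pd_mul hD hv hw 3 hy, pd_mul hD hv hw 2 hy, Pi.add_apply, Pi.mul_apply]
  ring

theorem groupPd_cconj (hD : IsOpen D) {v : Amp} (hv : SmoothAmp D v) :
    Set.EqOn (groupPd P (cconj v)) (cconj (groupPd P v)) (dom D) := fun y hy => by
  simp only [groupPd, pd_cconj hD hv 3 hy, pd_cconj hD hv 2 hy]
  simp [cconj, groupPd]

theorem pd_groupPd (hD : IsOpen D) {v : Amp} (hv : SmoothAmp D v) (i : Fin 4) :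
    Set.EqOn (pd i (groupPd P v)) (groupPd P (pd i v)) (dom D) := fun y hy => by
  have h2 : SmoothAmp D (fun y => (-((P.k / P.om : ℝ) : ℂ)) * pd 2 v y) :=
    contDiffOn_const.mul (hv.pd hD 2)
  have h1 : Set.EqOn (groupPd P v) (pd 3 v + fun y => (-((P.k / P.om : ℝ) : ℂ)) * pd 2 v y)
      (dom D) := fun y _ => by simp only [groupPd, Pi.add_apply]; ring
  rw [pd_congr hD h1 i hy, pd_add hD (hv.pd hD 3) h2 i hy, Pi.add_apply,
    pd_const_mul hD (hv.pd hD 2) _ i hy]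
  simp only [groupPd]
  rw [pd_comm hD hv i 3 hy, pd_comm hD hv i 2 hy]
  ring

/-- The squares of the values of `v` on the lines are at most a multiple of `M`. -/
def LineBounded (D : Set (ℝ × ℝ)) (v : Amp) (M : ℝ × ℝ → ℝ) : Prop :=
  ∃ C : ℝ, 0 ≤ C ∧ ∀ z ∈ D, ∀ x, ‖v (linePoint z x)‖ ^ 2 ≤ C * M z

theorem SqBounded.of_norm_eq {v w : Amp} {M : ℝ × ℝ → ℝ} (h : SqBounded D v M)
    (hvw : ∀ y ∈ dom D, ‖w y‖ = ‖v y‖) : SqBounded D w M := by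
  obtain ⟨C, hC, h⟩ := h
  refine ⟨C, hC, fun z hz => ?_⟩
  have e : (fun x => ‖w (linePoint z x)‖ ^ 2) = fun x => ‖v (linePoint z x)‖ ^ 2 :=
    funext fun x => by rw [hvw _ (linePoint_mem hz x)]
  rw [mass, e]
  exact h z hz

theorem SqBounded.const_mul (hD : IsOpen D) {v : Amp} (hv : SmoothAmp D v) {M : ℝ × ℝ → ℝ}
    (h : SqBounded D v M) (c : ℂ) : SqBounded D (fun y => c * v y) M :=
  SqBounded.sup_mul (B := fun _ => 1) hD (smoothAmp_const c) hv
    ⟨‖c‖ ^ 2, by positivity, fun z _ x => by simp⟩ h fun z _ => by rw [one_mul]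

theorem SqBounded.triple (hD : IsOpen D) {f₁ f₂ f₃ : Amp} (s₁ : SmoothAmp D f₁)
    (s₂ : SmoothAmp D f₂) (s₃ : SmoothAmp D f₃) {B₁ B₂ M M' : ℝ × ℝ → ℝ}
    (h₁ : LineBounded D f₁ B₁) (h₂ : LineBounded D f₂ B₂) (h₃ : SqBounded D f₃ M)
    (hM : ∀ z ∈ D, B₁ z * (B₂ z * M z) ≤ M' z) : SqBounded D (f₁ * f₂ * f₃) M' := by
  rw [mul_assoc]
  exact SqBounded.sup_mul hD s₁ (s₂.mul s₃) h₁
    (SqBounded.sup_mul hD s₂ s₃ h₂ h₃ fun z _ => le_rfl) hM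

/-- Leibniz' rule for the cubic term. -/
theorem sqBounded_pds_cubic (hD : IsOpen D) {a : Amp} (ha : SmoothAmp D a) (l : List (Fin 4))
    {M : ℝ × ℝ → ℝ}
    (h : ∀ b₁ b₂ b₃, slowCount b₁ + slowCount b₂ + slowCount b₃ = slowCount l →
      b₁.length + b₂.length + b₃.length = l.length →
      (b₁.length = l.length → b₁ = l) → (b₂.length = l.length → b₂ = l) →
      (b₃.length = l.length → b₃ = l) → SqBounded D (pds b₁ a * pds b₂ a * pds b₃ a) M) :
    SqBounded D (pds l (a * a * cconj a)) M := by
  refine sqBounded_pds_mul hD (ha.mul ha) ha.cconj l fun b b₃ hb => ?_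
  have s₃ : SmoothAmp D (pds b₃ (cconj a)) := ha.cconj.pds hD b₃
  refine leibniz_induction hD ha ha b (fun f => SqBounded D (f * pds b₃ (cconj a)) M) ?_ ?_ ?_
  · intro f g hf hg h1 h2
    rw [add_mul]
    exact h1.add hD (hf.mul s₃) (hg.mul s₃) h2
  · intro f g _ hfg h1
    exact h1.congr fun y hy => by rw [Pi.mul_apply, Pi.mul_apply, hfg hy]
  · intro b₁ b₂ hb'
    have n1 := hb.length
    have n2 := hb'.length
    have e1 := hb.slowCount
    have e2 := hb'.slowCount
    refine (h b₁ b₂ b₃ (by omega) (by omega) ?_ ?_ ?_).of_norm_eq fun y hy => ?_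
    · intro hl
      obtain rfl : b₂ = [] := List.length_eq_zero_iff.1 (by omega)
      obtain rfl : b₃ = [] := List.length_eq_zero_iff.1 (by omega)
      rw [hb'.symm.eq_of_left_nil, hb.symm.eq_of_left_nil]
    · intro hl
      obtain rfl : b₁ = [] := List.length_eq_zero_iff.1 (by omega)
      obtain rfl : b₃ = [] := List.length_eq_zero_iff.1 (by omega)
      rw [hb'.eq_of_left_nil, hb.symm.eq_of_left_nil]
    · intro hl
      obtain rfl : b = [] := List.length_eq_zero_iff.1 (by omega)
      exact hb.eq_of_left_nil
    · simp only [Pi.mul_apply, norm_mul]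
      rw [pds_cconj hD ha b₃ hy]
      simp [cconj]

variable {D₀ : Set (ℝ × ℝ)} {a : Amp}

theorem Transported.sqBounded_self {r : ℕ} (h : Transported P N D D₀ r a) (l : List (Fin 4)) :
    SqBounded D (pds l a) (mass (pds l a)) :=
  ⟨1, zero_le_one, fun z hz =>
    ⟨(h.dec.pds l).integrable_sq h.om_sq h.isOpen (h.smooth.pds h.isOpen l) hz, by rw [one_mul]⟩⟩

theorem Transported.lineBounded {r : ℕ} (h : Transported P N D D₀ r a) {b : List (Fin 4)}
    {M : ℝ × ℝ → ℝ} (h0 : SqBounded D (pds b a) M) (h1 : SqBounded D (pds (0 :: b) a) M) :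
    LineBounded D (pds b a) M := by
  obtain ⟨C, hC, h0⟩ := h0
  obtain ⟨C', hC', h1⟩ := h1
  refine ⟨C' + C, by positivity, fun z hz x => ?_⟩
  have h2 := sq_norm_le_mass h.om_sq h.isOpen (h.smooth.pds h.isOpen b) (h.dec.pds b) hz x one_pos
  rw [inv_one, one_mul, one_mul] at h2
  rw [add_mul]
  exact h2.trans (add_le_add (h1 z hz).2 (h0 z hz).2)

/-- The hypotheses on the leading amplitude. -/
structure SolvesNLS (P : Driver) (N : ℕ) (D D₀ : Set (ℝ × ℝ)) (q : (Fin 4 → ℝ) → ℝ) (a : Amp) :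
    Prop extends Transported P N D D₀ 0 a where
  zeta : DependsOnZeta P D a
  coef : IsCoef P N D 1 (fun y => (q y : ℂ))
  eq : ∀ y ∈ dom D, 2 * Complex.I * ((P.om : ℂ) * pd 3 a y - (P.k : ℂ) * pd 2 a y)
      - (P.om : ℂ)⁻¹ ^ 2 * pd 0 (pd 0 a) y + (q y : ℂ) * a y
      + 3 * (P.γ : ℂ) * (a * a * cconj a) y = 0

namespace SolvesNLS

variable {q : (Fin 4 → ℝ) → ℝ}

theorem om_ne_zero (h : SolvesNLS P N D D₀ q a) : (P.om : ℂ) ≠ 0 := by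
  have := one_le_abs_om h.om_sq
  simp only [ne_eq, Complex.ofReal_eq_zero]
  rintro h0
  rw [h0, abs_zero] at this
  linarith

/-- Conservation of the mass. -/
theorem massDeriv_eq_zero (h : SolvesNLS P N D D₀ q a) {z : ℝ × ℝ} (hz : z ∈ D) :
    massDeriv P a z = 0 := by
  have h1 := abs_massDeriv_le h.om_sq h.isOpen h.smooth h.dec (X := 0)
    -- The nonlinearity is counted as part of the real potential, and no source remains.
    (q := fun y => q y + 3 * P.γ * ‖a y‖ ^ 2) (fun y hy => by
      have e : ((‖a y‖ : ℝ) : ℂ) ^ 2 = a y * (starRingEnd ℂ) (a y) := by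
        rw [Complex.mul_conj, Complex.normSq_eq_norm_sq]; push_cast; ring
      have h2 := h.eq y hy
      simp only [Pi.mul_apply, cconj] at h2
      push_cast
      rw [e, Pi.zero_apply]
      linear_combination h2) hz (g := fun _ => 0) (MeasureTheory.integrable_zero _ _ _)
    (fun x => by simp)
  simpa using h1

theorem sqBounded_zero_order (h : SolvesNLS P N D D₀ q a) : SqBounded D a (resWeight P N 0) := by
  obtain ⟨C, hC, h1⟩ := exists_mass_le (r := 0) h.om_sq h.isOpen h.pos h.subset h.trans h.smooth
    h.dec ⟨0, le_rfl, fun z hz lam hlam => by rw [h.massDeriv_eq_zero hz]; simp⟩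
    (mass_data h.om_sq h.data (fun z hz => h.pos z (h.subset hz)) [])
  exact ⟨C, hC, fun z hz => ⟨h.dec.integrable_sq h.om_sq h.isOpen h.smooth hz, h1 z hz⟩⟩

/-- Conservation of the energy. -/
theorem energyDeriv_eq_zero (h : SolvesNLS P N D D₀ q a) {z : ℝ × ℝ} (hz : z ∈ D) :
    P.om⁻¹ ^ 2 * massDeriv P (pd 0 a) z + 3 / 2 * P.γ * massDeriv P (a * a) z = 0 := by
  have hD := h.isOpen
  have ha := h.smooth
  have ha0 := ha.pd hD 0
  have hb : SmoothAmp D (groupPd P a) := ha.groupPd hD P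
  have da := h.dec
  have da0 := da.pd 0
  have db := da.groupPd hD ha
  set A : Amp := cconj (pd 0 a) * groupPd P a with hA
  set B : Amp := pd 0 a * cconj (groupPd P a) with hB
  have sA : SmoothAmp D A := ha0.cconj.mul hb
  have sB : SmoothAmp D B := ha0.mul hb.cconj
  have dA : LocallyDecaying P D A := (da0.cconj hD ha0).mul hD ha0.cconj hb db
  have dB : LocallyDecaying P D B := da0.mul hD ha0 hb.cconj (db.cconj hD hb)
  set v : Amp := a * cconj a with hv
  set v0 : Amp := pd 0 a * cconj (pd 0 a) with hv0
  set v2 : Amp := (a * a) * cconj (a * a) with hv2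
  have sv : SmoothAmp D v := ha.mul ha.cconj
  have sv0 : SmoothAmp D v0 := ha0.mul ha0.cconj
  have sv2 : SmoothAmp D v2 := (ha.mul ha).mul (ha.mul ha).cconj
  have dv : LocallyDecaying P D v := da.mul_cconj hD ha
  have dv0 : LocallyDecaying P D v0 := da0.mul_cconj hD ha0
  have dv2 : LocallyDecaying P D v2 := (da.mul hD ha ha da).mul_cconj hD (ha.mul ha)
  -- On a line the potential is a constant `Q`, however large. The equation is paired with the group
  -- derivative of `a`, and the potential contributes only `Q` times the derivative of the mass,
  -- which is zero.
  set Q : ℝ := q (linePoint z 0) with hQ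
  have hpt : ∀ x, ((P.om⁻¹ ^ 2 : ℝ) : ℂ) * groupPd P v0 (linePoint z x)
      + ((3 / 2 * P.γ : ℝ) : ℂ) * groupPd P v2 (linePoint z x)
      = ((P.om⁻¹ ^ 2 : ℝ) : ℂ) * (pd 0 A (linePoint z x) + pd 0 B (linePoint z x))
        - (Q : ℂ) * groupPd P v (linePoint z x) := by
    intro x
    set y := linePoint z x with hy
    have hyD : y ∈ dom D := linePoint_mem hz x
    have hq : q y = Q := by
      have := h.coef.slow y hyD (linePoint z 0) (linePoint_mem hz 0) rfl
      exact_mod_cast this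
    have e0 : groupPd P v0 y = groupPd P (pd 0 a) y * (starRingEnd ℂ) (pd 0 a y)
        + pd 0 a y * (starRingEnd ℂ) (groupPd P (pd 0 a) y) := by
      rw [hv0, groupPd_mul hD ha0 ha0.cconj hyD, Pi.add_apply, Pi.mul_apply, Pi.mul_apply,
        groupPd_cconj hD ha0 hyD]
      rfl
    have e : groupPd P v y = groupPd P a y * (starRingEnd ℂ) (a y)
        + a y * (starRingEnd ℂ) (groupPd P a y) := by
      rw [hv, groupPd_mul hD ha ha.cconj hyD, Pi.add_apply, Pi.mul_apply, Pi.mul_apply,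
        groupPd_cconj hD ha hyD]
      rfl
    have e2 : groupPd P v2 y
        = 2 * a y * groupPd P a y * ((starRingEnd ℂ) (a y)) ^ 2
        + a y ^ 2 * (2 * (starRingEnd ℂ) (a y) * (starRingEnd ℂ) (groupPd P a y)) := by
      rw [hv2, groupPd_mul hD (ha.mul ha) (ha.mul ha).cconj hyD, Pi.add_apply, Pi.mul_apply,
        Pi.mul_apply, groupPd_cconj hD (ha.mul ha) hyD]
      simp only [cconj]
      rw [groupPd_mul hD ha ha hyD]
      simp only [Pi.add_apply, Pi.mul_apply, map_add, map_mul]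
      ring
    have eA : pd 0 A y = (starRingEnd ℂ) (pd 0 (pd 0 a) y) * groupPd P a y
        + (starRingEnd ℂ) (pd 0 a y) * groupPd P (pd 0 a) y := by
      rw [hA, pd_mul hD ha0.cconj hb 0 hyD, Pi.add_apply, Pi.mul_apply, Pi.mul_apply,
        pd_cconj hD ha0 0 hyD, pd_groupPd hD ha 0 hyD]
      rfl
    have eB : pd 0 B y = pd 0 (pd 0 a) y * (starRingEnd ℂ) (groupPd P a y)
        + pd 0 a y * (starRingEnd ℂ) (groupPd P (pd 0 a) y) := by
      rw [hB, pd_mul hD ha0 hb.cconj 0 hyD, Pi.add_apply, Pi.mul_apply, Pi.mul_apply,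
        pd_cconj hD hb 0 hyD]
      simp only [cconj]
      rw [pd_groupPd hD ha 0 hyD]
    have eq1 : (P.om : ℂ)⁻¹ ^ 2 * pd 0 (pd 0 a) y = 2 * Complex.I * (P.om : ℂ) * groupPd P a y
        + (Q : ℂ) * a y + 3 * (P.γ : ℂ) * (a y * a y * (starRingEnd ℂ) (a y)) := by
      have h1 := h.eq y hyD
      rw [hq] at h1
      have h2 : 2 * Complex.I * (P.om : ℂ) * groupPd P a y
          = 2 * Complex.I * ((P.om : ℂ) * pd 3 a y - (P.k : ℂ) * pd 2 a y) := by
        have := h.om_ne_zero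
        simp only [groupPd]; push_cast; field_simp
      rw [h2]
      simp only [Pi.mul_apply, cconj] at h1
      linear_combination -h1
    have eq2 := congrArg (starRingEnd ℂ) eq1
    simp only [map_mul, map_add, map_pow, map_inv₀, Complex.conj_ofReal, Complex.conj_I,
      map_ofNat, Complex.conj_conj] at eq2
    rw [e0, e, e2, eA, eB]
    push_cast
    linear_combination -(groupPd P a y) * eq2 - (starRingEnd ℂ) (groupPd P a y) * eq1
  have iv := (dv.groupPd hD sv).integrable h.om_sq hD (sv.groupPd hD P) hz
  have iv0 := (dv0.groupPd hD sv0).integrable h.om_sq hD (sv0.groupPd hD P) hz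
  have iv2 := (dv2.groupPd hD sv2).integrable h.om_sq hD (sv2.groupPd hD P) hz
  have iA := (dA.pd 0).integrable h.om_sq hD (sA.pd hD 0) hz
  have iB := (dB.pd 0).integrable h.om_sq hD (sB.pd hD 0) hz
  have hint := congrArg (fun f : ℝ → ℂ => ∫ x, f x) (funext hpt)
  have iAB : MeasureTheory.Integrable fun x =>
      ((P.om⁻¹ ^ 2 : ℝ) : ℂ) * (pd 0 A (linePoint z x) + pd 0 B (linePoint z x)) :=
    (iA.add iB).const_mul _
  beta_reduce at hint
  rw [MeasureTheory.integral_add (iv0.const_mul _) (iv2.const_mul _),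
    MeasureTheory.integral_sub iAB (iv.const_mul _), MeasureTheory.integral_const_mul,
    MeasureTheory.integral_const_mul, MeasureTheory.integral_const_mul,
    MeasureTheory.integral_const_mul, MeasureTheory.integral_add iA iB,
    integral_pd_zero h.om_sq hD sA dA hz, integral_pd_zero h.om_sq hD sB dB hz] at hint
  have hre := congrArg Complex.re hint
  have hm : (∫ x, groupPd P v (linePoint z x)).re = 0 := h.massDeriv_eq_zero hz
  simp only [Complex.add_re, Complex.re_ofReal_mul, add_zero, mul_zero, zero_sub, Complex.neg_re,
    hm, neg_zero] at hre
  exact hre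

/-- The quartic integral is at most the mass times the supremum of `|a|²`, and Sobolev's inequality
bounds the supremum. -/
theorem mass_sq_le (h : SolvesNLS P N D D₀ q a) {z : ℝ × ℝ} (hz : z ∈ D) {η : ℝ} (hη : 0 < η) :
    mass (a * a) z ≤ (η * mass (pd 0 a) z + η⁻¹ * mass a z) * mass a z := by
  have hi := h.dec.integrable_sq h.om_sq h.isOpen h.smooth hz
  rw [mass, mass.eq_1 a, ← MeasureTheory.integral_const_mul]
  refine MeasureTheory.integral_mono_of_nonneg (Filter.Eventually.of_forall fun x => by positivity)
    (hi.const_mul _) (Filter.Eventually.of_forall fun x => ?_)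
  simp only [Pi.mul_apply, norm_mul, mul_pow]
  exact mul_le_mul_of_nonneg_right
    (sq_norm_le_mass h.om_sq h.isOpen h.smooth h.dec hz x hη) (by positivity)

theorem energy_eq (h : SolvesNLS P N D D₀ q a) {z : ℝ × ℝ} {s₀ : ℝ}
    (hs : ∀ s ∈ Set.uIcc 0 s₀, z + s • groupDir P ∈ D) :
    P.om⁻¹ ^ 2 * mass (pd 0 a) z + 3 / 2 * P.γ * mass (a * a) z
      = P.om⁻¹ ^ 2 * mass (pd 0 a) (z + s₀ • groupDir P)
        + 3 / 2 * P.γ * mass (a * a) (z + s₀ • groupDir P) := by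
  have hD := h.isOpen
  have hd : ∀ s ∈ Set.uIcc 0 s₀, HasDerivWithinAt
      (fun s => P.om⁻¹ ^ 2 * mass (pd 0 a) (z + s • groupDir P)
        + 3 / 2 * P.γ * mass (a * a) (z + s • groupDir P)) 0 (Set.uIcc 0 s₀) s := by
    intro s hs'
    have h1 := hasDerivAt_mass h.om_sq hD (h.smooth.pd hD 0) (h.dec.pd 0) (hs s hs')
    have h2 := hasDerivAt_mass h.om_sq hD (h.smooth.mul h.smooth)
      (h.dec.mul hD h.smooth h.smooth h.dec) (hs s hs')
    have h3 := (h1.const_mul (P.om⁻¹ ^ 2)).add (h2.const_mul (3 / 2 * P.γ))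
    rw [h.energyDeriv_eq_zero (hs s hs')] at h3
    exact h3.hasDerivWithinAt
  have h1 := (convex_uIcc 0 s₀).norm_image_sub_le_of_norm_hasDerivWithin_le (C := 0) hd
    (fun _ _ => by simp) Set.left_mem_uIcc Set.right_mem_uIcc
  rw [zero_mul, norm_le_zero_iff, sub_eq_zero] at h1
  simpa using h1.symm

/-- The energy is conserved but indefinite if `γ < 0`. Since the mass is bounded, the quartic part
is at most half of the gradient part plus a constant, so the sign of `γ` does not matter. -/
theorem sqBounded_pd_zero (h : SolvesNLS P N D D₀ q a) :
    SqBounded D (pd 0 a) (resWeight P N 0) := by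
  have hD := h.isOpen
  obtain ⟨M, hM, hmass⟩ := h.sqBounded_zero_order
  obtain ⟨C, hC⟩ := mass_data h.om_sq h.data (fun z hz => h.pos z (h.subset hz)) [0]
  have hC' : ∀ z ∈ D₀, mass (pd 0 a) z ≤ C := by
    intro z hz
    simpa [slowCount] using hC z hz
  have hm : ∀ z ∈ D, mass a z ≤ M := by
    intro z hz
    simpa using (hmass z hz).2
  set κ : ℝ := P.om⁻¹ ^ 2 with hκ
  have hκ0 : 0 < κ := by
    have := h.om_ne_zero
    have : P.om ≠ 0 := by exact_mod_cast this
    positivity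
  set G : ℝ := 3 / 2 * |P.γ| with hG
  have hG0 : 0 ≤ G := by positivity
  -- Chosen such that `G η M ≤ κ / 2`; the `+ 1` avoids division by zero.
  set η : ℝ := κ / (2 * (G * M + 1)) with hη
  have hη0 : 0 < η := by positivity
  have hGη : G * (η * M) ≤ κ / 2 := by
    have : G * (η * M) = κ / 2 * ((G * M) / (G * M + 1)) := by rw [hη]; field_simp
    rw [this]
    exact mul_le_of_le_one_right (by positivity) (by
      rw [div_le_one (by positivity)]; linarith)
  have hsq : ∀ z ∈ D, G * mass (a * a) z ≤ κ / 2 * mass (pd 0 a) z + G * (η⁻¹ * M * M) := by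
    intro z hz
    have h1 := h.mass_sq_le hz hη0
    have m0 := mass_nonneg a z
    have m1 := mass_nonneg (pd 0 a) z
    have h2 : (η * mass (pd 0 a) z + η⁻¹ * mass a z) * mass a z
        ≤ (η * mass (pd 0 a) z + η⁻¹ * M) * M := by
      gcongr
      exacts [hm z hz, hm z hz]
    calc G * mass (a * a) z ≤ G * ((η * mass (pd 0 a) z + η⁻¹ * M) * M) := by
          gcongr; exact h1.trans h2
      _ = G * (η * M) * mass (pd 0 a) z + G * (η⁻¹ * M * M) := by ring
      _ ≤ _ := by gcongr
  obtain ⟨T, c, hc, htr⟩ := h.trans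
  have key : ∀ z ∈ D, mass (pd 0 a) z ≤ 2 * κ⁻¹ * (2 * κ * |C| + 2 * G * (η⁻¹ * M * M)) := by
    intro z hz
    obtain ⟨s₀, -, hz₀, hs⟩ := htr z hz
    have h1 := h.energy_eq (fun s hs' => (hs s hs').1)
    have hz₀D := h.subset hz₀
    have h2 := hsq z hz
    have h3 := hsq _ hz₀D
    have h4 := hC' _ hz₀
    have h5 : |3 / 2 * P.γ * mass (a * a) z| = G * mass (a * a) z := by
      rw [abs_mul, abs_mul, abs_of_nonneg (mass_nonneg _ _), abs_of_pos (by norm_num : (0:ℝ) < 3 / 2)]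
    have h6 : |3 / 2 * P.γ * mass (a * a) (z + s₀ • groupDir P)|
        = G * mass (a * a) (z + s₀ • groupDir P) := by
      rw [abs_mul, abs_mul, abs_of_nonneg (mass_nonneg _ _), abs_of_pos (by norm_num : (0:ℝ) < 3 / 2)]
    have h7 := neg_abs_le (3 / 2 * P.γ * mass (a * a) z)
    have h8 := le_abs_self (3 / 2 * P.γ * mass (a * a) (z + s₀ • groupDir P))
    have h9 : κ * mass (pd 0 a) (z + s₀ • groupDir P) ≤ κ * |C| :=
      mul_le_mul_of_nonneg_left (h4.trans (le_abs_self _)) hκ0.le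
    have h10 : κ / 2 * mass (pd 0 a) z ≤ 2 * κ * |C| + 2 * G * (η⁻¹ * M * M) := by
      have : 0 ≤ κ * |C| := by positivity
      linarith
    calc mass (pd 0 a) z = 2 * κ⁻¹ * (κ / 2 * mass (pd 0 a) z) := by field_simp
      _ ≤ _ := by gcongr
  refine ⟨2 * κ⁻¹ * (2 * κ * |C| + 2 * G * (η⁻¹ * M * M)), by positivity, fun z hz => ⟨?_, ?_⟩⟩
  · exact (h.dec.pd 0).integrable_sq h.om_sq hD (h.smooth.pd hD 0) hz
  · rw [resWeight_zero, mul_one]; exact key z hz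

/-- Derivatives in the fast variables reduce to derivatives in `x₁`. -/
theorem pds_fast (h : SolvesNLS P N D D₀ q a) (l : List (Fin 4)) (hl : slowCount l = 0) :
    ∃ c : ℂ, Set.EqOn (pds l a) (fun y => c * pds (List.replicate l.length 0) a y) (dom D) := by
  have hD := h.isOpen
  have hzeta : ∀ l : List (Fin 4), DependsOnZeta P D (pds l a) := by
    intro l
    induction l with
    | nil => exact h.zeta
    | cons i l ih => exact ih.pd hD i
  induction l with
  | nil => exact ⟨1, fun y _ => by simp⟩
  | cons i l ih =>
    rw [slowCount_cons] at hl
    obtain ⟨c, hc⟩ := ih (by omega)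
    have hs := h.smooth.pds hD (List.replicate l.length 0)
    have h1 := (pd_congr hD hc i).trans (pd_const_mul hD hs c i)
    rcases fast_of_slowCount_eq_zero (i := i) (by omega) with rfl | rfl
    · exact ⟨c, h1⟩
    · refine ⟨c * ((P.k : ℂ) * (P.om : ℂ)⁻¹), fun y hy => ?_⟩
      rw [pds_cons, h1 hy]
      beta_reduce
      rw [pd_one_eq h.om_sq hD hs (hzeta _) hy]
      simp only [List.length_cons, List.replicate_succ, pds_cons]
      ring

theorem sqBounded_fast_of_replicate (h : SolvesNLS P N D D₀ q a) {l : List (Fin 4)}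
    (hl : slowCount l = 0) {M : ℝ × ℝ → ℝ}
    (hM : SqBounded D (pds (List.replicate l.length 0) a) M) : SqBounded D (pds l a) M := by
  obtain ⟨c, hc⟩ := h.pds_fast l hl
  exact (hM.const_mul h.isOpen (h.smooth.pds h.isOpen _) c).congr hc.symm

/-- The energy estimate, if the cubic term is under control. -/
theorem sqBounded_step (h : SolvesNLS P N D D₀ q a) (l : List (Fin 4))
    (hshort : ∀ b : List (Fin 4), b.length < l.length → slowCount b ≤ slowCount l →
      SqBounded D (pds b a) (resWeight P N (slowCount b)))
    (htriple : ∀ b₁ b₂ b₃, slowCount b₁ + slowCount b₂ + slowCount b₃ = slowCount l →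
      b₁.length + b₂.length + b₃.length = l.length →
      (b₁.length = l.length → b₁ = l) → (b₂.length = l.length → b₂ = l) →
      (b₃.length = l.length → b₃ = l) → SqBounded D (pds b₁ a * pds b₂ a * pds b₃ a)
        (fun z => mass (pds l a) z + resWeight P N (slowCount l) z)) :
    SqBounded D (pds l a) (resWeight P N (slowCount l)) := by
  have hD := h.isOpen
  have sc : SmoothAmp D (a * a * cconj a) := (h.smooth.mul h.smooth).mul h.smooth.cconj
  have h1 := h.toTransported.sqBounded_pds h.coef (X := fun y => 3 * (P.γ : ℂ) * (a * a * cconj a) y)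
    (R := 0) (contDiffOn_const.mul sc) contDiffOn_const (by simpa using h.eq) l
  rw [zero_add] at h1
  refine h1 (fun b c hbc hb => ?_) ?_ (by rw [pds_zero]; exact sqBounded_zero _)
    fun _ => by rw [pds_zero]; exact fun _ _ => rfl
  · have e1 := hbc.length
    have e2 := hbc.slowCount
    have e3 := List.length_pos_iff.2 hb
    rw [zero_add]
    exact hshort c (by omega) (by omega)
  · exact ((sqBounded_pds_cubic hD h.smooth l htriple).const_mul hD (sc.pds hD l) _).congr
      (pds_const_mul hD sc _ l).symm

/-- Mass and energy give the first two cases. For `m ≥ 2` the cubic term is at most linear in the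
unknown mass of order `m`: the derivatives are shared among three factors, and Sobolev's inequality
bounds those of order up to `m - 2` in terms of masses already controlled. -/
theorem sqBounded_replicate (h : SolvesNLS P N D D₀ q a) (m : ℕ) :
    SqBounded D (pds (List.replicate m 0) a) (resWeight P N 0) := by
  have hD := h.isOpen
  have hρ := h.pos
  have s0 : ∀ m, slowCount (List.replicate m (0 : Fin 4)) = 0 := fun m => by
    simp [slowCount, List.countP_replicate]
  induction m using Nat.strong_induction_on with
  | _ m ih =>
    rcases Nat.lt_or_ge m 2 with hm | hm
    · interval_cases m
      · exact h.sqBounded_zero_order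
      · exact h.sqBounded_pd_zero
    set l := List.replicate m (0 : Fin 4) with hl
    have hlen : l.length = m := List.length_replicate
    have hfast : ∀ b : List (Fin 4), b.length < m → slowCount b = 0 →
        SqBounded D (pds b a) (resWeight P N 0) := fun b hb h0 =>
      h.sqBounded_fast_of_replicate h0 (ih b.length hb)
    have hline : ∀ b : List (Fin 4), b.length + 2 ≤ m → slowCount b = 0 →
        LineBounded D (pds b a) (resWeight P N 0) := fun b hb h0 =>
      h.lineBounded (hfast b (by omega) h0) (hfast (0 :: b) (by simp; omega) (by
        rw [slowCount_cons, h0]; rfl))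
    have hself := (h.sqBounded_self l).mono
      (M' := fun z => mass (pds l a) z + resWeight P N 0 z)
      fun z hz => le_add_of_nonneg_right (resWeight_nonneg hρ 0 hz)
    -- The supremum of a derivative of order `m - 1` involves the mass of order `m`; it may occur
    -- once in a product, since it enters linearly.
    have hline' : ∀ b : List (Fin 4), b.length + 1 ≤ m → slowCount b = 0 →
        LineBounded D (pds b a) (fun z => mass (pds l a) z + resWeight P N 0 z) := by
      intro b hb h0
      refine h.lineBounded ((hfast b (by omega) h0).mono fun z _ =>
        le_add_of_nonneg_left (mass_nonneg _ _)) ?_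
      rcases Nat.lt_or_ge (b.length + 1) m with hb' | hb'
      · exact (hfast (0 :: b) (by simpa using hb') (by
          rw [slowCount_cons, h0]; rfl)).mono fun z _ => le_add_of_nonneg_left (mass_nonneg _ _)
      · refine h.sqBounded_fast_of_replicate (by rw [slowCount_cons, h0]; rfl) ?_
        rw [List.length_cons, show b.length + 1 = m by omega]
        exact hself
    have key : ∀ b₁ b₂ b₃ : List (Fin 4), slowCount b₁ = 0 → slowCount b₂ = 0 →
        slowCount b₃ = 0 → b₁.length + 2 ≤ m → b₂.length + 1 ≤ m → b₃.length + 1 ≤ m →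
        SqBounded D (pds b₁ a * pds b₂ a * pds b₃ a)
          (fun z => mass (pds l a) z + resWeight P N 0 z) :=
      fun b₁ b₂ b₃ e1 e2 e3 n1 n2 n3 => SqBounded.triple hD (h.smooth.pds hD _)
        (h.smooth.pds hD _) (h.smooth.pds hD _) (hline b₁ n1 e1) (hline' b₂ n2 e2)
        (hfast b₃ (by omega) e3) fun z _ => by simp
    have key' : ∀ b₁ b₂ : List (Fin 4), slowCount b₁ = 0 → slowCount b₂ = 0 →
        b₁.length = 0 → b₂.length = 0 →
        SqBounded D (pds b₁ a * pds b₂ a * pds l a)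
          (fun z => mass (pds l a) z + resWeight P N 0 z) :=
      fun b₁ b₂ e1 e2 n1 n2 => SqBounded.triple hD (h.smooth.pds hD _)
        (h.smooth.pds hD _) (h.smooth.pds hD _) (hline b₁ (by omega) e1)
        (hline b₂ (by omega) e2) hself fun z _ => by simp
    have := h.sqBounded_step l (fun b hb hs => by
      rw [hl, s0] at hs
      rw [show slowCount b = 0 by omega]
      exact hfast b (by omega) (by omega)) ?_
    · rwa [hl, s0] at this
    rw [hl, s0, ← hl, hlen]
    intro b₁ b₂ b₃ hs hn e1 e2 e3
    -- Either one factor takes all `m` derivatives and the others none, or all have at most `m - 1`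
    -- and one of them at most `m - 2`. The product is reordered accordingly.
    by_cases c3 : b₃.length = m
    · rw [e3 c3]; exact key' b₁ b₂ (by omega) (by omega) (by omega) (by omega)
    by_cases c2 : b₂.length = m
    · rw [e2 c2, mul_right_comm]
      exact key' b₁ b₃ (by omega) (by omega) (by omega) (by omega)
    by_cases c1 : b₁.length = m
    · rw [e1 c1, mul_assoc, mul_comm]
      exact key' b₂ b₃ (by omega) (by omega) (by omega) (by omega)
    by_cases d1 : b₁.length + 2 ≤ m
    · exact key b₁ b₂ b₃ (by omega) (by omega) (by omega) d1 (by omega) (by omega)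
    by_cases d2 : b₂.length + 2 ≤ m
    · rw [mul_comm (pds b₁ a)]
      exact key b₂ b₁ b₃ (by omega) (by omega) (by omega) d2 (by omega) (by omega)
    · rw [mul_comm, ← mul_assoc]
      exact key b₃ b₁ b₂ (by omega) (by omega) (by omega) (by omega) (by omega) (by omega)

/-- The number of slow derivatives is the outer induction variable and the length the inner one.
Sobolev's inequality adds a fast derivative, so suprema are available for fewer slow derivatives and
any length. As `s > 0`, at most one factor of the cubic term has all `s` slow derivatives, and it is
the one taken in `L²`. -/
theorem sqBounded_all (h : SolvesNLS P N D D₀ q a) (l : List (Fin 4)) :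
    SqBounded D (pds l a) (resWeight P N (slowCount l)) := by
  have hD := h.isOpen
  have hρ := h.pos
  induction hs : slowCount l using Nat.strong_induction_on generalizing l with
  | _ s ih =>
    rcases Nat.eq_zero_or_pos s with rfl | hs0
    · exact h.sqBounded_fast_of_replicate hs (h.sqBounded_replicate _)
    induction hm : l.length using Nat.strong_induction_on generalizing l with
    | _ m ihm =>
      have hline : ∀ b : List (Fin 4), slowCount b < s →
          LineBounded D (pds b a) (resWeight P N (slowCount b)) := by
        intro b hb
        have e : slowCount (0 :: b) = slowCount b := by rw [slowCount_cons]; rfl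
        exact h.lineBounded (ih _ hb b rfl) (ih _ hb (0 :: b) e)
      have hshort : ∀ b : List (Fin 4), b.length < m → slowCount b ≤ s →
          SqBounded D (pds b a) (resWeight P N (slowCount b)) := by
        intro b hb hbs
        rcases Nat.lt_or_ge (slowCount b) s with h' | h'
        · exact ih _ h' b rfl
        · have e : slowCount b = s := by omega
          rw [e]
          exact ihm _ hb b e rfl
      set M : ℝ × ℝ → ℝ := fun z => mass (pds l a) z + resWeight P N s z with hM
      have key : ∀ b₁ b₂ b₃ : List (Fin 4), slowCount b₁ + slowCount b₂ + slowCount b₃ = s →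
          b₁.length + b₂.length + b₃.length = m → (b₃.length = m → b₃ = l) →
          slowCount b₁ < s → slowCount b₂ < s → SqBounded D (pds b₁ a * pds b₂ a * pds b₃ a) M := by
        intro b₁ b₂ b₃ e n n3 s1 s2
        by_cases hb : b₃.length = m
        · obtain rfl : b₁ = [] := List.length_eq_zero_iff.1 (by omega)
          obtain rfl : b₂ = [] := List.length_eq_zero_iff.1 (by omega)
          rw [n3 hb]
          refine SqBounded.triple hD (h.smooth.pds hD _) (h.smooth.pds hD _) (h.smooth.pds hD _)
            (hline [] s1) (hline [] s2) (h.sqBounded_self l) fun z hz => ?_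
          have e0 : slowCount [] = 0 := rfl
          rw [e0, resWeight_zero, one_mul, one_mul]
          exact le_add_of_nonneg_right (resWeight_nonneg hρ _ hz)
        · refine SqBounded.triple hD (h.smooth.pds hD _) (h.smooth.pds hD _) (h.smooth.pds hD _)
            (hline b₁ s1) (hline b₂ s2) (hshort b₃ (by omega) (by omega)) fun z hz => ?_
          rw [resWeight_mul, resWeight_mul, ← add_assoc, e]
          exact le_add_of_nonneg_left (mass_nonneg _ _)
      have := h.sqBounded_step l (fun b hb hb' => hshort b (by omega) (by omega)) ?_
      · rwa [hs] at this
      rw [hs, hm]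
      intro b₁ b₂ b₃ e n n1 n2 n3
      by_cases d1 : slowCount b₁ = s
      · rw [mul_assoc, mul_comm]
        exact key b₂ b₃ b₁ (by omega) (by omega) n1 (by omega) (by omega)
      by_cases d2 : slowCount b₂ = s
      · rw [mul_right_comm]
        exact key b₁ b₃ b₂ (by omega) (by omega) n2 (by omega) (by omega)
      exact key b₁ b₂ b₃ e n n3 (by omega) (by omega)

theorem localized (h : SolvesNLS P N D D₀ q a) : Localized P N D 0 a :=
  Localized.of_sq h.om_sq h.isOpen h.pos h.smooth h.zeta h.dec fun l => by
    rw [zero_add]; exact h.sqBounded_all l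

end SolvesNLS

end Nonlinear

/-! ### The carrier amplitudes of localized wave packets. -/

section Carriers

variable {P : Driver} {N : ℕ} {D : Set (ℝ × ℝ)}

/-- The source of the linearized equation of order `n`. -/
theorem localized_carrierTerms (hS : ContDiff ℝ ∞ P.S) (hD : IsOpen D)
    (hSb : ∀ i : ℕ, 1 ≤ i → ∃ C : ℝ, ∀ z ∈ D, ‖iteratedFDeriv ℝ i P.S z‖ ≤ C)
    (hρ : ∀ z ∈ D, 0 < resDist P N z) {u : Family} (ha : IsAnsatz D N u)
    (halg : AlgebraicEqs P D N u) {n : ℕ} (hn : 2 ≤ n) (hnN : n ≤ N)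
    (hcar : ∀ m, 1 ≤ m → m < n → Localized P N D (m - 1) (u m (1, 0))) :
    Localized P N D n (carrierTerms P (dropCarrier n u) n) := by
  have hcl := ampClass_localized hD hρ
  set v := dropCarrier n u with hv
  have hlow : ∀ m, 1 ≤ m → m < n → ∀ p, Localized P N D (m - 1) (v m p) := by
    intro m hm hmn p
    rw [hv, dropCarrier_of_ne (by omega)]
    exact hcl.all_modes hS hD hSb hρ ha halg hm (by omega)
      (fun q h1 h2 => hcar q h1 (by omega)) p
  have hv0 : ∀ p, Set.EqOn (v 0 p) 0 (dom D) := by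
    intro p
    rw [hv, dropCarrier_of_ne (by omega)]
    exact ha.zero p
  have hall : ∀ m, 1 ≤ m → m ≤ n → ∀ p, Localized P N D (m - 1) (v m p) := by
    intro m hm hmn p
    rcases Nat.lt_or_ge m n with h | h
    · exact hlow m hm h p
    obtain rfl : m = n := by omega
    by_cases e1 : p = (1, 0)
    · rw [e1, hv, dropCarrier_carrier]; exact hcl.zero _
    by_cases e2 : p = (-1, 0)
    · rw [e2, hv, dropCarrier_neg_carrier]; exact hcl.zero _
    rw [hv, dropCarrier_of_mode e1 e2]
    exact hcl.noncarrier hS hD hSb hρ ha halg hm hnN (fun q h1 h2 => hcar q h1 h2) e1 e2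
  -- The sidebands of order `n + 1` have order `n`, one more than the exponent `n - 1` of the
  -- amplitude to be estimated.
  have hd : ∀ m : ℤ, (m = 1 ∨ m = -1) → Localized P N D n (algAmp P v (n + 1) (1, m)) :=
    fun m hm => hcl.algAmp hS hD hSb hρ (m := n + 1) (by omega) hv0
      (fun q h1 h2 p => hall q h1 (by omega) p) (sideband_mem_drivenModes N hm)
  have hc : Localized P N D n (cubic v (n + 2) (1, 0)) :=
    hcl.mono (hcl.cubic (n := n + 2) (1, 0) fun q h1 h2 p => hall q h1 (by omega) p) (by omega)
  have hder : ∀ k, ∀ l : List (Fin 4), slowCount l ≤ k + 1 →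
      Localized P N D n (pds l (v (n - k) (1, 0))) := by
    intro k l hl
    rcases Nat.eq_zero_or_pos (n - k) with h0 | h0
    · rw [h0]
      exact hcl.congr (hcl.zero _) (pds_eqOn_zero hD (hv0 _) l).symm
    · exact hcl.mono (hcl.pds (hall (n - k) h0 (by omega) (1, 0)) l) (by omega)
  have k := fun c : ℂ => bddCoef_const (D := D) c
  have c1 := hcl.bdd hρ (k (P.f / 2)) (hd 1 (Or.inl rfl))
  have c2 := hcl.bdd hρ (k (P.f / 2)) (hd (-1) (Or.inr rfl))
  have c3 := hcl.bdd hρ (k P.γ) hc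
  have c4 := hcl.bdd hρ (k 2) (hder 1 [1, 3] (by simp [slowCount]))
  have c5 := hcl.bdd hρ (k (-2)) (hder 1 [0, 2] (by simp [slowCount]))
  have c6 := hder 2 [3, 3] (by simp [slowCount])
  have c7 := hcl.bdd hρ (k (-1)) (hder 2 [2, 2] (by simp [slowCount]))
  refine hcl.congr (hcl.add (hcl.add (hcl.add (hcl.add (hcl.add (hcl.add c1 c2) c3) c4) c5) c6) c7)
    fun y _ => ?_
  simp only [Pi.add_apply, Pi.mul_apply, pds_cons, pds_nil, carrierTerms]
  ring

/-- The amplitudes of localized wave packets, if the group lines are transversal to the resonant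
curves. -/
theorem localized_carrier (hS : ContDiff ℝ ∞ P.S) (hom : P.om ^ 2 = P.k ^ 2 + 1) (hD : IsOpen D)
    (hSb : ∀ i : ℕ, 1 ≤ i → ∃ C : ℝ, ∀ z ∈ D, ‖iteratedFDeriv ℝ i P.S z‖ ≤ C)
    (hρ : ∀ z ∈ D, 0 < resDist P N z) {u : Family} {D₀ : Set (ℝ × ℝ)} (hD₀ : D₀ ⊆ D)
    (htr : TransversalFrom P N D D₀) (ha : IsAnsatz D N u) (halg : AlgebraicEqs P D N u)
    (hz : CarrierZeta P D N u) (hc : CarrierEqs P D N u)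
    (hdec : ∀ n, 1 ≤ n → n ≤ N → LocallyDecaying P D (u n (1, 0)))
    (hdata : ∀ n, 1 ≤ n → n ≤ N → DecayingData P N D₀ (n - 1) (u n (1, 0)))
    {n : ℕ} (hn : 1 ≤ n) (hnN : n ≤ N) : Localized P N D (n - 1) (u n (1, 0)) := by
  have hcl := ampClass_localized hD hρ
  have hq : IsCoef P N D 1 (fun y => ((P.f ^ 2 / 4 * gFun P (slow y) : ℝ) : ℂ)) := by
    have h1 := ((bddCoef_const (D := D) ((P.f ^ 2 / 4 : ℝ) : ℂ)).isCoef hρ 0).mul hρ hD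
      (isCoef_gFun hS hD hSb hρ)
    rw [zero_add] at h1
    convert h1 using 1
    funext y
    simp
  have htran : ∀ n, 1 ≤ n → n ≤ N → Transported P N D D₀ (n - 1) (u n (1, 0)) :=
    fun n h1 h2 => ⟨hom, hD, hρ, hD₀, htr, ha.smooth n h2 _, hdec n h1 h2, hdata n h1 h2⟩
  have hsq : ∀ y, ((‖u 1 (1, 0) y‖ ^ 2 : ℝ) : ℂ) = u 1 (1, 0) y * (starRingEnd ℂ) (u 1 (1, 0) y) :=
    fun y => by rw [Complex.mul_conj, Complex.normSq_eq_norm_sq]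
  induction n using Nat.strong_induction_on with
  | _ n ih =>
    rcases Nat.lt_or_ge n 2 with h2 | h2
    · obtain rfl : n = 1 := by omega
      refine SolvesNLS.localized (D₀ := D₀) ⟨htran 1 le_rfl hnN, hz 1 le_rfl hnN, hq, fun y hy => ?_⟩
      have h1 := hc.1 hnN y hy
      rw [dzeta_dzeta_eq hD (ha.smooth 1 hnN _) hy, hsq] at h1
      simp only [Pi.mul_apply, cconj]
      push_cast
      linear_combination h1
    · have hcar : ∀ m, 1 ≤ m → m < n → Localized P N D (m - 1) (u m (1, 0)) :=
        fun m h1 h2 => ih m h2 h1 (by omega)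
      have hR := localized_carrierTerms hS hD hSb hρ ha halg h2 hnN hcar
      have h1 : Localized P N D 0 (u 1 (1, 0)) := hcar 1 le_rfl (by omega)
      have k := fun c : ℂ => bddCoef_const (D := D) c
      -- The coefficients of the linearization, `6 γ |u₁|²` and `3 γ u₁²`, have order zero because
      -- the leading amplitude has.
      have hV := hcl.bdd hρ (k (6 * P.γ)) (hcl.mul h1 (hcl.conj h1))
      have hW := hcl.bdd hρ (k (3 * P.γ)) (hcl.mul h1 h1)
      refine (htran n hn hnN).localized_linear (by omega) (hz n hn hnN) hq hV hW
        (by rwa [Nat.sub_add_cancel hn]) fun y hy => ?_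
      have h3 := hc.2 n h2 hnN y hy
      rw [dzeta_dzeta_eq hD (ha.smooth n hnN _) hy, hsq] at h3
      simp only [Pi.mul_apply, Pi.add_apply, cconj]
      push_cast
      linear_combination h3

end Carriers

end WKB
-- The theorem.
theorem theorem2 (P : Driver) (hom : P.om ^ 2 = P.k ^ 2 + 1)
    (hS : ContDiff ℝ ∞ P.S)
    (D : Set (ℝ × ℝ)) (hD : IsOpen D)
    (hSb : ∀ i : ℕ, 1 ≤ i → ∃ C : ℝ, ∀ z ∈ D, ‖iteratedFDeriv ℝ i P.S z‖ ≤ C)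
    (hl : ∀ z ∈ D, ell P z < 0)
    (N : ℕ) (hN : 1 ≤ N)
    (hres : ∀ z ∈ D, ∀ p ∈ drivenModes N, eikonal (phase P p) z ≠ 0) :
    -- the carrier amplitudes determine all others through the algebraic equations
    (∀ a : ℕ → Amp, (∀ n, ContDiffOn ℝ ∞ (a n) (dom D)) →
      ∃ u : Family, (IsAnsatz D N u ∧ AlgebraicEqs P D N u ∧
          ∀ n, 1 ≤ n → n ≤ N → Set.EqOn (u n (1, 0)) (a n) (dom D)) ∧
        ∀ u' : Family, (IsAnsatz D N u' ∧ AlgebraicEqs P D N u' ∧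
            ∀ n, 1 ≤ n → n ≤ N → Set.EqOn (u' n (1, 0)) (a n) (dom D)) →
          ∀ n ≤ N, ∀ p, Set.EqOn (u' n p) (u n p) (dom D)) ∧
    -- an expansion with bounded carrier amplitudes solves the recurrent system up to the
    -- order `N` exactly if its amplitudes satisfy the equations
    (∀ u : Family, IsAnsatz D N u →
      (∀ n ≤ N, ∀ z ∈ D, ∃ C : ℝ, ∀ y, slow y = z → ‖u n (1, 0) y‖ ≤ C) →
      (IsFormalSolution P D N u ↔
        AlgebraicEqs P D N u ∧ CarrierZeta P D (N - 1) u ∧ CarrierEqs P D (N - 2) u)) ∧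
    -- validity for `ε⁻¹ |L[χ_{j,m}]| ≫ 1`
    (∀ u : Family, IsAnsatz D N u → AlgebraicEqs P D N u →
      CarrierZeta P D N u → CarrierEqs P D N u →
      (∀ n, 1 ≤ n → n ≤ N → SingularOrder P N D (n - 1) (u n (1, 0))) →
      (∀ n, 1 ≤ n → n ≤ N → ∀ p, SingularOrder P N D (n - 1) (u n p)) ∧
      ∃ C : ℝ, ∀ ε x t : ℝ, 0 < ε → (ε ^ 2 * x, ε ^ 2 * t) ∈ D →
        ε ≤ resDist P N (ε ^ 2 * x, ε ^ 2 * t) →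
        (wkb P u N ε x t).im = 0 ∧
        (∀ n, 1 ≤ n → n ≤ N → ‖(ε : ℂ) ^ n * wkbTerm P u n ε x t‖ ≤
          C * ε * (ε / resDist P N (ε ^ 2 * x, ε ^ 2 * t)) ^ (n - 1)) ∧
        ‖kleinGordon P ε (wkb P u N ε) x t‖ ≤
          C * ε ^ 2 * (ε / resDist P N (ε ^ 2 * x, ε ^ 2 * t)) ^ (N - 1)) ∧
    -- the carrier amplitudes have the required size if they are localized wave packets and if
    -- the group lines are transversal to the resonant curves
    (∀ (u : Family) (D₀ : Set (ℝ × ℝ)), D₀ ⊆ D → TransversalFrom P N D D₀ →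
      IsAnsatz D N u → AlgebraicEqs P D N u →
      CarrierZeta P D N u → CarrierEqs P D N u →
      (∀ n, 1 ≤ n → n ≤ N → LocallyDecaying P D (u n (1, 0))) →
      (∀ n, 1 ≤ n → n ≤ N → DecayingData P N D₀ (n - 1) (u n (1, 0))) →
      ∀ n, 1 ≤ n → n ≤ N → SingularOrder P N D (n - 1) (u n (1, 0))) := by
  have hρ : ∀ z ∈ D, 0 < resDist P N z := fun z hz => resDist_pos P N (hres z hz)
  refine ⟨fun a ha => existsUnique_algebraic hS hD hSb hρ a ha,
    fun u ha hb => isFormalSolution_iff hS hom hD hSb hres ha hb,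
    fun u ha halg hz hc hs => validity hS hom hD hSb hN hres ha halg hz hc hs, ?_⟩
  intro u D₀ hD₀ htr ha halg hz hc hdec hdata n hn hnN
  exact (localized_carrier hS hom hD hSb hρ hD₀ htr ha halg hz hc hdec hdata hn hnN).sing
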